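/- **Definitions.** A *natural domain* is a connected open set $\Omega\subset\mathbb R^d$ with $\Omega=\operatorname{int}(\overline\Omega)$. Let $\mathbf w=(w_1,\dots,w_d)$ be positive real weights; the weighted degree of a polynomial is $\deg_{\mathbf w}\big(\sum_k a_kx^k\big)=\max_{a_k\neq0}\sum_i w_ik_i$. Let $\Omega\subset\mathbb R^d$ be a natural domain, $g=(g^{ij})$ a continuous function on $\Omega$ with values in the positive definite symmetric real matrices, and $\rho\ge 0$ a continuous function on $\Omega$ such that $\mu=\rho\,dx$ is a probability measure on $\Omega$ and the polynomials lie, and are dense, in $L^2(\Omega,\mu)$. The triple $(\Omega,g,\rho)$ is a *solution of the $\mathbf w$-SDOP problem* if there are continuous functions $b^1,\dots,b^d$ on $\Omega$ such that, for $L f=\sum_{i,j}g^{ij}\partial_{ij}f+\sum_i b^i\partial_if$: * for every real $n$, the space $\{P\in\mathbb R[x_1,\dots,x_d]:\deg_{\mathbf w}P\le n\}$ has a basis which is orthogonal in $L^2(\Omega,\mu)$ and consists of eigenvectors of $L$; * $\int_\Omega f_1\,Lf_2\,d\mu=\int_\Omega f_2\,Lf_1\,d\mu$ for all smooth functions $f_1,f_2$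 with compact support in $\mathbb R^d$. For $d=2$, a *solution of the $(1,\infty)$-SDOP problem* is a solution of the $(1,w)$-SDOP problem for some real $w>2$. A *$(1,\infty)$-admissible change of variables* is a map $\Phi(x,y)=(\alpha x+\beta,\ \gamma y+p(x))$ with $\alpha,\beta,\gamma\in\mathbb R$, $\alpha\gamma\ne0$, and $p\in\mathbb R[x]$ arbitrary; it transforms $(\Omega,g,\rho)$ into the triple formed by $\Phi(\Omega)$, the cometric $\big(D\Phi\; g\; D\Phi^{\mathsf T}\big)\circ\Phi^{-1}$ and the density $\big(\rho/|\det D\Phi|\big)\circ\Phi^{-1}$. Below, densities other than $\rho_1(x)\rho_2(y)$ are written without the normalizing constant $1/\int_\Omega\rho$. **Theorem 6.4.** Let $(\Omega,g,\rho)$ be a solution of the $(1,\infty)$-SDOP problem in $\mathbb R^2$ with $\Omega$ unbounded. Then, after a suitable $(1,\infty)$-admissible change of variables, one of the following holds. * **(U1)** For some integer $n\ge1$ and some real $c_{02}\le0$, one has $\Omega=\{x>0,\ x^n>y^2\}$ and $$g=\begin{pmatrix} x & \tfrac12ny\\ \tfrac12ny & \tfrac14n^2x^{n-1}-c_{02}(x^n-y^2)\end{pmatrix}\quad\text{on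 }\Omega,$$ and: * if $n$ is odd, $\rho=(x^n-y^2)^{p-1}e^{-\lambda x}$ with $\lambda>0$ and $p>\max\big(0,\tfrac12-\tfrac1n\big)$; * if $n$ is even, $\rho=(x^{n/2}+y)^{p-1}(x^{n/2}-y)^{q-1}e^{-\lambda x}$ with $\lambda>0$, $p>0$, $q>0$ and $p+q>1-\tfrac2n$. * **(U2)** $\Omega=\Omega_1\times\Omega_2$, $g=\operatorname{diag}\big(\alpha g_1(x),\beta g_2(y)\big)$ with $\alpha,\beta>0$, and $\rho=\rho_1(x)\rho_2(y)$, where, for each $k=1,2$, the triple $(\Omega_k,g_k,\rho_k)$ is one of the following three (with $\rho_k$ normalized to have integral $1$): * Hermite: $\Omega_k=\mathbb R$, $g_k(t)=1$, $\rho_k(t)=Ce^{-t^2/2}$; * Laguerre: $\Omega_k=(0,\infty)$, $g_k(t)=t$, $\rho_k(t)=C_at^{a-1}e^{-t}$ with $a>0$; * Jacobi: $\Omega_k=(-1,1)$, $g_k(t)=1-t^2$, $\rho_k(t)=C_{p,q}(1-t)^{p-1}(1+t)^{q-1}$ with $p,q>0$. -/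

import Mathlib

open scoped ContDiff

noncomputable section

/-- Natural domain: a connected open set that is the interior of its closure. -/
def IsNaturalDomain {d : ℕ} (Ω : Set (Fin d → ℝ)) : Prop :=
  IsOpen Ω ∧ IsConnected Ω ∧ interior (closure Ω) = Ω

/-- The space of real polynomials in `d` variables whose `w`-weighted degree is at most `n`. -/
def weightedPolys {d : ℕ} (w : Fin d → ℝ) (n : ℝ) : Submodule ℝ (MvPolynomial (Fin d) ℝ) :=
  MvPolynomial.restrictSupport ℝ {k : Fin d →₀ ℕ | ∑ i, w i * (k i : ℝ) ≤ n}

/-- The function on `ℝ^d` defined by a polynomial. -/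
def polyFun {d : ℕ} (P : MvPolynomial (Fin d) ℝ) (x : Fin d → ℝ) : ℝ :=
  MvPolynomial.eval x P

/-- The partial derivative `∂_i f`. -/
def partialDeriv {d : ℕ} (i : Fin d) (f : (Fin d → ℝ) → ℝ) (x : Fin d → ℝ) : ℝ :=
  fderiv ℝ f x (Pi.single i 1)

/-- The operator `L f = ∑ g^{ij} ∂_{ij} f + ∑ b^i ∂_i f`. -/
def diffOp {d : ℕ} (g : (Fin d → ℝ) → Matrix (Fin d) (Fin d) ℝ)
    (b : (Fin d → ℝ) → Fin d → ℝ) (f : (Fin d → ℝ) → ℝ) (x : Fin d → ℝ) : ℝ :=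
  (∑ i, ∑ j, g x i j * partialDeriv i (partialDeriv j f) x) + ∑ i, b x i * partialDeriv i f x

/-- The measure `ρ dx` on `Ω`. -/
def densityMeasure {d : ℕ} (Ω : Set (Fin d → ℝ)) (ρ : (Fin d → ℝ) → ℝ) :
    MeasureTheory.Measure (Fin d → ℝ) :=
  (MeasureTheory.volume.restrict Ω).withDensity (fun x => ENNReal.ofReal (ρ x))

/-- `(Ω, L, μ)` is a solution of the Diffusion Orthogonal Polynomial problem with weights `w`,
where `L` has second order coefficients `g` and first order coefficients `b`, and `μ = ρ dx`.
Only the values of `g`, `b`, `ρ` on `Ω` are relevant. -/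
structure IsDOPSolution {d : ℕ} (w : Fin d → ℝ) (Ω : Set (Fin d → ℝ))
    (g : (Fin d → ℝ) → Matrix (Fin d) (Fin d) ℝ) (b : (Fin d → ℝ) → Fin d → ℝ)
    (ρ : (Fin d → ℝ) → ℝ) : Prop where
  weights_pos : ∀ i, 0 < w i
  naturalDomain : IsNaturalDomain Ω
  continuousOn_g : ∀ i j, ContinuousOn (fun x => g x i j) Ω
  continuousOn_b : ∀ i, ContinuousOn (fun x => b x i) Ω
  /-- Ellipticity; positive definiteness includes the symmetry of the matrix. -/
  elliptic : ∀ x ∈ Ω, (g x).PosDef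
  continuousOn_density : ContinuousOn ρ Ω
  density_nonneg : ∀ x ∈ Ω, 0 ≤ ρ x
  probability : MeasureTheory.IsProbabilityMeasure (densityMeasure Ω ρ)
  /-- The polynomials form a subspace of `L²(Ω, μ)` ... -/
  poly_memLp : ∀ P : MvPolynomial (Fin d) ℝ,
    MeasureTheory.MemLp (polyFun P) 2 (densityMeasure Ω ρ)
  /-- ... which is dense. -/
  poly_dense : ∀ f : (Fin d → ℝ) → ℝ, MeasureTheory.MemLp f 2 (densityMeasure Ω ρ) →
    ∀ ε : ENNReal, 0 < ε → ∃ P : MvPolynomial (Fin d) ℝ,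
      MeasureTheory.eLpNorm (fun x => f x - polyFun P x) 2 (densityMeasure Ω ρ) < ε
  /-- Every space of polynomials of bounded weighted degree has an orthogonal basis
  of eigenvectors of `L`. -/
  eigenbasis : ∀ n : ℝ, ∃ (ι : Type) (e : Module.Basis ι ℝ (weightedPolys w n)),
    (∀ s t, s ≠ t → ∫ x, polyFun (e s).1 x * polyFun (e t).1 x ∂(densityMeasure Ω ρ) = 0) ∧
    ∀ s, ∃ c : ℝ, ∀ x ∈ Ω, diffOp g b (polyFun (e s).1) x = c * polyFun (e s).1 x

/-- A solution of the Strong DOP problem: in addition, `L` is symmetric on the smooth functions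
with compact support in the whole of `ℝ^d`. -/
structure IsSDOPSolution {d : ℕ} (w : Fin d → ℝ) (Ω : Set (Fin d → ℝ))
    (g : (Fin d → ℝ) → Matrix (Fin d) (Fin d) ℝ) (b : (Fin d → ℝ) → Fin d → ℝ)
    (ρ : (Fin d → ℝ) → ℝ) : Prop extends IsDOPSolution w Ω g b ρ where
  symmetric : ∀ f₁ f₂ : (Fin d → ℝ) → ℝ, ContDiff ℝ ∞ f₁ → ContDiff ℝ ∞ f₂ →
    HasCompactSupport f₁ → HasCompactSupport f₂ →
    ∫ x, f₁ x * diffOp g b f₂ x ∂(densityMeasure Ω ρ) =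
      ∫ x, f₂ x * diffOp g b f₁ x ∂(densityMeasure Ω ρ)

/-- The triple `(Ω, g, ρ)` is a solution of the `w`-SDOP problem: for some first order
coefficients `b`, the operator `L` with coefficients `(g, b)` gives a solution. -/
def IsSDOPTriple {d : ℕ} (w : Fin d → ℝ) (Ω : Set (Fin d → ℝ))
    (g : (Fin d → ℝ) → Matrix (Fin d) (Fin d) ℝ) (ρ : (Fin d → ℝ) → ℝ) : Prop :=
  ∃ b : (Fin d → ℝ) → Fin d → ℝ, IsSDOPSolution w Ω g b ρ

/-- A solution of the `(1,∞)`-SDOP problem: a solution of the `(1,w)`-SDOP problem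
for some `w > 2`. -/
def IsInftySDOPTriple (Ω : Set (Fin 2 → ℝ)) (g : (Fin 2 → ℝ) → Matrix (Fin 2) (Fin 2) ℝ)
    (ρ : (Fin 2 → ℝ) → ℝ) : Prop :=
  ∃ w : ℝ, 2 < w ∧ IsSDOPTriple ![1, w] Ω g ρ

/-- `(1,∞)`-admissible changes of variables `(x,y) ↦ (αx+β, γy+p(x))`, `αγ ≠ 0`,
with an arbitrary polynomial `p`. -/
def IsInftyAdmissible (Φ : (Fin 2 → ℝ) ≃ (Fin 2 → ℝ)) : Prop :=
  ∃ (α β γ : ℝ) (p : Polynomial ℝ), α ≠ 0 ∧ γ ≠ 0 ∧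
    ∀ x : Fin 2 → ℝ, Φ x = ![α * x 0 + β, γ * x 1 + p.eval (x 0)]

/-- The Jacobian matrix `(∂_k Φ_i)` at `x`. -/
def jacobian {d : ℕ} (Φ : (Fin d → ℝ) → (Fin d → ℝ)) (x : Fin d → ℝ) :
    Matrix (Fin d) (Fin d) ℝ :=
  Matrix.of fun i k => partialDeriv k (fun z => Φ z i) x

/-- The second order coefficients of the operator `f ↦ L(f ∘ Φ) ∘ Φ⁻¹`. -/
def pushCometric {d : ℕ} (Φ : (Fin d → ℝ) ≃ (Fin d → ℝ))
    (g : (Fin d → ℝ) → Matrix (Fin d) (Fin d) ℝ) (X : Fin d → ℝ) : Matrix (Fin d) (Fin d) ℝ :=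
  jacobian Φ (Φ.symm X) * g (Φ.symm X) * (jacobian Φ (Φ.symm X)).transpose

/-- The density of the image of the measure `ρ dx` under `Φ`. -/
def pushDensity {d : ℕ} (Φ : (Fin d → ℝ) ≃ (Fin d → ℝ)) (ρ : (Fin d → ℝ) → ℝ)
    (X : Fin d → ℝ) : ℝ :=
  ρ (Φ.symm X) / |(jacobian Φ (Φ.symm X)).det|

/-- On `Ω`, the function `ρ` is `f` times the normalizing constant `1 / ∫_Ω f`. -/
def IsNormalizationOn {E : Type*} [MeasureTheory.MeasureSpace E] (Ω : Set E) (ρ f : E → ℝ) :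
    Prop :=
  ∀ x ∈ Ω, ρ x = f x / ∫ y in Ω, f y

/-- The three classical one-dimensional solutions, normalized as usual: `I` is the domain,
`γ` the coefficient of `∂²` and `ρ` the probability density (on `I`). -/
def IsClassicalSolution (I : Set ℝ) (γ ρ : ℝ → ℝ) : Prop :=
  -- Hermite
  (I = Set.univ ∧ (∀ t ∈ I, γ t = 1) ∧
    IsNormalizationOn I ρ (fun t => Real.exp (-t ^ 2 / 2))) ∨
  -- Laguerre
  (I = Set.Ioi 0 ∧ (∀ t ∈ I, γ t = t) ∧
    ∃ a : ℝ, 0 < a ∧ IsNormalizationOn I ρ (fun t => t ^ (a - 1) * Real.exp (-t))) ∨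
  -- Jacobi
  (I = Set.Ioo (-1) 1 ∧ (∀ t ∈ I, γ t = 1 - t ^ 2) ∧
    ∃ p q : ℝ, 0 < p ∧ 0 < q ∧
      IsNormalizationOn I ρ (fun t => (1 - t) ^ (p - 1) * (1 + t) ^ (q - 1)))

/-- Case (U1): the domain `x > 0, x^n > y²`. -/
def IsCaseU1 (Ω : Set (Fin 2 → ℝ)) (g : (Fin 2 → ℝ) → Matrix (Fin 2) (Fin 2) ℝ)
    (ρ : (Fin 2 → ℝ) → ℝ) : Prop :=
  ∃ (n : ℕ) (c : ℝ), 1 ≤ n ∧ c ≤ 0 ∧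
    Ω = {X | 0 < X 0 ∧ X 1 ^ 2 < X 0 ^ n} ∧
    (∀ X ∈ Ω, g X =
      !![X 0, (n : ℝ) / 2 * X 1;
         (n : ℝ) / 2 * X 1, (n : ℝ) ^ 2 / 4 * X 0 ^ (n - 1) - c * (X 0 ^ n - X 1 ^ 2)]) ∧
    ((Odd n ∧ ∃ p l : ℝ, 0 < l ∧ max 0 (1 / 2 - 1 / (n : ℝ)) < p ∧
        IsNormalizationOn Ω ρ (fun X =>
          (X 0 ^ n - X 1 ^ 2) ^ (p - 1) * Real.exp (-l * X 0))) ∨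
     (Even n ∧ ∃ p q l : ℝ, 0 < l ∧ 0 < p ∧ 0 < q ∧ 1 - 2 / (n : ℝ) < p + q ∧
        IsNormalizationOn Ω ρ (fun X =>
          (X 0 ^ (n / 2) + X 1) ^ (p - 1) * (X 0 ^ (n / 2) - X 1) ^ (q - 1) *
            Real.exp (-l * X 0))))

/-- Case (U2): a product of two classical one-dimensional solutions, the two operators being
multiplied by positive constants. -/
def IsCaseU2 (Ω : Set (Fin 2 → ℝ)) (g : (Fin 2 → ℝ) → Matrix (Fin 2) (Fin 2) ℝ)
    (ρ : (Fin 2 → ℝ) → ℝ) : Prop :=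
  ∃ (I₁ I₂ : Set ℝ) (γ₁ γ₂ ρ₁ ρ₂ : ℝ → ℝ) (α β : ℝ),
    IsClassicalSolution I₁ γ₁ ρ₁ ∧ IsClassicalSolution I₂ γ₂ ρ₂ ∧ 0 < α ∧ 0 < β ∧
    Ω = {X | X 0 ∈ I₁ ∧ X 1 ∈ I₂} ∧
    (∀ X ∈ Ω, g X = !![α * γ₁ (X 0), 0; 0, β * γ₂ (X 1)]) ∧
    (∀ X ∈ Ω, ρ X = ρ₁ (X 0) * ρ₂ (X 1))

end

open scoped ContDiff

namespace SDOP

open MeasureTheory Set Filter Topology Polynomial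

/-! ### Polynomial functions under the operator, and the polynomial shape of its coefficients -/

section Polynomials

/-! Invariance of the weighted polynomial spaces, with `w > 2`, forces g¹¹ = A(x), g¹² = l(x) y +
r(x), g²² = c y² + m(x) y + s(x), with drift β(x) and e y + B(x), where deg A ≤ 2 and deg l, deg β ≤
1. Symmetry against all compactly supported functions of the plane gives div(ρ g) = ρ b weakly on
the whole plane, with ρ extended by zero (`integral_coord_eq_zero`); the boundary conditions are
hidden in the fact that test functions need not vanish on the boundary of Ω.

The first component of this equation is transport along the field A ∂ₓ + (l y + r) ∂ᵧ. In
coordinates x, u = E(x) y - F(x), with u constant along the field, it is an ODE in x alone, so the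
density splits as k(x) h(u) (`exists_separation`). Eliminating the x-derivative between the two
components leaves an equation in y alone with leading coefficient det g. Hence for every x the same
function h solves a Pearson equation (D h)' = t h with D quadratic and t affine; integrating out y
shows that k solves (A k)' = β k. A Pearson weight with all moments is Hermite, Laguerre or Jacobi
up to an affine map (`pearson_normal`). Since h does not depend on x, its quadratics for different x
are proportional, so that det g = K(x) D₂(E y - F), with a similar formula for the drift
(`exists_splitForm`).

Comparing coefficients in y makes F/E and suitable powers of E rational in x. They solve linear
equations of the form A q' = l q + r; as A is squarefree, counting pole orders rules out
denominators (`isUnit_of_riccati`), so F/E is a polynomial Q, and y - Q(x) is an admissible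
coordinate.

If l = 0, then E is constant and the solution is a product (U2). If l ≠ 0, the vertical family must
be Jacobi: otherwise the y² coefficient of det g vanishes, A and l are constants, and the
exponential E, or its square, would be rational. Then R = 1/E² is a polynomial with A R' = 2 l R,
and Ω is given by (y - Q)² < R over an interval of the x-axis. A constant A is impossible, a Jacobi
A gives a bounded Ω, and an affine A gives R = const · (x - x₀)ⁿ, which is the cusp (U1). The
conditions on the exponents come from comparing the drift with det g (`exists_cusp`). -/

lemma contDiff_polyFun {d : ℕ} (P : MvPolynomial (Fin d) ℝ) : ContDiff ℝ ∞ (polyFun P) := by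
  unfold polyFun
  induction P using MvPolynomial.induction_on with
  | C a => simpa using contDiff_const
  | add p q hp hq => simpa using hp.add hq
  | mul_X p i hp => simpa using hp.mul (contDiff_apply ℝ ℝ i)

lemma partialDeriv_polyFun {d : ℕ} (i : Fin d) (P : MvPolynomial (Fin d) ℝ) :
    partialDeriv i (polyFun P) = polyFun (MvPolynomial.pderiv i P) := by
  funext x
  unfold partialDeriv
  induction P using MvPolynomial.induction_on with
  | C a =>
    have : polyFun (MvPolynomial.C a : MvPolynomial (Fin d) ℝ) = fun _ => a := by
      funext y; simp [polyFun]
    rw [this]; simp [polyFun]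
  | add p q hp hq =>
    have : polyFun (p + q) = polyFun p + polyFun q := by funext y; simp [polyFun]
    rw [this, fderiv_add ((contDiff_polyFun p).differentiable (by simp) x)
      ((contDiff_polyFun q).differentiable (by simp) x)]
    rw [_root_.add_apply, hp, hq]; simp [polyFun]
  | mul_X p j hp =>
    have : polyFun (p * MvPolynomial.X j) = fun y => polyFun p y * y j := by
      funext y; simp [polyFun]
    have h2 : HasFDerivAt (fun y : Fin d → ℝ => y j) (ContinuousLinearMap.proj j) x :=
      (ContinuousLinearMap.proj (R := ℝ) (φ := fun _ : Fin d => ℝ) j).hasFDerivAt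
    have h1 := ((contDiff_polyFun p).differentiable (by simp) x).hasFDerivAt
    rw [this, show (fun y => polyFun p y * y j) = polyFun p * fun y => y j from rfl, (h1.mul h2).fderiv]
    simp only [_root_.add_apply, _root_.smul_apply, smul_eq_mul, hp]
    simp [polyFun, MvPolynomial.pderiv_X, Pi.single_apply]
    split_ifs with h <;> simp_all

lemma diffOp_polyFun {d : ℕ} (g : (Fin d → ℝ) → Matrix (Fin d) (Fin d) ℝ)
    (b : (Fin d → ℝ) → Fin d → ℝ) (P : MvPolynomial (Fin d) ℝ) (x : Fin d → ℝ) :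
    diffOp g b (polyFun P) x =
      (∑ i, ∑ j, g x i j * polyFun (MvPolynomial.pderiv i (MvPolynomial.pderiv j P)) x) +
        ∑ i, b x i * polyFun (MvPolynomial.pderiv i P) x := by
  simp only [diffOp, partialDeriv_polyFun]

lemma diffOp_polyFun_add_smul {d : ℕ} (g : (Fin d → ℝ) → Matrix (Fin d) (Fin d) ℝ)
    (b : (Fin d → ℝ) → Fin d → ℝ) (P Q : MvPolynomial (Fin d) ℝ) (a : ℝ) (x : Fin d → ℝ) :
    diffOp g b (polyFun (P + a • Q)) x =
      diffOp g b (polyFun P) x + a * diffOp g b (polyFun Q) x := by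
  simp only [diffOp_polyFun, polyFun, map_add, mul_add,
    Finset.sum_add_distrib, MvPolynomial.smul_eval, Derivation.map_smul, Finset.mul_sum]
  have : ∀ u v w : ℝ, u * (v * w) = v * (u * w) := fun u v w => by ring
  simp only [this _ a]
  ring

/-- The operator maps the space of polynomials of weighted degree at most `n` into itself. -/
lemma exists_diffOp_eq {d : ℕ} {w : Fin d → ℝ} {Ω : Set (Fin d → ℝ)}
    {g : (Fin d → ℝ) → Matrix (Fin d) (Fin d) ℝ} {b : (Fin d → ℝ) → Fin d → ℝ}
    {ρ : (Fin d → ℝ) → ℝ} (h : IsDOPSolution w Ω g b ρ) (n : ℝ)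
    (P : MvPolynomial (Fin d) ℝ) (hP : P ∈ weightedPolys w n) :
    ∃ Q ∈ weightedPolys w n, ∀ x ∈ Ω, diffOp g b (polyFun P) x = polyFun Q x := by
  obtain ⟨ι, e, -, he⟩ := h.eigenbasis n
  -- The polynomials with the desired property form a subspace; it contains the eigenbasis, hence is
  -- everything.
  let S : Submodule ℝ (weightedPolys w n) :=
    { carrier := {P | ∃ Q ∈ weightedPolys w n, ∀ x ∈ Ω, diffOp g b (polyFun P.1) x = polyFun Q x}
      zero_mem' := ⟨0, Submodule.zero_mem _, fun x _ => by simp [diffOp_polyFun, polyFun]⟩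
      add_mem' := by
        rintro p q ⟨P, hP, hp⟩ ⟨Q, hQ, hq⟩
        refine ⟨P + Q, Submodule.add_mem _ hP hQ, fun x hx => ?_⟩
        have := diffOp_polyFun_add_smul g b p.1 q.1 1 x
        simp only [one_smul, one_mul, hp x hx, hq x hx] at this
        simpa [polyFun] using this
      smul_mem' := by
        rintro a p ⟨P, hP, hp⟩
        refine ⟨a • P, Submodule.smul_mem _ _ hP, fun x hx => ?_⟩
        have h0 := diffOp_polyFun_add_smul g b 0 p.1 a x
        have h1 : diffOp g b (polyFun (0 : MvPolynomial (Fin d) ℝ)) x = 0 := by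
          simp [diffOp_polyFun, polyFun]
        rw [h1, zero_add, zero_add, hp x hx] at h0
        simpa [polyFun] using h0 }
  have hS : (⊤ : Submodule ℝ (weightedPolys w n)) ≤ S := by
    rw [← e.span_eq, Submodule.span_le]
    rintro _ ⟨s, rfl⟩
    obtain ⟨c, hc⟩ := he s
    exact ⟨c • (e s).1, Submodule.smul_mem _ _ (e s).2, fun x hx => by
      rw [hc x hx]; simp [polyFun]⟩
  exact hS (x := ⟨P, hP⟩) trivial

/-- A polynomial in two variables as a polynomial in `y` with coefficients in `ℝ[x]`. -/
lemma exists_coeff_polys {w n : ℝ} (hw : 0 < w) {Q : MvPolynomial (Fin 2) ℝ}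
    (hQ : Q ∈ weightedPolys ![1, w] n) (N : ℕ) (hN : n < w * N) :
    ∃ p : ℕ → ℝ[X], (∀ j d : ℕ, n < w * j + (d + 1) → (p j).natDegree ≤ d) ∧
      ∀ x : Fin 2 → ℝ, polyFun Q x = ∑ j ∈ Finset.range N, (p j).eval (x 0) * x 1 ^ j := by
  have hQ' : ∀ k ∈ Q.support, (k 0 : ℝ) + w * k 1 ≤ n := by
    intro k hk
    have := (MvPolynomial.mem_restrictSupport_iff (R := ℝ)).1 hQ hk
    simpa [Fin.sum_univ_two] using this
  refine ⟨fun j => ∑ k ∈ Q.support with k 1 = j, Polynomial.C (Q.coeff k) * Polynomial.X ^ (k 0),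
    fun j d h => ?_, fun x => ?_⟩
  · refine Polynomial.natDegree_sum_le_of_forall_le _ _ fun k hk => ?_
    refine (Polynomial.natDegree_C_mul_X_pow_le _ _).trans ?_
    rw [Finset.mem_filter] at hk
    have h1 := hQ' k hk.1
    rw [hk.2] at h1
    have : (k 0 : ℝ) < d + 1 := by linarith
    exact_mod_cast Nat.lt_succ_iff.1 (by exact_mod_cast this)
  · have hmaps : ∀ k ∈ Q.support, k 1 ∈ Finset.range N := by
      intro k hk
      have h1 := hQ' k hk
      have h2 : w * k 1 < w * N := by
        have : (0 : ℝ) ≤ k 0 := by positivity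
        linarith
      have h3 := lt_of_mul_lt_mul_left h2 hw.le
      simpa using (by exact_mod_cast h3 : k 1 < N)
    rw [polyFun, MvPolynomial.eval_eq']
    rw [← Finset.sum_fiberwise_of_maps_to hmaps]
    refine Finset.sum_congr rfl fun j _ => ?_
    rw [Polynomial.eval_finsetSum, Finset.sum_mul]
    refine Finset.sum_congr rfl fun k hk => ?_
    rw [Finset.mem_filter] at hk
    simp [Fin.prod_univ_two, hk.2]
    ring

lemma monomial_mem_weightedPolys {w n : ℝ} {P : MvPolynomial (Fin 2) ℝ} (i j : ℕ)
    (hP : P = MvPolynomial.X 0 ^ i * MvPolynomial.X 1 ^ j) (h : i + w * j ≤ n) :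
    P ∈ weightedPolys ![1, w] n := by
  subst hP
  rw [weightedPolys, MvPolynomial.mem_restrictSupport_iff]
  have : (MvPolynomial.X 0 ^ i * MvPolynomial.X 1 ^ j : MvPolynomial (Fin 2) ℝ) =
      MvPolynomial.monomial (Finsupp.single 0 i + Finsupp.single 1 j) 1 := by
    rw [MvPolynomial.X_pow_eq_monomial, MvPolynomial.X_pow_eq_monomial,
      MvPolynomial.monomial_mul, one_mul]
  rw [this]
  intro k hk
  have := MvPolynomial.support_monomial_subset hk
  rw [Finset.mem_singleton] at this
  subst this
  simpa [Fin.sum_univ_two] using h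

/-- The polynomial form of the coefficients of the operator. -/
lemma exists_coefficients {w : ℝ} (hw : 2 < w) {Ω : Set (Fin 2 → ℝ)}
    {g : (Fin 2 → ℝ) → Matrix (Fin 2) (Fin 2) ℝ} {b : (Fin 2 → ℝ) → Fin 2 → ℝ}
    {ρ : (Fin 2 → ℝ) → ℝ} (h : IsDOPSolution ![1, w] Ω g b ρ) :
    ∃ (A l r m s β B : ℝ[X]) (c e : ℝ), A.natDegree ≤ 2 ∧ l.natDegree ≤ 1 ∧ β.natDegree ≤ 1 ∧
      ∀ x ∈ Ω, g x 0 0 = A.eval (x 0) ∧ g x 0 1 = l.eval (x 0) * x 1 + r.eval (x 0) ∧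
        g x 1 0 = l.eval (x 0) * x 1 + r.eval (x 0) ∧
        g x 1 1 = c * x 1 ^ 2 + m.eval (x 0) * x 1 + s.eval (x 0) ∧
        b x 0 = β.eval (x 0) ∧ b x 1 = e * x 1 + B.eval (x 0) := by
  have hw0 : 0 < w := by linarith
  -- The images of x, x², y, xy and y² determine all the coefficients: for instance L x = b¹ and L
  -- x² = 2 g¹¹ + 2 x b¹.
  obtain ⟨Q1, hQ1, h1⟩ := exists_diffOp_eq h 1 (MvPolynomial.X 0)
    (monomial_mem_weightedPolys 1 0 (by simp) (by simp))
  obtain ⟨Q2, hQ2, h2⟩ := exists_diffOp_eq h 2 (MvPolynomial.X 0 ^ 2)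
    (monomial_mem_weightedPolys 2 0 (by simp) (by simp))
  obtain ⟨Q3, hQ3, h3⟩ := exists_diffOp_eq h w (MvPolynomial.X 1)
    (monomial_mem_weightedPolys 0 1 (by simp) (by simp))
  obtain ⟨Q4, hQ4, h4⟩ := exists_diffOp_eq h (1 + w) (MvPolynomial.X 0 * MvPolynomial.X 1)
    (monomial_mem_weightedPolys 1 1 (by simp) (by simp))
  obtain ⟨Q5, hQ5, h5⟩ := exists_diffOp_eq h (2 * w) (MvPolynomial.X 1 ^ 2)
    (monomial_mem_weightedPolys 0 2 (by simp) (by simp; linarith))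
  -- The y-degree is read off from the weight. That L x² contains no y at all is exactly where 2 < w
  -- enters.
  obtain ⟨p1, d1, e1⟩ := exists_coeff_polys hw0 hQ1 1 (by push_cast; linarith)
  obtain ⟨p2, d2, e2⟩ := exists_coeff_polys hw0 hQ2 1 (by push_cast; linarith)
  obtain ⟨p3, d3, e3⟩ := exists_coeff_polys hw0 hQ3 2 (by push_cast; linarith)
  obtain ⟨p4, d4, e4⟩ := exists_coeff_polys hw0 hQ4 2 (by push_cast; linarith)
  obtain ⟨p5, d5, e5⟩ := exists_coeff_polys hw0 hQ5 3 (by push_cast; linarith)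
  -- The factor y in L y, and y² in L y², already exhausts the allowed weight, so its coefficient is
  -- a constant.
  have hc3 := Polynomial.eq_C_of_natDegree_le_zero (d3 1 0 (by push_cast; linarith))
  have hc5 := Polynomial.eq_C_of_natDegree_le_zero (d5 2 0 (by push_cast; linarith))
  have hd1 : (p1 0).natDegree ≤ 1 := d1 0 1 (by push_cast; linarith)
  have hd2 : (p2 0).natDegree ≤ 2 := d2 0 2 (by push_cast; linarith)
  have hd4 : (p4 1).natDegree ≤ 1 := d4 1 1 (by push_cast; linarith)
  set e := (p3 1).coeff 0
  set c' := (p5 2).coeff 0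
  refine ⟨C (1/2) * (p2 0 - 2 * (X * p1 0)), C (1/2) * (p4 1 - p1 0 - X * C e),
    C (1/2) * (p4 0 - X * p3 0), C (1/2) * p5 1 - p3 0, C (1/2) * p5 0, p1 0, p3 0,
    c' / 2 - e, e, ?_, ?_, hd1, ?_⟩
  · have hX : (X * p1 0 : ℝ[X]).natDegree ≤ 2 :=
      natDegree_mul_le.trans (by have := natDegree_X_le (R := ℝ); omega)
    refine (natDegree_C_mul_le _ _).trans ((natDegree_sub_le _ _).trans (max_le hd2 ?_))
    have := natDegree_C_mul_le (2 : ℝ) (X * p1 0)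
    simp only [map_ofNat] at this
    omega
  · refine (natDegree_C_mul_le _ _).trans ((natDegree_sub_le _ _).trans (max_le
      ((natDegree_sub_le _ _).trans (max_le hd4 hd1)) ?_))
    exact natDegree_mul_le.trans (by simp)
  · intro x hx
    have sym : g x 1 0 = g x 0 1 := by
      have := (h.elliptic x hx).isHermitian.apply 0 1
      simpa using this
    have k1 := h1 x hx
    have k2 := h2 x hx
    have k3 := h3 x hx
    have k4 := h4 x hx
    have k5 := h5 x hx
    rw [e1 x] at k1
    rw [e2 x] at k2
    rw [e3 x] at k3
    rw [e4 x] at k4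
    rw [e5 x] at k5
    rw [diffOp_polyFun] at k1 k2 k3 k4 k5
    have two : ∀ i : Fin 2, MvPolynomial.pderiv i (2 : MvPolynomial (Fin 2) ℝ) = 0 := fun i => by
      simpa using (MvPolynomial.pderiv i).map_natCast 2
    simp [polyFun, Fin.sum_univ_two, Finset.sum_range_succ, MvPolynomial.pderiv_X, Pi.single_apply,
      two] at k1 k2 k3 k4 k5
    rw [hc3] at k3
    rw [hc5] at k5
    simp at k3 k5
    simp only [eval_mul, eval_C, eval_sub, eval_X, eval_ofNat, sym]
    change b x 1 = (p3 0).eval (x 0) + e * x 1 at k3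
    rw [k1, k3] at k4
    rw [k1] at k2
    rw [k3] at k5
    rw [sym] at k4
    refine ⟨by linarith, by linarith, by linarith, by linarith, k1, by linarith⟩

end Polynomials

/-! ### Integration by parts obtained from the symmetry of the operator -/

section WeakForm

variable {d : ℕ}

lemma contDiff_partialDeriv {f : (Fin d → ℝ) → ℝ} (hf : ContDiff ℝ ∞ f) (i : Fin d) :
    ContDiff ℝ ∞ (partialDeriv i f) := by
  unfold partialDeriv
  exact (hf.fderiv_right (m := ∞) (by simp)).clm_apply contDiff_const

lemma partialDeriv_congr {f f' : (Fin d → ℝ) → ℝ} {x : Fin d → ℝ} (h : f =ᶠ[𝓝 x] f')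
    (i : Fin d) : partialDeriv i f =ᶠ[𝓝 x] partialDeriv i f' := by
  filter_upwards [h.fderiv (𝕜 := ℝ)] with y hy
  simp [partialDeriv, hy]

lemma diffOp_congr (g : (Fin d → ℝ) → Matrix (Fin d) (Fin d) ℝ)
    (b : (Fin d → ℝ) → Fin d → ℝ) {f f' : (Fin d → ℝ) → ℝ} {x : Fin d → ℝ} (h : f =ᶠ[𝓝 x] f') :
    diffOp g b f x = diffOp g b f' x := by
  simp only [diffOp]
  congr 1
  · refine Finset.sum_congr rfl fun i _ => Finset.sum_congr rfl fun j _ => ?_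
    rw [(partialDeriv_congr (partialDeriv_congr h j) i).eq_of_nhds]
  · refine Finset.sum_congr rfl fun i _ => ?_
    rw [(partialDeriv_congr h i).eq_of_nhds]

lemma partialDeriv_coord_mul {f : (Fin d → ℝ) → ℝ} (hf : ContDiff ℝ ∞ f) (k j : Fin d)
    (x : Fin d → ℝ) : partialDeriv j (fun y => y k * f y) x =
      (if k = j then f x else 0) + x k * partialDeriv j f x := by
  unfold partialDeriv
  have h2 : HasFDerivAt (fun y : Fin d → ℝ => y k) (ContinuousLinearMap.proj k) x :=
    (ContinuousLinearMap.proj (R := ℝ) (φ := fun _ : Fin d => ℝ) k).hasFDerivAt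
  have h1 := (hf.differentiable (by simp) x).hasFDerivAt
  rw [show (fun y => y k * f y) = (fun y => y k) * f from rfl, (h2.mul h1).fderiv]
  simp only [_root_.add_apply, _root_.smul_apply, smul_eq_mul, ContinuousLinearMap.proj_apply,
    Pi.single_apply]
  split_ifs <;> ring

lemma partialDeriv_add {f f' : (Fin d → ℝ) → ℝ} (hf : ContDiff ℝ ∞ f) (hf' : ContDiff ℝ ∞ f')
    (j : Fin d) (x : Fin d → ℝ) : partialDeriv j (fun y => f y + f' y) x =
      partialDeriv j f x + partialDeriv j f' x := by
  unfold partialDeriv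
  rw [show (fun y => f y + f' y) = f + f' from rfl, fderiv_add (hf.differentiable (by simp) x)
    (hf'.differentiable (by simp) x), _root_.add_apply]

lemma diffOp_coord_mul (g : (Fin d → ℝ) → Matrix (Fin d) (Fin d) ℝ)
    (b : (Fin d → ℝ) → Fin d → ℝ) {f : (Fin d → ℝ) → ℝ} (hf : ContDiff ℝ ∞ f) (k : Fin d)
    (x : Fin d → ℝ) : diffOp g b (fun y => y k * f y) x =
      x k * diffOp g b f x + b x k * f x + ∑ j, (g x k j + g x j k) * partialDeriv j f x := by
  have h2 : ∀ i j : Fin d, partialDeriv i (partialDeriv j (fun y => y k * f y)) x =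
      (if k = j then partialDeriv i f x else 0) + (if k = i then partialDeriv j f x else 0) +
        x k * partialDeriv i (partialDeriv j f) x := by
    intro i j
    have : partialDeriv j (fun y => y k * f y) =
        fun y => (if k = j then f y else 0) + y k * partialDeriv j f y := by
      funext y; exact partialDeriv_coord_mul hf k j y
    rw [this]
    by_cases hkj : k = j
    · simp only [if_pos hkj]
      rw [partialDeriv_add hf ((contDiff_apply ℝ ℝ k).mul (contDiff_partialDeriv hf j)),
        partialDeriv_coord_mul (contDiff_partialDeriv hf j)]
      ring
    · simp only [if_neg hkj, zero_add]
      rw [partialDeriv_coord_mul (contDiff_partialDeriv hf j)]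
  simp only [diffOp, h2, partialDeriv_coord_mul hf, mul_add, add_mul, Finset.sum_add_distrib,
    mul_ite, mul_zero, Finset.sum_ite_eq, Finset.mem_univ, if_true, Finset.mul_sum]
  have e1 : ∑ i, ∑ j, (if k = i then g x i j * partialDeriv j f x else 0) =
      ∑ j, g x k j * partialDeriv j f x := by
    rw [Finset.sum_comm]; simp
  rw [e1]
  have e2 : ∀ u v w : ℝ, u * (v * w) = v * (u * w) := fun u v w => by ring
  simp only [e2 (x k)]
  ring

lemma continuous_diffOp {g : (Fin d → ℝ) → Matrix (Fin d) (Fin d) ℝ}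
    {b : (Fin d → ℝ) → Fin d → ℝ} (hg : ∀ i j, Continuous fun x => g x i j)
    (hb : ∀ i, Continuous fun x => b x i) {f : (Fin d → ℝ) → ℝ} (hf : ContDiff ℝ ∞ f) :
    Continuous (diffOp g b f) := by
  unfold diffOp
  refine Continuous.add ?_ ?_
  · exact continuous_finsetSum _ fun i _ => continuous_finsetSum _ fun j _ =>
      (hg i j).mul (contDiff_partialDeriv (contDiff_partialDeriv hf j) i).continuous
  · exact continuous_finsetSum _ fun i _ => (hb i).mul (contDiff_partialDeriv hf i).continuous

lemma diffOp_eq_zero {g : (Fin d → ℝ) → Matrix (Fin d) (Fin d) ℝ}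
    {b : (Fin d → ℝ) → Fin d → ℝ} {f : (Fin d → ℝ) → ℝ} {x : Fin d → ℝ} {a : ℝ}
    (hx : f =ᶠ[𝓝 x] fun _ => a) : diffOp g b f x = 0 := by
  rw [diffOp_congr g b hx]
  have : ∀ i : Fin d, partialDeriv i (fun _ : Fin d → ℝ => a) = fun _ => 0 := by
    intro i; funext y; simp [partialDeriv]
  have h0 : ∀ i : Fin d, partialDeriv i (fun _ : Fin d → ℝ => (0 : ℝ)) = fun _ => 0 := by
    intro i; funext y; simp [partialDeriv]
  simp [diffOp, this, h0]

/-- The integration by parts formula obtained from the symmetry of the operator. -/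
lemma integral_coord_eq_zero {g : (Fin d → ℝ) → Matrix (Fin d) (Fin d) ℝ}
    {b : (Fin d → ℝ) → Fin d → ℝ} {μ : Measure (Fin d → ℝ)} [IsFiniteMeasure μ]
    (hg : ∀ i j, Continuous fun x => g x i j) (hb : ∀ i, Continuous fun x => b x i)
    (hgs : ∀ x i j, g x i j = g x j i)
    (hsym : ∀ f₁ f₂ : (Fin d → ℝ) → ℝ, ContDiff ℝ ∞ f₁ → ContDiff ℝ ∞ f₂ →
      HasCompactSupport f₁ → HasCompactSupport f₂ →
      ∫ x, f₁ x * diffOp g b f₂ x ∂μ = ∫ x, f₂ x * diffOp g b f₁ x ∂μ)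
    {f : (Fin d → ℝ) → ℝ} (hf : ContDiff ℝ ∞ f) (hfc : HasCompactSupport f) (k : Fin d) :
    ∫ x, (b x k * f x + ∑ j, g x k j * partialDeriv j f x) ∂μ = 0 := by
  obtain ⟨R, hR0, hR⟩ := hfc.isBounded.subset_ball_lt 0 0
  -- Near the support of f the cutoff is 1, so χ and x_k χ stand in for the functions 1 and x_k,
  -- which are not compactly supported.
  let χ : ContDiffBump (0 : Fin d → ℝ) := ⟨R, R + 1, hR0, by linarith⟩
  have hχ : ∀ x ∈ tsupport f, (χ : (Fin d → ℝ) → ℝ) =ᶠ[𝓝 x] fun _ => 1 := by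
    intro x hx
    filter_upwards [Metric.isOpen_ball.mem_nhds (hR hx)] with y hy
    exact χ.one_of_mem_closedBall (Metric.ball_subset_closedBall hy)
  have hχs : ContDiff ℝ ∞ χ := χ.contDiff
  have hχc : HasCompactSupport χ := χ.hasCompactSupport
  have hfz : ∀ x, x ∉ tsupport f → f =ᶠ[𝓝 x] fun _ => 0 := by
    intro x hx
    exact notMem_tsupport_iff_eventuallyEq.1 hx
  have hk : ContDiff ℝ ∞ (fun x : Fin d → ℝ => x k) := contDiff_apply ℝ ℝ k
  have hL : ∀ x, x ∉ tsupport f → diffOp g b f x = 0 := fun x hx => diffOp_eq_zero (hfz x hx)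
  -- The pair (f, x_k) gives ∫ b_k f = ∫ x_k L f; the pair (x_k f, 1) gives 0 = ∫ L(x_k f) = ∫ (x_k
  -- L f + b_k f + 2 ∑ g_kj ∂_j f). Subtracting leaves twice the claim.
  have s1 := hsym f (fun x => x k * χ x) hf (hk.mul hχs) hfc hχc.mul_left
  have s2 := hsym (fun x => x k * f x) χ (hk.mul hf) hχs hfc.mul_left hχc
  have a1 : ∀ x, f x * diffOp g b (fun x => x k * χ x) x = b x k * f x := by
    intro x
    by_cases hx : x ∈ tsupport f
    · rw [diffOp_coord_mul g b hχs, diffOp_eq_zero (hχ x hx), (hχ x hx).eq_of_nhds]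
      have : ∀ j, partialDeriv j χ x = 0 := fun j => by
        rw [(partialDeriv_congr (hχ x hx) j).eq_of_nhds]; simp [partialDeriv]
      simp [this]; ring
    · rw [image_eq_zero_of_notMem_tsupport hx]; ring
  have a2 : ∀ x, x k * χ x * diffOp g b f x = x k * diffOp g b f x := by
    intro x
    by_cases hx : x ∈ tsupport f
    · rw [(hχ x hx).eq_of_nhds]; ring
    · rw [hL x hx]; ring
  have a3 : ∀ x, x k * f x * diffOp g b χ x = 0 := by
    intro x
    by_cases hx : x ∈ tsupport f
    · rw [diffOp_eq_zero (hχ x hx)]; ring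
    · rw [image_eq_zero_of_notMem_tsupport hx]; ring
  have a4 : ∀ x, χ x * diffOp g b (fun x => x k * f x) x = x k * diffOp g b f x +
      (b x k * f x + ∑ j, (g x k j + g x j k) * partialDeriv j f x) := by
    intro x
    rw [diffOp_coord_mul g b hf]
    by_cases hx : x ∈ tsupport f
    · rw [(hχ x hx).eq_of_nhds]; ring
    · have : ∀ j, partialDeriv j f x = 0 := fun j => by
        rw [(partialDeriv_congr (hfz x hx) j).eq_of_nhds]; simp [partialDeriv]
      rw [hL x hx, image_eq_zero_of_notMem_tsupport hx]; simp [this]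
  simp only [a1, a2] at s1
  simp only [a3, a4, integral_zero] at s2
  have hint : ∀ F : (Fin d → ℝ) → ℝ, Continuous F → (∀ x, x ∉ tsupport f → F x = 0) →
      Integrable F μ := fun F hF h0 =>
    hF.integrable_of_hasCompactSupport (HasCompactSupport.intro hfc h0)
  have hpd : ∀ x, x ∉ tsupport f → ∀ j, partialDeriv j f x = 0 := fun x hx j => by
    rw [(partialDeriv_congr (hfz x hx) j).eq_of_nhds]; simp [partialDeriv]
  have i1 : Integrable (fun x => x k * diffOp g b f x) μ :=
    hint _ (hk.continuous.mul (continuous_diffOp hg hb hf)) fun x hx => by rw [hL x hx]; ring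
  have i2 : Integrable (fun x => b x k * f x) μ :=
    hint _ ((hb k).mul hf.continuous) fun x hx => by
      rw [image_eq_zero_of_notMem_tsupport hx]; ring
  have i3 : Integrable (fun x => ∑ j, g x k j * partialDeriv j f x) μ :=
    hint _ (continuous_finsetSum _ fun j _ =>
      (hg k j).mul (contDiff_partialDeriv hf j).continuous) fun x hx => by simp [hpd x hx]
  have e3 : ∀ x, ∑ j, (g x k j + g x j k) * partialDeriv j f x =
      2 * ∑ j, g x k j * partialDeriv j f x := by
    intro x
    rw [Finset.mul_sum]
    refine Finset.sum_congr rfl fun j _ => ?_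
    rw [hgs x j k]; ring
  simp only [e3] at s2
  have h12 : ∫ x, (b x k * f x + 2 * ∑ j, g x k j * partialDeriv j f x) ∂μ =
      ∫ x, b x k * f x ∂μ + 2 * ∫ x, ∑ j, g x k j * partialDeriv j f x ∂μ := by
    rw [integral_add i2 (i3.const_mul 2), integral_const_mul]
  have i23 : Integrable (fun x => b x k * f x + 2 * ∑ j, g x k j * partialDeriv j f x) μ :=
    i2.add (i3.const_mul 2)
  rw [integral_add i1 i23, h12, ← s1] at s2
  rw [integral_add i2 i3]
  linarith

end WeakForm

/-- The data on the plane extracted from a solution of the `(1,∞)`-SDOP problem: the coefficients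
are polynomials of a special form, the density is extended by zero, and the integration by parts
formulas hold for all test functions on the plane. -/
structure WeakSolution (Ω : Set (ℝ × ℝ)) (ρ : ℝ × ℝ → ℝ) (A l r m s β B : ℝ[X]) (c e : ℝ) :
    Prop where
  isOpen : IsOpen Ω
  isConnected : IsConnected Ω
  regular : interior (closure Ω) ⊆ Ω
  A_deg : A.natDegree ≤ 2
  l_deg : l.natDegree ≤ 1
  β_deg : β.natDegree ≤ 1
  A_pos : ∀ p ∈ Ω, 0 < A.eval p.1
  disc_pos : ∀ p ∈ Ω, 0 < A.eval p.1 * (c * p.2 ^ 2 + m.eval p.1 * p.2 + s.eval p.1) -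
    (l.eval p.1 * p.2 + r.eval p.1) ^ 2
  cont : ContinuousOn ρ Ω
  nonneg : ∀ p, 0 ≤ ρ p
  zero_off : ∀ p, p ∉ Ω → ρ p = 0
  moments : ∀ i j : ℕ, Integrable fun p : ℝ × ℝ => p.1 ^ i * p.2 ^ j * ρ p
  integral_one : ∫ p, ρ p = 1
  eq_fst : ∀ f : ℝ × ℝ → ℝ, ContDiff ℝ ∞ f → HasCompactSupport f →
    ∫ p, (β.eval p.1 * f p + (A.eval p.1 * fderiv ℝ f p (1, 0) +
      (l.eval p.1 * p.2 + r.eval p.1) * fderiv ℝ f p (0, 1))) * ρ p = 0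
  eq_snd : ∀ f : ℝ × ℝ → ℝ, ContDiff ℝ ∞ f → HasCompactSupport f →
    ∫ p, ((e * p.2 + B.eval p.1) * f p + ((l.eval p.1 * p.2 + r.eval p.1) * fderiv ℝ f p (1, 0) +
      (c * p.2 ^ 2 + m.eval p.1 * p.2 + s.eval p.1) * fderiv ℝ f p (0, 1))) * ρ p = 0

/-! ### Passage from functions on `Fin 2` to the product plane -/

section Transfer

/-- The density extended by zero, as a function on the product plane. -/
noncomputable def planeDensity (Ω : Set (Fin 2 → ℝ)) (ρ : (Fin 2 → ℝ) → ℝ) (p : ℝ × ℝ) : ℝ :=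
  Ω.indicator ρ ![p.1, p.2]

/-- The domain as a subset of the product plane. -/
def planeDomain (Ω : Set (Fin 2 → ℝ)) : Set (ℝ × ℝ) := {p | ![p.1, p.2] ∈ Ω}

lemma vec_eta (X : Fin 2 → ℝ) : ![X 0, X 1] = X := by
  funext i; fin_cases i <;> rfl

/-- The homeomorphism between the two models of the plane. -/
def planeHomeo : (Fin 2 → ℝ) ≃ₜ ℝ × ℝ where
  toFun X := (X 0, X 1)
  invFun p := ![p.1, p.2]
  left_inv X := vec_eta X
  right_inv _ := rfl
  continuous_toFun := by fun_prop
  continuous_invFun := by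
    refine continuous_pi fun i => ?_
    fin_cases i
    · exact continuous_fst
    · exact continuous_snd

lemma planeDomain_eq (Ω : Set (Fin 2 → ℝ)) : planeDomain Ω = planeHomeo.symm ⁻¹' Ω := rfl

variable {Ω : Set (Fin 2 → ℝ)} {ρ : (Fin 2 → ℝ) → ℝ}

lemma integral_plane_comp (G : ℝ × ℝ → ℝ) :
    ∫ X : Fin 2 → ℝ, G (X 0, X 1) = ∫ p, G p :=
  (volume_preserving_finTwoArrow ℝ).integral_comp' (f := MeasurableEquiv.finTwoArrow) G

lemma integrable_plane_comp (G : ℝ × ℝ → ℝ) :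
    Integrable (fun X : Fin 2 → ℝ => G (X 0, X 1)) ↔ Integrable G :=
  (volume_preserving_finTwoArrow ℝ).integrable_comp_emb
    (f := MeasurableEquiv.finTwoArrow) MeasurableEquiv.finTwoArrow.measurableEmbedding

lemma aemeasurable_density (hΩ : IsOpen Ω) (hρ : ContinuousOn ρ Ω) :
    AEMeasurable (fun x => ENNReal.ofReal (ρ x)) (volume.restrict Ω) :=
  (hρ.aemeasurable hΩ.measurableSet).ennreal_ofReal

lemma smul_density_eq (F : (Fin 2 → ℝ) → ℝ) (h0 : ∀ x ∈ Ω, 0 ≤ ρ x) :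
    Ω.indicator (fun X => (ENNReal.ofReal (ρ X)).toReal • F X) =
      fun X => F ![X 0, X 1] * planeDensity Ω ρ (X 0, X 1) := by
  funext X
  simp only [planeDensity, vec_eta]
  by_cases hX : X ∈ Ω
  · simp [hX, h0 X hX, mul_comm]
  · simp [hX]

lemma integral_densityMeasure (hΩ : IsOpen Ω) (hρ : ContinuousOn ρ Ω) (h0 : ∀ x ∈ Ω, 0 ≤ ρ x)
    (F : (Fin 2 → ℝ) → ℝ) :
    ∫ X, F X ∂(densityMeasure Ω ρ) = ∫ p : ℝ × ℝ, F ![p.1, p.2] * planeDensity Ω ρ p := by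
  rw [densityMeasure, integral_withDensity_eq_integral_toReal_smul₀ (aemeasurable_density hΩ hρ)
    (by simp), ← integral_indicator hΩ.measurableSet, smul_density_eq F h0]
  exact integral_plane_comp fun p => F ![p.1, p.2] * planeDensity Ω ρ p

lemma integrable_densityMeasure (hΩ : IsOpen Ω) (hρ : ContinuousOn ρ Ω) (h0 : ∀ x ∈ Ω, 0 ≤ ρ x)
    (F : (Fin 2 → ℝ) → ℝ) :
    Integrable F (densityMeasure Ω ρ) ↔
      Integrable fun p : ℝ × ℝ => F ![p.1, p.2] * planeDensity Ω ρ p := by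
  rw [densityMeasure, integrable_withDensity_iff_integrable_smul₀' (aemeasurable_density hΩ hρ)
    (by simp), ← IntegrableOn, ← integrable_indicator_iff hΩ.measurableSet, smul_density_eq F h0]
  exact integrable_plane_comp fun p => F ![p.1, p.2] * planeDensity Ω ρ p

lemma ae_mem_densityMeasure (hΩ : IsOpen Ω) : ∀ᵐ x ∂(densityMeasure Ω ρ), x ∈ Ω :=
  (withDensity_absolutelyContinuous _ _).ae_le (ae_restrict_mem hΩ.measurableSet)

lemma partialDeriv_comp_plane {f : ℝ × ℝ → ℝ} (hf : ContDiff ℝ ∞ f) (p : ℝ × ℝ) :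
    partialDeriv 0 (fun X : Fin 2 → ℝ => f (X 0, X 1)) ![p.1, p.2] = fderiv ℝ f p (1, 0) ∧
    partialDeriv 1 (fun X : Fin 2 → ℝ => f (X 0, X 1)) ![p.1, p.2] = fderiv ℝ f p (0, 1) := by
  let T : (Fin 2 → ℝ) →L[ℝ] ℝ × ℝ := (ContinuousLinearMap.proj (R := ℝ)
    (φ := fun _ : Fin 2 => ℝ) 0).prod (ContinuousLinearMap.proj (R := ℝ)
    (φ := fun _ : Fin 2 => ℝ) 1)
  have h1 : HasFDerivAt f (fderiv ℝ f p) (T ![p.1, p.2]) :=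
    (hf.differentiable (by simp) p).hasFDerivAt
  have h2 := (h1.comp _ T.hasFDerivAt).fderiv
  have h3 : (fun X : Fin 2 → ℝ => f (X 0, X 1)) = f ∘ T := rfl
  unfold partialDeriv
  rw [h3, h2]
  simp [T]

/-- A solution of the `(1,∞)`-SDOP problem gives polynomial coefficients and the integration by
parts formulas on the plane. -/
lemma exists_weakSolution {w : ℝ} (hw : 2 < w)
    {g : (Fin 2 → ℝ) → Matrix (Fin 2) (Fin 2) ℝ} {b : (Fin 2 → ℝ) → Fin 2 → ℝ}
    (h : IsSDOPSolution ![1, w] Ω g b ρ) :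
    ∃ (A l r m s β B : ℝ[X]) (c e : ℝ),
      WeakSolution (planeDomain Ω) (planeDensity Ω ρ) A l r m s β B c e ∧
      ∀ x ∈ Ω, g x = !![A.eval (x 0), l.eval (x 0) * x 1 + r.eval (x 0);
        l.eval (x 0) * x 1 + r.eval (x 0), c * x 1 ^ 2 + m.eval (x 0) * x 1 + s.eval (x 0)] := by
  obtain ⟨A, l, r, m, s, β, B, c, e, hA, hl, hβ, hcoef⟩ := exists_coefficients hw h.toIsDOPSolution
  have hΩ : IsOpen Ω := h.naturalDomain.1
  have hcont := h.continuousOn_density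
  have h0 := h.density_nonneg
  have := h.probability
  -- The given coefficients are controlled on Ω only. Their polynomial extensions are continuous on
  -- the whole plane, which the integrability arguments require, and the measure does not see the
  -- difference.
  set gc : (Fin 2 → ℝ) → Matrix (Fin 2) (Fin 2) ℝ := fun x =>
    !![A.eval (x 0), l.eval (x 0) * x 1 + r.eval (x 0);
        l.eval (x 0) * x 1 + r.eval (x 0), c * x 1 ^ 2 + m.eval (x 0) * x 1 + s.eval (x 0)] with hgc
  set bc : (Fin 2 → ℝ) → Fin 2 → ℝ := fun x => ![β.eval (x 0), e * x 1 + B.eval (x 0)] with hbc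
  have hggc : ∀ x ∈ Ω, g x = gc x := by
    intro x hx
    obtain ⟨h1, h2, h3, h4, -, -⟩ := hcoef x hx
    ext i j
    fin_cases i <;> fin_cases j <;> simp [hgc, h1, h2, h3, h4]
  have hbbc : ∀ x ∈ Ω, b x = bc x := by
    intro x hx
    obtain ⟨-, -, -, -, h5, h6⟩ := hcoef x hx
    ext i
    fin_cases i <;> simp [hbc, h5, h6]
  have hgcc : ∀ i j, Continuous fun x => gc x i j := by
    intro i j
    fin_cases i <;> fin_cases j <;> simp only [hgc] <;> simp <;> fun_prop
  have hbcc : ∀ i, Continuous fun x => bc x i := by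
    intro i
    fin_cases i <;> simp only [hbc] <;> simp <;> fun_prop
  have hgcs : ∀ x i j, gc x i j = gc x j i := by
    intro x i j
    fin_cases i <;> fin_cases j <;> simp [hgc]
  have hop : ∀ f : (Fin 2 → ℝ) → ℝ, ∀ x ∈ Ω, diffOp g b f x = diffOp gc bc f x := by
    intro f x hx
    simp only [diffOp, hggc x hx, hbbc x hx]
  have hweak : ∀ f : (Fin 2 → ℝ) → ℝ, ContDiff ℝ ∞ f → HasCompactSupport f → ∀ k,
      ∫ x, (bc x k * f x + ∑ j, gc x k j * partialDeriv j f x) ∂(densityMeasure Ω ρ) = 0 := by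
    intro f hf hfc k
    refine integral_coord_eq_zero hgcc hbcc hgcs (fun f₁ f₂ hf₁ hf₂ hc₁ hc₂ => ?_) hf hfc k
    have := h.symmetric f₁ f₂ hf₁ hf₂ hc₁ hc₂
    have e1 : ∀ f₁ f₂ : (Fin 2 → ℝ) → ℝ,
        ∫ x, f₁ x * diffOp g b f₂ x ∂(densityMeasure Ω ρ) =
          ∫ x, f₁ x * diffOp gc bc f₂ x ∂(densityMeasure Ω ρ) := fun f₁ f₂ =>
      integral_congr_ae ((ae_mem_densityMeasure hΩ).mono fun x hx => by
        simp only [hop f₂ x hx])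
    rwa [e1, e1] at this
  have hcomp : ∀ f : ℝ × ℝ → ℝ, ContDiff ℝ ∞ f → HasCompactSupport f →
      ContDiff ℝ ∞ (fun X : Fin 2 → ℝ => f (X 0, X 1)) ∧
      HasCompactSupport (fun X : Fin 2 → ℝ => f (X 0, X 1)) := fun f hf hfc =>
    ⟨hf.comp ((contDiff_apply ℝ ℝ 0).prodMk (contDiff_apply ℝ ℝ 1)),
      hfc.comp_homeomorph planeHomeo⟩
  refine ⟨A, l, r, m, s, β, B, c, e, ⟨?_, ?_, ?_, hA, hl, hβ, ?_, ?_, ?_, ?_, ?_, ?_, ?_, ?_, ?_⟩,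
    hggc⟩
  · exact hΩ.preimage planeHomeo.symm.continuous
  · rw [planeDomain_eq]
    exact planeHomeo.symm.isConnected_preimage.2 h.naturalDomain.2.1
  · rw [planeDomain_eq, ← planeHomeo.symm.preimage_closure, ← planeHomeo.symm.preimage_interior,
      h.naturalDomain.2.2]
  · intro p hp
    have := (h.elliptic _ hp).diag_pos (i := 0)
    rw [hggc _ hp] at this
    simpa [hgc] using this
  · intro p hp
    have := (h.elliptic _ hp).det_pos
    rw [hggc _ hp, Matrix.det_fin_two] at this
    simp [hgc] at this
    linarith [this]
  · have : ContinuousOn (fun p : ℝ × ℝ => ρ (planeHomeo.symm p)) (planeDomain Ω) :=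
      hcont.comp planeHomeo.symm.continuous.continuousOn fun p hp => hp
    refine this.congr fun p hp => ?_
    exact indicator_of_mem (s := Ω) hp ρ
  · intro p
    exact indicator_nonneg h0 _
  · intro p hp
    exact indicator_of_notMem (s := Ω) hp ρ
  · intro i j
    have hint : Integrable (polyFun (MvPolynomial.X 0 ^ i * MvPolynomial.X 1 ^ j))
        (densityMeasure Ω ρ) := (h.poly_memLp _).integrable (by norm_num)
    rw [integrable_densityMeasure hΩ hcont h0] at hint
    simpa [polyFun] using hint
  · have : ∫ X, (1 : ℝ) ∂(densityMeasure Ω ρ) = 1 := by simp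
    rw [integral_densityMeasure hΩ hcont h0] at this
    simpa using this
  · intro f hf hfc
    have h1 := hweak _ (hcomp f hf hfc).1 (hcomp f hf hfc).2 0
    rw [integral_densityMeasure hΩ hcont h0] at h1
    simp only [Fin.sum_univ_two, (partialDeriv_comp_plane hf _).1,
      (partialDeriv_comp_plane hf _).2] at h1
    simpa [hgc, hbc] using h1
  · intro f hf hfc
    have h1 := hweak _ (hcomp f hf hfc).1 (hcomp f hf hfc).2 1
    rw [integral_densityMeasure hΩ hcont h0] at h1
    simp only [Fin.sum_univ_two, (partialDeriv_comp_plane hf _).1,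
      (partialDeriv_comp_plane hf _).2] at h1
    simpa [hgc, hbc] using h1

end Transfer

/-! ### First order linear equations and test functions on an interval -/

section OneDim

/-- Smooth functions with compact support in `U`. -/
structure TestOn (U : Set ℝ) (φ : ℝ → ℝ) : Prop where
  smooth : ContDiff ℝ ∞ φ
  compact : HasCompactSupport φ
  subset : tsupport φ ⊆ U

lemma exists_antideriv {U : Set ℝ} (hU : IsOpen U) (hc : U.OrdConnected) {u₀ : ℝ} (hu : u₀ ∈ U)
    {s : ℝ → ℝ} (hs : ContDiffOn ℝ ∞ s U) :
    ∃ S : ℝ → ℝ, (∀ u ∈ U, HasDerivAt S (s u) u) ∧ ContDiffOn ℝ ∞ S U := by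
  have hd : ∀ u ∈ U, HasDerivAt (fun u => ∫ v in u₀..u, s v) (s u) u := by
    intro u hu'
    have hsub : uIcc u₀ u ⊆ U := hc.uIcc_subset hu hu'
    exact intervalIntegral.integral_hasDerivAt_right
      ((hs.continuousOn.mono hsub).intervalIntegrable)
      (hs.continuousOn.stronglyMeasurableAtFilter hU u hu')
      (hs.continuousOn.continuousAt (hU.mem_nhds hu'))
  refine ⟨_, hd, ?_⟩
  rw [contDiffOn_infty_iff_deriv_of_isOpen hU]
  exact ⟨fun u hu => (hd u hu).differentiableAt.differentiableWithinAt,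
    hs.congr fun u hu => (hd u hu).deriv⟩

lemma contDiff_mul_of_tsupport {E : Type*} [NormedAddCommGroup E] [NormedSpace ℝ E] {U : Set E}
    (hU : IsOpen U) {θ F : E → ℝ} (hθ : ContDiff ℝ ∞ θ) (hs : tsupport θ ⊆ U)
    (hF : ContDiffOn ℝ ∞ F U) : ContDiff ℝ ∞ fun x => θ x * F x := by
  rw [contDiff_iff_contDiffAt]
  intro x
  by_cases hx : x ∈ tsupport θ
  · exact hθ.contDiffAt.mul ((hF x (hs hx)).contDiffAt (hU.mem_nhds (hs hx)))
  · have : (fun x => θ x * F x) =ᶠ[𝓝 x] fun _ => 0 := by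
      filter_upwards [notMem_tsupport_iff_eventuallyEq.1 hx] with y hy
      simp [hy]
    exact contDiffAt_const.congr_of_eventuallyEq this

/-- The exponential of a primitive of s. It is positive on all of ℝ, even where nothing else is
known about it, so later divisions need no membership condition. -/
lemma exists_integrating_factor {U : Set ℝ} (hU : IsOpen U) (hc : U.OrdConnected) {u₀ : ℝ}
    (hu : u₀ ∈ U) {s : ℝ → ℝ} (hs : ContDiffOn ℝ ∞ s U) :
    ∃ w : ℝ → ℝ, (∀ u, 0 < w u) ∧ (∀ u ∈ U, HasDerivAt w (s u * w u) u) ∧ ContDiffOn ℝ ∞ w U := by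
  obtain ⟨S, hS, hS'⟩ := exists_antideriv hU hc hu hs
  exact ⟨fun u => Real.exp (S u), fun u => Real.exp_pos _, fun u hu => by
    simpa [mul_comm] using (hS u hu).exp, hS'.exp⟩

/-- The first order equation `D φ' + t φ = θ` is solvable by test functions if `θ` is orthogonal
to the solution of the adjoint equation. -/
lemma exists_testOn_solution {U : Set ℝ} (hU : IsOpen U) (hc : U.OrdConnected) {D t w : ℝ → ℝ}
    (hD : ContDiffOn ℝ ∞ D U) (hD0 : ∀ u ∈ U, D u ≠ 0) (hw : ContDiffOn ℝ ∞ w U)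
    (hw0 : ∀ u ∈ U, w u ≠ 0) (hwd : ∀ u ∈ U, HasDerivAt w (t u / D u * w u) u)
    {θ : ℝ → ℝ} (hθ : TestOn U θ) (h0 : ∫ u, θ u * (w u / D u) = 0) :
    ∃ φ, TestOn U φ ∧ ∀ u, D u * deriv φ u + t u * φ u = θ u := by
  rcases (tsupport θ).eq_empty_or_nonempty with he | hne
  · rw [tsupport_eq_empty_iff] at he
    subst he
    exact ⟨0, hθ, fun u => by simp⟩
  obtain ⟨a, ha, hab⟩ := hθ.compact.isCompact.exists_isLeast hne
  obtain ⟨b, hb, hbb⟩ := hθ.compact.isCompact.exists_isGreatest hne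
  have hIcc : Icc a b ⊆ U := hc.out (hθ.subset ha) (hθ.subset hb)
  have hθ0 : ∀ u, u ∉ Icc a b → θ u = 0 := fun u hu =>
    image_eq_zero_of_notMem_tsupport fun h => hu ⟨hab h, hbb h⟩
  -- Variation of constants: φ = Φ / w, where Φ is the primitive of θ w / D. To the left of the
  -- support of θ it vanishes by the choice of base point, to the right by the orthogonality
  -- hypothesis.
  set η : ℝ → ℝ := fun u => θ u * (w u / D u) with hη
  have hηs : ContDiff ℝ ∞ η :=
    contDiff_mul_of_tsupport hU hθ.smooth hθ.subset (hw.div hD hD0)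
  have hη0 : ∀ u, u ∉ Icc a b → η u = 0 := fun u hu => by simp [hη, hθ0 u hu]
  set Φ : ℝ → ℝ := fun u => ∫ v in a..u, η v with hΦ
  have hΦd : ∀ u, HasDerivAt Φ (η u) u := fun u =>
    intervalIntegral.integral_hasDerivAt_right (hηs.continuous.intervalIntegrable _ _)
      (hηs.continuous.stronglyMeasurableAtFilter _ _) hηs.continuous.continuousAt
  have hΦs : ContDiff ℝ ∞ Φ := by
    rw [contDiff_infty_iff_deriv]
    exact ⟨fun u => (hΦd u).differentiableAt, by
      rw [show deriv Φ = η from funext fun u => (hΦd u).deriv]; exact hηs⟩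
  have hsupp : Function.support η ⊆ Icc a b := fun u hu => by
    by_contra h; exact hu (hη0 u h)
  have hΦ0 : ∀ u, u ∉ Icc a b → Φ u = 0 := by
    intro u hu
    rcases lt_or_ge u a with h | h
    · rw [hΦ]
      simp only
      rw [intervalIntegral.integral_symm, intervalIntegral.integral_of_le h.le,
        ← integral_Icc_eq_integral_Ioc, integral_Icc_eq_integral_Ico]
      rw [setIntegral_eq_zero_of_forall_eq_zero fun v hv => hη0 v fun h' =>
        absurd hv.2 (not_lt.2 h'.1), neg_zero]
    · have hub : b < u := by
        by_contra h'; exact hu ⟨h, not_lt.1 h'⟩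
      rw [hΦ]
      simp only
      rw [intervalIntegral.integral_of_le h, ← integral_Icc_eq_integral_Ioc,
        setIntegral_eq_integral_of_forall_compl_eq_zero]
      · exact h0
      · intro v hv
        exact hη0 v fun h' => hv ⟨h'.1, h'.2.trans hub.le⟩
  have hΦt : tsupport Φ ⊆ Icc a b :=
    closure_minimal (fun u hu => by by_contra h; exact hu (hΦ0 u h)) isClosed_Icc
  refine ⟨fun u => Φ u * (w u)⁻¹, ⟨contDiff_mul_of_tsupport hU hΦs (hΦt.trans hIcc)
    (hw.inv hw0), ?_, ?_⟩, ?_⟩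
  · exact HasCompactSupport.intro isCompact_Icc fun u hu => by rw [hΦ0 u hu, zero_mul]
  · refine (closure_minimal (fun u hu => ?_) isClosed_Icc).trans hIcc
    by_contra h
    exact hu (by simp [hΦ0 u h])
  · intro u
    by_cases hu : u ∈ U
    · have hd := ((hΦd u).mul ((hwd u hu).inv (hw0 u hu))).deriv
      have : (fun u => Φ u * (w u)⁻¹) = Φ * w⁻¹ := rfl
      rw [this, hd]
      have h1 := hD0 u hu
      have h2 := hw0 u hu
      simp only [hη, Pi.inv_apply, Pi.mul_apply]
      field_simp
      ring
    · have hu' : u ∉ Icc a b := fun h => hu (hIcc h)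
      have hev : (fun u => Φ u * (w u)⁻¹) =ᶠ[𝓝 u] fun _ => 0 := by
        filter_upwards [isClosed_Icc.isOpen_compl.mem_nhds hu'] with v hv
        rw [hΦ0 v hv, zero_mul]
      change D u * deriv (fun u => Φ u * (w u)⁻¹) u + t u * (Φ u * (w u)⁻¹) = θ u
      rw [hev.deriv_eq, hΦ0 u hu', hθ0 u hu']
      simp

lemma exists_bump {U : Set ℝ} (hU : IsOpen U) {u₀ : ℝ} (hu : u₀ ∈ U) :
    ∃ θ, TestOn U θ ∧ (∀ u, 0 ≤ θ u) ∧ θ u₀ = 1 := by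
  obtain ⟨f, h1, h2, h3, h4, h5⟩ :=
    exists_contDiff_tsupport_subset (n := ⊤) (hU.mem_nhds hu)
  exact ⟨f, ⟨h3, h2, h1⟩, fun u => (h4 ⟨u, rfl⟩).1, h5⟩

lemma integral_bump_pos {U : Set ℝ} (hU : IsOpen U) {u₀ : ℝ} (hu : u₀ ∈ U) {θ k : ℝ → ℝ}
    (hθ : TestOn U θ) (h0 : ∀ u, 0 ≤ θ u) (h1 : θ u₀ = 1) (hk : ContinuousOn k U)
    (hk0 : ∀ u ∈ U, 0 < k u) : 0 < ∫ u, θ u * k u := by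
  have hcont : Continuous fun u => θ u * k u := by
    rw [continuous_iff_continuousAt]
    intro x
    by_cases hx : x ∈ tsupport θ
    · exact hθ.smooth.continuous.continuousAt.mul (hk.continuousAt (hU.mem_nhds (hθ.subset hx)))
    · have : (fun x => θ x * k x) =ᶠ[𝓝 x] fun _ => 0 := by
        filter_upwards [notMem_tsupport_iff_eventuallyEq.1 hx] with y hy
        simp [hy]
      exact (continuousAt_const (y := (0 : ℝ))).congr this.symm
  refine hcont.integral_pos_of_hasCompactSupport_nonneg_nonzero hθ.compact.mul_right
    (fun u => ?_) (x := u₀) ?_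
  · by_cases hx : u ∈ tsupport θ
    · exact mul_nonneg (h0 u) (hk0 u (hθ.subset hx)).le
    · simp [image_eq_zero_of_notMem_tsupport hx]
  · rw [h1, one_mul]; exact (hk0 u₀ hu).ne'

lemma TestOn.continuous_mul {U : Set ℝ} (hU : IsOpen U) {θ k : ℝ → ℝ}
    (hθ : TestOn U θ) (hk : ContinuousOn k U) : Continuous fun u => θ u * k u := by
  rw [continuous_iff_continuousAt]
  intro x
  by_cases hx : x ∈ tsupport θ
  · exact hθ.smooth.continuous.continuousAt.mul (hk.continuousAt (hU.mem_nhds (hθ.subset hx)))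
  · have : (fun x => θ x * k x) =ᶠ[𝓝 x] fun _ => 0 := by
      filter_upwards [notMem_tsupport_iff_eventuallyEq.1 hx] with y hy
      simp [hy]
    exact (continuousAt_const (y := (0 : ℝ))).congr this.symm

lemma TestOn.integrable_mul {U : Set ℝ} (hU : IsOpen U) {θ k : ℝ → ℝ}
    (hθ : TestOn U θ) (hk : ContinuousOn k U) : Integrable fun u => θ u * k u :=
  (hθ.continuous_mul hU hk).integrable_of_hasCompactSupport hθ.compact.mul_right

lemma TestOn.smul {U : Set ℝ} {θ : ℝ → ℝ} (hθ : TestOn U θ) (a : ℝ) :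
    TestOn U fun u => a * θ u :=
  ⟨contDiff_const.mul hθ.smooth, hθ.compact.mul_left,
    (closure_mono (show Function.support _ ⊆ Function.support θ from
      fun u hu h => hu (by simp [h]))).trans hθ.subset⟩

lemma TestOn.sub {U : Set ℝ} {θ η : ℝ → ℝ} (hθ : TestOn U θ) (hη : TestOn U η) :
    TestOn U fun u => θ u - η u :=
  ⟨hθ.smooth.sub hη.smooth, hθ.compact.sub hη.compact,
    (tsupport_sub θ η).trans (union_subset hθ.subset hη.subset)⟩

lemma TestOn.mono {U V : Set ℝ} {θ : ℝ → ℝ} (hθ : TestOn U θ) (h : U ⊆ V) : TestOn V θ :=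
  ⟨hθ.smooth, hθ.compact, hθ.subset.trans h⟩

/-- Two positive solutions of the same first order equation are proportional. -/
lemma exists_const_mul_of_ode {U : Set ℝ} (hU : IsOpen U) (hc : U.OrdConnected) {s w v : ℝ → ℝ}
    (hw : ∀ u ∈ U, HasDerivAt w (s u * w u) u) (hv : ∀ u ∈ U, HasDerivAt v (s u * v u) u)
    (hv0 : ∀ u ∈ U, v u ≠ 0) : ∃ C : ℝ, ∀ u ∈ U, w u = C * v u := by
  rcases U.eq_empty_or_nonempty with rfl | ⟨u₀, hu₀⟩
  · exact ⟨0, fun u hu => hu.elim⟩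
  have hd : ∀ u ∈ U, HasDerivAt (fun u => w u / v u) 0 u := by
    intro u hu
    have := (hw u hu).div (hv u hu) (hv0 u hu)
    rwa [show s u * w u * v u - w u * (s u * v u) = 0 by ring, zero_div] at this
  refine ⟨w u₀ / v u₀, fun u hu => ?_⟩
  have := hU.is_const_of_deriv_eq_zero hc.isPreconnected
    (fun u hu => (hd u hu).differentiableAt.differentiableWithinAt)
    (fun u hu => (hd u hu).deriv) hu hu₀
  rw [← this, div_mul_cancel₀ _ (hv0 u hu)]

end OneDim

/-! ### Weak solutions of the Pearson equation (D h)' = t h -/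

section Pearson

lemma hasDerivAt_of_eq {f g : ℝ → ℝ} {a b x : ℝ} (h : HasDerivAt f a x) (hf : ∀ y, g y = f y)
    (hab : a = b) : HasDerivAt g b x := by
  rw [← hab, show g = f from funext hf]; exact h

/-- On an interval on which `D` is positive, a weak solution of `(D h)' = t h` which is positive
somewhere is a positive solution. -/
lemma pearson_on_interval {D t h : ℝ → ℝ} {W U : Set ℝ} (hD : ContDiff ℝ ∞ D)
    (ht : ContDiff ℝ ∞ t) (hU : IsOpen U) (hUc : U.OrdConnected) (hUD : ∀ u ∈ U, 0 < D u)
    (hW : IsOpen W) (hc : ContinuousOn h W) (h0 : ∀ u, u ∉ W → h u = 0)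
    (hfill : interior (closure {u | 0 < h u}) ⊆ W) (hint : Integrable h)
    (hweak : ∀ φ, ContDiff ℝ ∞ φ → HasCompactSupport φ →
      ∫ u, (D u * deriv φ u + t u * φ u) * h u = 0)
    {u₁ : ℝ} (hu₁ : u₁ ∈ U) (hpos : 0 < h u₁) :
    U ⊆ W ∧ ∀ u ∈ U, 0 < h u ∧ HasDerivAt (fun u => D u * h u) (t u * h u) u := by
  have hD0 : ∀ u ∈ U, D u ≠ 0 := fun u hu => (hUD u hu).ne'
  obtain ⟨w, hw0, hwd, hws⟩ := exists_integrating_factor hU hUc hu₁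
    (s := fun u => t u / D u) (ht.contDiffOn.div hD.contDiffOn hD0)
  have hu₁W : u₁ ∈ W := by
    by_contra h'; rw [h0 u₁ h'] at hpos; exact lt_irrefl _ hpos
  set k : ℝ → ℝ := fun u => w u / D u with hk
  have hkc : ContinuousOn k U := hws.continuousOn.div hD.continuous.continuousOn hD0
  have hk0 : ∀ u ∈ U, 0 < k u := fun u hu => div_pos (hw0 u) (hUD u hu)
  obtain ⟨θ, hθ, hθ0, hθ1⟩ := exists_bump hU hu₁
  have hI := integral_bump_pos hU hu₁ hθ hθ0 hθ1 hkc hk0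
  set I := ∫ u, θ u * k u with hIdef
  -- The candidate is h = C k, where k = w / D solves the equation; C is fixed by testing against
  -- the single bump θ.
  set C := (∫ u, θ u * h u) / I with hC
  have hθh : ∀ φ, TestOn U φ → Integrable fun u => φ u * h u := by
    intro φ hφ
    obtain ⟨K, hK⟩ := hφ.smooth.continuous.bounded_above_of_compact_support hφ.compact
    exact hint.bdd_mul hφ.smooth.continuous.aestronglyMeasurable
      (Eventually.of_forall hK)
  have hae : ∀ᵐ u, u ∈ U → h u - C * k u = 0 := by
    refine hU.ae_eq_zero_of_integral_contDiff_smul_eq_zero (μ := volume) ?_ ?_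
    · exact (hint.locallyIntegrable.locallyIntegrableOn U).sub
        ((continuousOn_const.mul hkc).locallyIntegrableOn hU.measurableSet)
    · intro φ h1 h2 h3
      have hφ : TestOn U φ := ⟨h1, h2, h3⟩
      have hφk := hφ.integrable_mul hU hkc
      set J := ∫ u, φ u * k u with hJ
      -- Removing a multiple of θ makes the test function orthogonal to k, hence of the form D ψ' +
      -- t ψ with ψ a test function; such functions are killed by h.
      have hη : TestOn U fun u => φ u - (J / I) * θ u := hφ.sub (hθ.smul _)
      have hη0 : ∫ u, (φ u - (J / I) * θ u) * (w u / D u) = 0 := by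
        have e : ∀ u, (φ u - (J / I) * θ u) * (w u / D u) =
            φ u * k u - (J / I) * (θ u * k u) := fun u => by simp only [hk]; ring
        simp only [e]
        rw [integral_sub hφk ((hθ.integrable_mul hU hkc).const_mul _), integral_const_mul,
          ← hIdef, ← hJ]
        field_simp
        ring
      obtain ⟨ψ, hψ, hψe⟩ := exists_testOn_solution hU hUc hD.contDiffOn hD0 hws
        (fun u _ => (hw0 u).ne') hwd hη hη0
      have := hweak ψ hψ.smooth hψ.compact
      simp only [hψe, sub_mul, mul_assoc] at this
      rw [integral_sub (hθh φ hφ) ((hθh θ hθ).const_mul _), integral_const_mul] at this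
      have e : ∀ u, φ u • (h u - C * k u) = φ u * h u - C * (φ u * k u) := fun u => by
        rw [smul_eq_mul]; ring
      simp only [e]
      rw [integral_sub (hθh φ hφ) (hφk.const_mul _), integral_const_mul, ← hJ]
      have : ∫ u, φ u * h u = J / I * ∫ u, θ u * h u := by linarith
      rw [this, hC]
      field_simp
      ring
  have hVopen : IsOpen ({u | u ∈ W ∧ 0 < h u} ∩ U) :=
    (hc.isOpen_inter_preimage hW isOpen_Ioi).inter hU
  have hCpos : 0 < C := by
    by_contra hCn
    have hz : volume ({u | u ∈ W ∧ 0 < h u} ∩ U) = 0 := by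
      refine measure_mono_null ?_ (ae_iff.1 hae)
      rintro u ⟨⟨-, hu⟩, huU⟩ h'
      have := h' huU
      have h2 := mul_nonneg (neg_nonneg.2 (not_lt.1 hCn)) (hk0 u huU).le
      linarith
    exact (hVopen.measure_pos volume ⟨u₁, ⟨hu₁W, hpos⟩, hu₁⟩).ne' hz
  -- Since h equals C k > 0 almost everywhere on U, the set where h is positive is dense in U, and
  -- the filling hypothesis leaves no hole of W inside U.
  have hUW : U ⊆ W := by
    refine (interior_maximal ?_ hU).trans hfill
    intro u hu
    rw [mem_closure_iff]
    intro o ho huo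
    by_contra hemp
    have hz : volume (o ∩ U) = 0 := by
      refine measure_mono_null ?_ (ae_iff.1 hae)
      rintro v ⟨hvo, hvU⟩ h'
      refine hemp ⟨v, hvo, ?_⟩
      have h2 := mul_pos hCpos (hk0 v hvU)
      have := h' hvU
      simp only [mem_ofPred_eq]
      linarith
    exact ((ho.inter hU).measure_pos volume ⟨u, huo, hu⟩).ne' hz
  have heq : EqOn h (fun u => C * k u) U := by
    refine Measure.eqOn_open_of_ae_eq (μ := volume) ?_ hU (hc.mono hUW)
      (continuousOn_const.mul hkc)
    rw [EventuallyEq, ae_restrict_iff' hU.measurableSet]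
    filter_upwards [hae] with u hu hu'
    linarith [hu hu']
  refine ⟨hUW, fun u hu => ⟨?_, ?_⟩⟩
  · rw [heq hu]; exact mul_pos hCpos (hk0 u hu)
  · have hev : (fun u => D u * h u) =ᶠ[𝓝 u] fun u => C * w u := by
      filter_upwards [hU.mem_nhds hu] with v hv
      rw [heq hv]
      have := hD0 v hv
      simp only [hk]
      field_simp
    have h2 := ((hwd u hu).const_mul C).congr_of_eventuallyEq hev
    refine hasDerivAt_of_eq h2 (fun _ => rfl) ?_
    rw [heq hu]
    simp only [hk]
    ring

lemma exists_nonneg_of_leading {p : ℝ} (hp : 0 < p) (q r : ℝ) :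
    ∃ M : ℝ, ∀ u, M < u → 0 ≤ p * u ^ 2 + q * u + r := by
  refine ⟨1 + (|q| + |r|) / p, fun u hu => ?_⟩
  have h1 : 0 ≤ (|q| + |r|) / p := by positivity
  have hu1 : 1 ≤ u := by linarith
  have h2 : |q| + |r| ≤ p * u := by
    have : (|q| + |r|) / p ≤ u := by linarith
    rw [div_le_iff₀ hp] at this
    linarith
  have h3 : -|q| * u ≤ q * u := mul_le_mul_of_nonneg_right (neg_abs_le q) (by linarith)
  have h4 : -|r| * u ≤ r := by nlinarith [neg_abs_le r, abs_nonneg r]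
  nlinarith

/-- A tail with slow decay contradicts the existence of moments. -/
lemma false_of_slow_tail {d2 d1 d0 t1 t0 u₁ : ℝ} {h : ℝ → ℝ}
    (hD : ∀ u, u₁ ≤ u → 0 < d2 * u ^ 2 + d1 * u + d0) (hpos : ∀ u, u₁ ≤ u → 0 < h u)
    (hd : ∀ u, u₁ ≤ u →
      HasDerivAt (fun u => (d2 * u ^ 2 + d1 * u + d0) * h u) ((t1 * u + t0) * h u) u)
    (hm : ∀ n : ℕ, Integrable fun u => u ^ n * h u) (C : ℕ) (M : ℝ)
    (hC : ∀ u, M < u → 0 ≤ C * (d2 * u ^ 2 + d1 * u + d0) + u * (t1 * u + t0)) : False := by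
  set a := max (max u₁ (M + 1)) 1 with ha
  have ha1 : u₁ ≤ a := (le_max_left _ _).trans (le_max_left _ _)
  have ha2 : M + 1 ≤ a := (le_max_right _ _).trans (le_max_left _ _)
  have ha3 : 1 ≤ a := le_max_right _ _
  -- By the equation, f' is u ^ C * h times D + (C D + u t), which is nonnegative. So f stays above
  -- f(a) > 0, although f ≤ K u ^ (C + 3) h is integrable at infinity.
  set f : ℝ → ℝ := fun u => u ^ (C + 1) * ((d2 * u ^ 2 + d1 * u + d0) * h u) with hf
  have hfd : ∀ u, a ≤ u → HasDerivAt f (((C + 1 : ℕ) : ℝ) * u ^ C * ((d2 * u ^ 2 + d1 * u + d0) *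
      h u) + u ^ (C + 1) * ((t1 * u + t0) * h u)) u := fun u hu => by
    have := (hasDerivAt_pow (C + 1) u).mul (hd u (ha1.trans hu))
    exact hasDerivAt_of_eq this (fun _ => rfl) (by simp)
  have hmono : MonotoneOn f (Ici a) := by
    refine monotoneOn_of_deriv_nonneg (convex_Ici a)
      (fun u hu => (hfd u hu).continuousAt.continuousWithinAt)
      (fun u hu => (hfd u (interior_subset hu)).differentiableAt.differentiableWithinAt) ?_
    intro u hu
    have hu' : a ≤ u := interior_subset hu
    rw [(hfd u hu').deriv]
    have e : ((C + 1 : ℕ) : ℝ) * u ^ C * ((d2 * u ^ 2 + d1 * u + d0) * h u) +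
        u ^ (C + 1) * ((t1 * u + t0) * h u) = u ^ C * h u *
        ((d2 * u ^ 2 + d1 * u + d0) +
          (C * (d2 * u ^ 2 + d1 * u + d0) + u * (t1 * u + t0))) := by
      push_cast; ring
    rw [e]
    have hu1 : 0 ≤ u := by linarith
    exact mul_nonneg (mul_nonneg (pow_nonneg hu1 _) (hpos u (ha1.trans hu')).le)
      (add_nonneg (hD u (ha1.trans hu')).le (hC u (by linarith)))
  have hfa : 0 < f a := mul_pos (pow_pos (by linarith) _) (mul_pos (hD a ha1) (hpos a ha1))
  set K := |d2| + |d1| + |d0| with hK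
  have hDle : ∀ u, a ≤ u → d2 * u ^ 2 + d1 * u + d0 ≤ K * u ^ 2 := by
    intro u hu
    have hu1 : 1 ≤ u := ha3.trans hu
    have h1 : d2 * u ^ 2 ≤ |d2| * u ^ 2 := mul_le_mul_of_nonneg_right (le_abs_self _) (sq_nonneg _)
    have h2 : d1 * u ≤ |d1| * u ^ 2 := by
      have := mul_le_mul_of_nonneg_right (le_abs_self d1) (by linarith : (0 : ℝ) ≤ u)
      nlinarith [abs_nonneg d1, mul_nonneg (abs_nonneg d1) (by nlinarith : 0 ≤ u ^ 2 - u)]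
    have h3 : d0 ≤ |d0| * u ^ 2 := by
      nlinarith [abs_nonneg d0, le_abs_self d0,
        mul_nonneg (abs_nonneg d0) (by nlinarith : 0 ≤ u ^ 2 - 1)]
    rw [hK]; nlinarith
  have hi := ((hm (C + 3)).const_mul K).integrableOn (s := Ioi a)
  have hbd : IntegrableOn (fun _ : ℝ => f a) (Ioi a) := by
    refine Integrable.mono' hi aestronglyMeasurable_const ?_
    rw [ae_restrict_iff' measurableSet_Ioi]
    refine Eventually.of_forall fun u hu => ?_
    have hu' : a ≤ u := le_of_lt hu
    rw [Real.norm_of_nonneg hfa.le]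
    refine (hmono (mem_Ici.2 le_rfl) (mem_Ici.2 hu') hu').trans ?_
    have hu1 : 0 ≤ u := by linarith
    have := mul_le_mul_of_nonneg_left (mul_le_mul_of_nonneg_right (hDle u hu')
      (hpos u (ha1.trans hu')).le) (pow_nonneg hu1 (C + 1))
    refine this.trans (le_of_eq ?_)
    ring
  rw [integrableOn_const_iff] at hbd
  rcases hbd with h' | h'
  · exact hfa.ne' (by simpa using h')
  · simp at h'

/-- The reflection u ↦ -u exchanges the two tails and changes the signs of d1 and t0. -/
lemma false_of_slow_left_tail {d2 d1 d0 t1 t0 u₁ : ℝ} {h : ℝ → ℝ}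
    (hD : ∀ u, u ≤ u₁ → 0 < d2 * u ^ 2 + d1 * u + d0) (hpos : ∀ u, u ≤ u₁ → 0 < h u)
    (hd : ∀ u, u ≤ u₁ →
      HasDerivAt (fun u => (d2 * u ^ 2 + d1 * u + d0) * h u) ((t1 * u + t0) * h u) u)
    (hm : ∀ n : ℕ, Integrable fun u => u ^ n * h u) (C : ℕ) (M : ℝ)
    (hC : ∀ u, M < u → 0 ≤ C * (d2 * u ^ 2 - d1 * u + d0) + u * (t1 * u - t0)) : False := by
  refine false_of_slow_tail (d2 := d2) (d1 := -d1) (d0 := d0) (t1 := t1) (t0 := -t0) (u₁ := -u₁)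
    (h := fun u => h (-u)) (fun u hu => ?_) (fun u hu => hpos _ (by linarith)) (fun u hu => ?_)
    (fun n => ?_) C M (fun u hu => ?_)
  · have := hD (-u) (by linarith)
    nlinarith
  · have h1 : HasDerivAt (fun u : ℝ => -u) (-1) u := hasDerivAt_neg u
    have := (hd (-u) (by linarith)).comp u h1
    refine hasDerivAt_of_eq this (fun v => ?_) (by ring)
    simp only [Function.comp]
    ring
  · have := (hm n).comp_neg.const_mul ((-1) ^ n)
    refine this.congr (Eventually.of_forall fun u => ?_)
    simp only
    rw [← mul_assoc, ← mul_pow]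
    simp
  · have := hC u hu
    nlinarith

/-- A weak solution of the Pearson equation `(D h)' = t h` on the line having all moments. -/
lemma pearson_basic {d2 d1 d0 t1 t0 : ℝ} {h : ℝ → ℝ} {W : Set ℝ}
    (hWD : ∀ u ∈ W, 0 < d2 * u ^ 2 + d1 * u + d0)
    (hW : IsOpen W) (hc : ContinuousOn h W) (h0 : ∀ u, u ∉ W → h u = 0)
    (hne : ∃ u, 0 < h u)
    (hfill : interior (closure {u | 0 < h u}) ⊆ W) (hm : ∀ n : ℕ, Integrable fun u => u ^ n * h u)
    (hweak : ∀ φ, ContDiff ℝ ∞ φ → HasCompactSupport φ →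
      ∫ u, ((d2 * u ^ 2 + d1 * u + d0) * deriv φ u + (t1 * u + t0) * φ u) * h u = 0) :
    d2 ≤ 0 ∧ W = {u | 0 < d2 * u ^ 2 + d1 * u + d0} ∧ ∀ u ∈ W, 0 < h u ∧
      HasDerivAt (fun u => (d2 * u ^ 2 + d1 * u + d0) * h u) ((t1 * u + t0) * h u) u := by
  obtain ⟨u₁, hu₁⟩ := hne
  have hu₁W : u₁ ∈ W := by
    by_contra h'; rw [h0 u₁ h'] at hu₁; exact lt_irrefl _ hu₁
  have hint : Integrable h := by simpa using hm 0
  have hDs : ContDiff ℝ ∞ fun u : ℝ => d2 * u ^ 2 + d1 * u + d0 := by fun_prop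
  have hts : ContDiff ℝ ∞ fun u : ℝ => t1 * u + t0 := by fun_prop
  have hPopen : IsOpen {u : ℝ | 0 < d2 * u ^ 2 + d1 * u + d0} :=
    isOpen_lt continuous_const hDs.continuous
  have key : ∀ U ⊆ {u : ℝ | 0 < d2 * u ^ 2 + d1 * u + d0}, IsOpen U → U.OrdConnected → u₁ ∈ U →
      U ⊆ W ∧ ∀ u ∈ U, 0 < h u ∧
      HasDerivAt (fun u => (d2 * u ^ 2 + d1 * u + d0) * h u) ((t1 * u + t0) * h u) u :=
    fun U hUP hU hUc huU => pearson_on_interval hDs hts hU hUc (fun u hu => hUP hu) hW hc h0 hfill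
      hint hweak huU hu₁
  -- If d2 > 0, then D is convex, so it stays positive on one of the two half-lines starting at u₁.
  -- There h decays only polynomially, since C D + u t is eventually nonnegative once C d2 + t1 > 0;
  -- this contradicts the moments.
  have hd2 : d2 ≤ 0 := by
    by_contra hd2
    rw [not_le] at hd2
    obtain ⟨C, hC⟩ := exists_nat_gt (-t1 / d2)
    have hC' : 0 < C * d2 + t1 := by
      rw [div_lt_iff₀ hd2] at hC; linarith
    set U := connectedComponentIn {u : ℝ | 0 < d2 * u ^ 2 + d1 * u + d0} u₁ with hUdef
    have hk := key U (connectedComponentIn_subset _ _) hPopen.connectedComponentIn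
      isPreconnected_connectedComponentIn.ordConnected (mem_connectedComponentIn (hWD u₁ hu₁W))
    have hor : (∀ u, u₁ ≤ u → 0 < d2 * u ^ 2 + d1 * u + d0) ∨
        (∀ u, u ≤ u₁ → 0 < d2 * u ^ 2 + d1 * u + d0) := by
      by_contra hcon
      push Not at hcon
      obtain ⟨⟨v, hv1, hv2⟩, ⟨v', hv1', hv2'⟩⟩ := hcon
      have hpos := hWD u₁ hu₁W
      have hv1 : u₁ < v := lt_of_le_of_ne hv1 fun h => by rw [← h] at hv2; linarith
      have hv1' : v' < u₁ := lt_of_le_of_ne hv1' fun h => by rw [h] at hv2'; linarith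
      have e : (d2 * u₁ ^ 2 + d1 * u₁ + d0) * (v - v') =
        (d2 * v' ^ 2 + d1 * v' + d0) * (v - u₁) + (d2 * v ^ 2 + d1 * v + d0) * (u₁ - v') -
          d2 * ((v - v') * ((u₁ - v') * (v - u₁))) := by ring
      have h1 : 0 < (d2 * u₁ ^ 2 + d1 * u₁ + d0) * (v - v') := mul_pos hpos (by linarith)
      have h2 : 0 ≤ d2 * ((v - v') * ((u₁ - v') * (v - u₁))) :=
        mul_nonneg hd2.le (mul_nonneg (by linarith) (mul_nonneg (by linarith) (by linarith)))
      have h3 := mul_nonneg (neg_nonneg.2 hv2') (by linarith : 0 ≤ v - u₁)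
      have h4 := mul_nonneg (neg_nonneg.2 hv2) (by linarith : 0 ≤ u₁ - v')
      nlinarith
    rcases hor with hor | hor
    · have hsub : Ici u₁ ⊆ U := isPreconnected_Ici.subset_connectedComponentIn
        (mem_Ici.2 le_rfl) fun u hu => hor u hu
      obtain ⟨M, hM⟩ := exists_nonneg_of_leading hC' (C * d1 + t0) (C * d0)
      exact false_of_slow_tail hor (fun u hu => (hk.2 u (hsub hu)).1)
        (fun u hu => (hk.2 u (hsub hu)).2) hm C M fun u hu => by
          have := hM u hu; nlinarith
    · have hsub : Iic u₁ ⊆ U := isPreconnected_Iic.subset_connectedComponentIn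
        (mem_Iic.2 le_rfl) fun u hu => hor u hu
      obtain ⟨M, hM⟩ := exists_nonneg_of_leading hC' (-C * d1 - t0) (C * d0)
      exact false_of_slow_left_tail hor (fun u hu => (hk.2 u (hsub hu)).1)
        (fun u hu => (hk.2 u (hsub hu)).2) hm C M fun u hu => by
          have := hM u hu; nlinarith
  -- D is now concave, so its positivity set is an interval and `pearson_on_interval` applies to all
  -- of it at once.
  have hcon : {u : ℝ | 0 < d2 * u ^ 2 + d1 * u + d0}.OrdConnected := by
    refine ⟨fun v' hv' v hv u hu => ?_⟩
    simp only [mem_ofPred_eq] at hv hv' ⊢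
    rcases eq_or_lt_of_le hu.1 with h1 | h1
    · rwa [← h1]
    have e : (d2 * u ^ 2 + d1 * u + d0) * (v - v') =
        (d2 * v' ^ 2 + d1 * v' + d0) * (v - u) + (d2 * v ^ 2 + d1 * v + d0) * (u - v') +
          (-d2) * ((v - v') * ((u - v') * (v - u))) := by ring
    have hvv : 0 < v - v' := by linarith [hu.2]
    have h2 : 0 ≤ (-d2) * ((v - v') * ((u - v') * (v - u))) :=
      mul_nonneg (by linarith) (mul_nonneg hvv.le
        (mul_nonneg (by linarith) (by linarith [hu.2])))
    have h3 := mul_nonneg hv'.le (by linarith [hu.2] : 0 ≤ v - u)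
    have h4 := mul_pos hv (by linarith : 0 < u - v')
    exact pos_of_mul_pos_left (by linarith) hvv.le
  have hk := key _ subset_rfl hPopen hcon (hWD u₁ hu₁W)
  have hWeq : W = {u : ℝ | 0 < d2 * u ^ 2 + d1 * u + d0} := Subset.antisymm hWD hk.1
  exact ⟨hd2, hWeq, fun u hu => hk.2 u (hWD u hu)⟩

end Pearson

/-! ### Reduction of Pearson weights to the Hermite, Laguerre and Jacobi families -/

section NormalForm

/-- The interval, the two coefficients of the Pearson equation `(D f)' = t f`, and its solution, for
the three classical families. -/
inductive StdForm : Set ℝ → (ℝ → ℝ) → (ℝ → ℝ) → (ℝ → ℝ) → Prop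
  | hermite : StdForm univ (fun _ => 1) (fun v => -v) (fun v => Real.exp (-v ^ 2 / 2))
  | laguerre (a : ℝ) (ha : 0 < a) :
      StdForm (Ioi 0) (fun v => v) (fun v => a - v) (fun v => v ^ (a - 1) * Real.exp (-v))
  | jacobi (p q : ℝ) (hp : 0 < p) (hq : 0 < q) :
      StdForm (Ioo (-1) 1) (fun v => 1 - v ^ 2) (fun v => q - p - (p + q) * v)
        (fun v => (1 - v) ^ (p - 1) * (1 + v) ^ (q - 1))

lemma hermite_ode (v : ℝ) :
    HasDerivAt (fun v : ℝ => 1 * Real.exp (-v ^ 2 / 2)) (-v * Real.exp (-v ^ 2 / 2)) v := by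
  have h1 : HasDerivAt (fun v : ℝ => -v ^ 2 / 2) (-v) v :=
    hasDerivAt_of_eq (((hasDerivAt_pow 2 v).neg).div_const 2) (fun _ => rfl) (by simp; ring)
  exact hasDerivAt_of_eq h1.exp (fun _ => one_mul _) (by ring)

lemma laguerre_ode (a : ℝ) {v : ℝ} (hv : 0 < v) :
    HasDerivAt (fun v : ℝ => v * (v ^ (a - 1) * Real.exp (-v)))
      ((a - v) * (v ^ (a - 1) * Real.exp (-v))) v := by
  have h1 := ((hasDerivAt_id v).rpow_const (p := a - 1) (Or.inl hv.ne')).mul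
    (hasDerivAt_neg v).exp
  refine hasDerivAt_of_eq ((hasDerivAt_id v).mul h1) (fun _ => rfl) ?_
  simp only [id, Real.rpow_sub_one hv.ne', Pi.mul_apply]
  field_simp
  ring

lemma jacobi_ode (p q : ℝ) {v : ℝ} (hv : v ∈ Ioo (-1 : ℝ) 1) :
    HasDerivAt (fun v : ℝ => (1 - v ^ 2) * ((1 - v) ^ (p - 1) * (1 + v) ^ (q - 1)))
      ((q - p - (p + q) * v) * ((1 - v) ^ (p - 1) * (1 + v) ^ (q - 1))) v := by
  have hv1 : 0 < 1 - v := by linarith [hv.2]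
  have hv2 : 0 < 1 + v := by linarith [hv.1]
  have h1 := ((hasDerivAt_id v).const_sub 1).rpow_const (p := p - 1) (Or.inl hv1.ne')
  have h2 := ((hasDerivAt_id v).const_add 1).rpow_const (p := q - 1) (Or.inl hv2.ne')
  have h3 := ((hasDerivAt_pow 2 v).const_sub 1).mul (h1.mul h2)
  refine hasDerivAt_of_eq h3 (fun _ => rfl) ?_
  simp only [id, Real.rpow_sub_one hv1.ne', Real.rpow_sub_one hv2.ne', Pi.mul_apply]
  field_simp
  push_cast
  ring

lemma StdForm.pos {J : Set ℝ} {D₀ t₀ f₀ : ℝ → ℝ} (h : StdForm J D₀ t₀ f₀) :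
    ∀ v ∈ J, 0 < f₀ v := by
  cases h with
  | hermite => exact fun v _ => Real.exp_pos _
  | laguerre a ha => exact fun v hv => mul_pos (Real.rpow_pos_of_pos hv _) (Real.exp_pos _)
  | jacobi p q hp hq =>
    exact fun v hv => mul_pos (Real.rpow_pos_of_pos (by linarith [hv.2]) _)
      (Real.rpow_pos_of_pos (by linarith [hv.1]) _)

/-- The functions D h and D · f₀(γu + δ) solve the same equation w' = (t / D) w on an interval, so
they are proportional. The factors γ² and γ in the two hypotheses on D and t are those produced by
substituting v = γu + δ. -/
lemma density_eq_of_ode {D t h : ℝ → ℝ} {W : Set ℝ} (hW : IsOpen W) (hWc : W.OrdConnected)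
    (hne : W.Nonempty) (hDpos : ∀ u ∈ W, 0 < D u) (hpos : ∀ u ∈ W, 0 < h u)
    (hd : ∀ u ∈ W, HasDerivAt (fun u => D u * h u) (t u * h u) u)
    {J : Set ℝ} {D₀ t₀ f₀ : ℝ → ℝ} (hf₀ : ∀ v ∈ J, 0 < f₀ v)
    (hode : ∀ v ∈ J, HasDerivAt (fun v => D₀ v * f₀ v) (t₀ v * f₀ v) v)
    {γ δ β : ℝ} (hγ : γ ≠ 0) (hβ : 0 < β) (hDD : ∀ u, γ ^ 2 * D u = β * D₀ (γ * u + δ))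
    (htt : ∀ u, γ * t u = β * t₀ (γ * u + δ)) (hWJ : W = {u | γ * u + δ ∈ J}) :
    ∃ C, 0 < C ∧ ∀ u ∈ W, h u = C * f₀ (γ * u + δ) := by
  have hJ : ∀ u ∈ W, γ * u + δ ∈ J := fun u hu => by rw [hWJ] at hu; exact hu
  have hD0 : ∀ u, D₀ (γ * u + δ) = γ ^ 2 / β * D u := fun u => by
    have := hDD u; field_simp; linarith
  have ht0 : ∀ u, t₀ (γ * u + δ) = γ / β * t u := fun u => by
    have := htt u; field_simp; linarith
  obtain ⟨C', hC'⟩ := exists_const_mul_of_ode (s := fun u => t u / D u)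
    (w := fun u => D u * h u) (v := fun u => D u * f₀ (γ * u + δ)) hW hWc
    (fun u hu => hasDerivAt_of_eq (hd u hu) (fun _ => rfl) (by
      have := (hDpos u hu).ne'; field_simp))
    (fun u hu => by
      have h1 : HasDerivAt (fun u : ℝ => γ * u + δ) γ u :=
        hasDerivAt_of_eq (((hasDerivAt_id u).const_mul γ).add_const δ) (fun _ => rfl) (by simp)
      have h2 := ((hode _ (hJ u hu)).comp u h1).const_mul (β / γ ^ 2)
      refine hasDerivAt_of_eq h2 (fun v => ?_) ?_
      · simp only [Function.comp, hD0]
        field_simp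
      · rw [ht0]
        have := (hDpos u hu).ne'
        field_simp)
    (fun u hu => (mul_pos (hDpos u hu) (hf₀ _ (hJ u hu))).ne')
  have heq : ∀ u ∈ W, h u = C' * f₀ (γ * u + δ) := fun u hu => by
    have h1 := hC' u hu
    have := (hDpos u hu).ne'
    have h2 : D u * h u = D u * (C' * f₀ (γ * u + δ)) := by rw [h1]; ring
    exact mul_left_cancel₀ this h2
  refine ⟨C', ?_, heq⟩
  obtain ⟨u, hu⟩ := hne
  have h1 := hpos u hu
  rw [heq u hu] at h1
  exact pos_of_mul_pos_left h1 (hf₀ _ (hJ u hu)).le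

lemma integrableOn_of_density {h f₀ : ℝ → ℝ} {W J : Set ℝ} {γ δ C : ℝ} (hγ : γ ≠ 0) (hC : 0 < C)
    (hJm : MeasurableSet J)
    (hWJ : W = {u | γ * u + δ ∈ J}) (hh : ∀ u ∈ W, h u = C * f₀ (γ * u + δ))
    (h0 : ∀ u, u ∉ W → h u = 0) (hint : Integrable h) : IntegrableOn f₀ J := by
  rw [← integrable_indicator_iff hJm]
  have h1 : Integrable fun u => J.indicator f₀ (γ * u + δ) := by
    refine (hint.const_mul C⁻¹).congr (Eventually.of_forall fun u => ?_)
    by_cases hu : u ∈ W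
    · have : γ * u + δ ∈ J := by rw [hWJ] at hu; exact hu
      simp only [hh u hu, indicator_of_mem this]
      field_simp
    · have : γ * u + δ ∉ J := fun h => hu (by rw [hWJ]; exact h)
      simp [h0 u hu, indicator_of_notMem this]
  have h2 : Integrable fun u => (fun v => J.indicator f₀ (v + δ)) (γ * u) := h1
  replace h2 := (integrable_comp_mul_left_iff (fun v => J.indicator f₀ (v + δ)) hγ).1 h2
  have := h2.comp_add_right (-δ)
  simpa using this

/-- On (0, 1) the exponential is bounded below, so integrability of v ^ (a - 1) near 0 decides. -/
lemma pos_of_integrable_laguerre {a : ℝ}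
    (h : IntegrableOn (fun v : ℝ => v ^ (a - 1) * Real.exp (-v)) (Ioi 0)) : 0 < a := by
  have h1 := (h.mono_set (Ioo_subset_Ioi_self : Ioo (0 : ℝ) 1 ⊆ Ioi 0)).const_mul (Real.exp 1)
  have h2 : IntegrableOn (fun v : ℝ => v ^ (a - 1)) (Ioo 0 1) := by
    refine Integrable.mono' h1 (ContinuousOn.aestronglyMeasurable (fun v hv =>
      (Real.continuousAt_rpow_const _ _ (Or.inl hv.1.ne')).continuousWithinAt)
      measurableSet_Ioo) ?_
    rw [ae_restrict_iff' measurableSet_Ioo]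
    refine Eventually.of_forall fun v hv => ?_
    have hp := Real.rpow_pos_of_pos hv.1 (a - 1)
    rw [Real.norm_of_nonneg hp.le]
    have : 1 ≤ Real.exp 1 * Real.exp (-v) := by
      rw [← Real.exp_add]; exact Real.one_le_exp (by linarith [hv.2])
    calc v ^ (a - 1) = v ^ (a - 1) * 1 := (mul_one _).symm
      _ ≤ v ^ (a - 1) * (Real.exp 1 * Real.exp (-v)) := mul_le_mul_of_nonneg_left this hp.le
      _ = _ := by ring
  rw [intervalIntegral.integrableOn_Ioo_rpow_iff one_pos] at h2
  linarith

/-- Only the endpoint -1 is examined, after a translation to 0; near it the other factor is at least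
c > 0. The condition on p follows later from the symmetry v ↦ -v. -/
lemma pos_of_integrable_jacobi {p q : ℝ}
    (h : IntegrableOn (fun v : ℝ => (1 - v) ^ (p - 1) * (1 + v) ^ (q - 1)) (Ioo (-1) 1)) :
    0 < q := by
  rw [← integrable_indicator_iff measurableSet_Ioo] at h
  have h0 := h.comp_add_right (-1)
  set c := min 1 ((2 : ℝ) ^ (p - 1)) with hc
  have hc0 : 0 < c := lt_min one_pos (Real.rpow_pos_of_pos two_pos _)
  have h1 := (h0.const_mul c⁻¹).integrableOn (s := Ioo 0 1)
  have h2 : IntegrableOn (fun v : ℝ => v ^ (q - 1)) (Ioo 0 1) := by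
    refine Integrable.mono' h1 (ContinuousOn.aestronglyMeasurable (fun v hv =>
      (Real.continuousAt_rpow_const _ _ (Or.inl hv.1.ne')).continuousWithinAt)
      measurableSet_Ioo) ?_
    rw [ae_restrict_iff' measurableSet_Ioo]
    refine Eventually.of_forall fun v hv => ?_
    have hp := Real.rpow_pos_of_pos hv.1 (q - 1)
    rw [Real.norm_of_nonneg hp.le, indicator_of_mem
      (show v + -1 ∈ Ioo (-1 : ℝ) 1 from ⟨by linarith [hv.1], by linarith [hv.2]⟩)]
    have e1 : 1 - (v + -1) = 2 - v := by ring
    have e2 : 1 + (v + -1) = v := by ring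
    rw [e1, e2]
    have hcl : c ≤ (2 - v) ^ (p - 1) := by
      rcases le_total 0 (p - 1) with h' | h'
      · exact (min_le_left _ _).trans (Real.one_le_rpow (by linarith [hv.2]) h')
      · exact (min_le_right _ _).trans
          (Real.rpow_le_rpow_of_nonpos (by linarith [hv.2]) (by linarith [hv.1]) h')
    calc v ^ (q - 1) = c⁻¹ * (c * v ^ (q - 1)) := by field_simp
      _ ≤ c⁻¹ * ((2 - v) ^ (p - 1) * v ^ (q - 1)) := by gcongr
  rw [intervalIntegral.integrableOn_Ioo_rpow_iff one_pos] at h2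
  linarith

/-- Normal form of the weak solutions of Pearson equations having all moments. -/
lemma pearson_normal {d2 d1 d0 t1 t0 : ℝ} {h : ℝ → ℝ} {W : Set ℝ}
    (hWD : ∀ u ∈ W, 0 < d2 * u ^ 2 + d1 * u + d0)
    (hW : IsOpen W) (hc : ContinuousOn h W) (h0 : ∀ u, u ∉ W → h u = 0)
    (hne : ∃ u, 0 < h u)
    (hfill : interior (closure {u | 0 < h u}) ⊆ W) (hm : ∀ n : ℕ, Integrable fun u => u ^ n * h u)
    (hweak : ∀ φ, ContDiff ℝ ∞ φ → HasCompactSupport φ →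
      ∫ u, ((d2 * u ^ 2 + d1 * u + d0) * deriv φ u + (t1 * u + t0) * φ u) * h u = 0) :
    ∃ (J : Set ℝ) (D₀ t₀ f₀ : ℝ → ℝ) (γ δ β C : ℝ), StdForm J D₀ t₀ f₀ ∧ γ ≠ 0 ∧ 0 < β ∧ 0 < C ∧
      (∀ u, γ ^ 2 * (d2 * u ^ 2 + d1 * u + d0) = β * D₀ (γ * u + δ)) ∧
      (∀ u, γ * (t1 * u + t0) = β * t₀ (γ * u + δ)) ∧
      W = {u | γ * u + δ ∈ J} ∧ ∀ u ∈ W, h u = C * f₀ (γ * u + δ) := by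
  obtain ⟨hd2, hWeq, hk⟩ := pearson_basic hWD hW hc h0 hne hfill hm hweak
  have hint : Integrable h := by simpa using hm 0
  obtain ⟨u₁, hu₁⟩ := hne
  have hu₁W : u₁ ∈ W := by
    by_contra h'; rw [h0 u₁ h'] at hu₁; exact lt_irrefl _ hu₁
  have hpos := fun u hu => (hk u hu).1
  have hd := fun u hu => (hk u hu).2
  have hmemW : ∀ u, u ∈ W ↔ 0 < d2 * u ^ 2 + d1 * u + d0 := fun u => by rw [hWeq]; rfl
  rcases eq_or_lt_of_le hd2 with hd2 | hd2
  · subst hd2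
    by_cases hd1 : d1 = 0
    · subst hd1
      have hd0 : 0 < d0 := by simpa using hWD u₁ hu₁W
      have hall : ∀ u, u ∈ W := fun u => (hmemW u).2 (by simpa using hd0)
      -- With D constant and t1 ≥ 0, the sign of t0 selects a half-line on which h does not decay,
      -- contradicting integrability.
      have ht1 : t1 < 0 := by
        by_contra ht1
        rw [not_lt] at ht1
        rcases le_total 0 t0 with ht0 | ht0
        · refine false_of_slow_tail (u₁ := 0) (fun u _ => hWD u (hall u))
            (fun u _ => hpos u (hall u)) (fun u _ => hd u (hall u)) hm 0 0 fun u hu => ?_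
          have := mul_nonneg ht1 (sq_nonneg u)
          have := mul_nonneg ht0 hu.le
          push_cast
          nlinarith
        · refine false_of_slow_left_tail (u₁ := 0) (fun u _ => hWD u (hall u))
            (fun u _ => hpos u (hall u)) (fun u _ => hd u (hall u)) hm 0 0 fun u hu => ?_
          have := mul_nonneg ht1 (sq_nonneg u)
          have := mul_nonneg (neg_nonneg.2 ht0) hu.le
          push_cast
          nlinarith
      set γ := √(-t1 / d0) with hγ
      have hq : 0 < -t1 / d0 := div_pos (by linarith) hd0
      have hγ0 : 0 < γ := Real.sqrt_pos.2 hq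
      have hγ2 : γ ^ 2 * d0 = -t1 := by
        rw [hγ, Real.sq_sqrt hq.le]; field_simp
      have hDD : ∀ u : ℝ, γ ^ 2 * (0 * u ^ 2 + 0 * u + d0) = -t1 * (fun _ => 1 : ℝ → ℝ)
          (γ * u + γ * t0 / t1) := fun u => by
        simp only; linarith
      have htt : ∀ u : ℝ, γ * (t1 * u + t0) = -t1 * (fun v => -v : ℝ → ℝ)
          (γ * u + γ * t0 / t1) := fun u => by
        have := ht1.ne; field_simp
      have hWJ : W = {u | γ * u + γ * t0 / t1 ∈ (univ : Set ℝ)} := by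
        ext u; simp [hall u]
      have std := StdForm.hermite
      obtain ⟨C, hC, hCe⟩ := density_eq_of_ode hW (hWJ ▸ ordConnected_univ)
        ⟨u₁, hu₁W⟩ hWD hpos hd std.pos (fun v _ => hermite_ode v) hγ0.ne' (by linarith) hDD htt hWJ
      exact ⟨_, _, _, _, γ, _, -t1, C, std, hγ0.ne', by linarith, hC, hDD, htt, hWJ, hCe⟩
    · have hmemW' : ∀ u, u ∈ W ↔ 0 < d1 * u + d0 := fun u => by rw [hmemW]; simp
      -- W is a half-line, and its direction is the sign of d1. If t1 ≥ 0, the tail along it is at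
      -- most polynomially small.
      have ht1 : t1 < 0 := by
        by_contra ht1
        rw [not_lt] at ht1
        rcases lt_or_gt_of_ne hd1 with hd1' | hd1'
        · obtain ⟨C, hC⟩ := exists_nat_gt ((t0 + 1) / (-d1))
          rw [div_lt_iff₀ (by linarith)] at hC
          have hle : ∀ u, u ≤ u₁ → u ∈ W := fun u hu => (hmemW' u).2 (by
            have := (hmemW' u₁).1 hu₁W; nlinarith)
          refine false_of_slow_left_tail (u₁ := u₁) (fun u hu => hWD u (hle u hu))
            (fun u hu => hpos u (hle u hu)) (fun u hu => hd u (hle u hu)) hm C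
            (max 0 (C * |d0|)) fun u hu => ?_
          have hu0 : 0 < u := (le_max_left _ _).trans_lt hu
          have hu1 : C * |d0| < u := (le_max_right _ _).trans_lt hu
          have h1 := mul_nonneg ht1 (sq_nonneg u)
          have h2 : -(C * |d0|) ≤ C * d0 := by
            have := mul_le_mul_of_nonneg_left (neg_abs_le d0) (Nat.cast_nonneg C : (0 : ℝ) ≤ C)
            linarith
          nlinarith [mul_pos (sub_pos.2 hC) hu0]
        · obtain ⟨C, hC⟩ := exists_nat_gt ((1 - t0) / d1)
          rw [div_lt_iff₀ hd1'] at hC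
          have hle : ∀ u, u₁ ≤ u → u ∈ W := fun u hu => (hmemW' u).2 (by
            have := (hmemW' u₁).1 hu₁W; nlinarith)
          refine false_of_slow_tail (u₁ := u₁) (fun u hu => hWD u (hle u hu))
            (fun u hu => hpos u (hle u hu)) (fun u hu => hd u (hle u hu)) hm C
            (max 0 (C * |d0|)) fun u hu => ?_
          have hu0 : 0 < u := (le_max_left _ _).trans_lt hu
          have hu1 : C * |d0| < u := (le_max_right _ _).trans_lt hu
          have h1 := mul_nonneg ht1 (sq_nonneg u)
          have h2 : -(C * |d0|) ≤ C * d0 := by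
            have := mul_le_mul_of_nonneg_left (neg_abs_le d0) (Nat.cast_nonneg C : (0 : ℝ) ≤ C)
            linarith
          nlinarith [mul_pos (sub_pos.2 hC) hu0]
      -- The values of γ, δ and a solve γ² D = -t1 v and γ t = -t1 (a - v) for v = γu + δ. The sign
      -- of γ is that of d1, so a left half-line is reflected.
      set γ := -t1 / d1 with hγ
      set δ := γ * d0 / d1 with hδ
      set a := (t0 + γ * d0) / d1 with ha
      have hγ0 : γ ≠ 0 := div_ne_zero (by linarith) hd1
      have hDD : ∀ u : ℝ, γ ^ 2 * (0 * u ^ 2 + d1 * u + d0) = -t1 * (fun v => v : ℝ → ℝ)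
          (γ * u + δ) := fun u => by
        simp only [hδ, hγ]; field_simp; ring
      have htt : ∀ u : ℝ, γ * (t1 * u + t0) = -t1 * (fun v => a - v : ℝ → ℝ)
          (γ * u + δ) := fun u => by
        simp only [hδ, ha, hγ]; field_simp; ring
      have hWJ : W = {u | γ * u + δ ∈ Ioi (0 : ℝ)} := by
        ext u
        rw [hmemW, mem_ofPred_eq, mem_Ioi]
        have h1 := hDD u
        have hg2 : 0 < γ ^ 2 := by positivity
        constructor
        · intro h'
          have h2 := mul_pos hg2 h'
          rw [h1] at h2
          exact (mul_pos_iff_of_pos_left (by linarith : 0 < -t1)).1 h2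
        · intro h'
          have h2 : 0 < -t1 * (γ * u + δ) := mul_pos (by linarith) h'
          rw [← h1] at h2
          exact (mul_pos_iff_of_pos_left hg2).1 h2
      have hWc : W.OrdConnected := by
        refine ⟨fun x hx y hy z hz => ?_⟩
        rw [hmemW'] at hx hy ⊢
        rcases lt_or_gt_of_ne hd1 with h' | h' <;> nlinarith [hz.1, hz.2]
      obtain ⟨C, hC, hCe⟩ := density_eq_of_ode (f₀ := fun v : ℝ => v ^ (a - 1) * Real.exp (-v)) hW
        hWc ⟨u₁, hu₁W⟩ hWD hpos hd
        (fun v hv => mul_pos (Real.rpow_pos_of_pos hv _) (Real.exp_pos _))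
        (fun v hv => laguerre_ode a hv) hγ0 (by linarith) hDD htt hWJ
      have ha0 := pos_of_integrable_laguerre
        (integrableOn_of_density (f₀ := fun v : ℝ => v ^ (a - 1) * Real.exp (-v)) hγ0 hC
          measurableSet_Ioi hWJ hCe h0 hint)
      exact ⟨_, _, _, _, γ, _, -t1, C, StdForm.laguerre a ha0, hγ0, by linarith, hC, hDD, htt, hWJ,
        hCe⟩
  · set κ := -d2 with hκ
    have hκ0 : 0 < κ := by linarith
    -- Completing the square, D = κ (σ² - (u - z)²): W is the interval of centre z and half-length
    -- σ, and v = (u - z) / σ.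
    set z := d1 / (2 * κ) with hz
    have hsq : 0 < z ^ 2 + d0 / κ := by
      have h1 := hWD u₁ hu₁W
      have e : d2 * u₁ ^ 2 + d1 * u₁ + d0 = κ * ((z ^ 2 + d0 / κ) - (u₁ - z) ^ 2) := by
        rw [hz, show d2 = -κ by linarith]; field_simp; ring
      rw [e] at h1
      have := pos_of_mul_pos_right h1 hκ0.le
      nlinarith [sq_nonneg (u₁ - z)]
    set σ := √(z ^ 2 + d0 / κ) with hσ
    have hσ0 : 0 < σ := Real.sqrt_pos.2 hsq
    have hσ2 : σ ^ 2 = z ^ 2 + d0 / κ := Real.sq_sqrt hsq.le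
    have hDe : ∀ u, d2 * u ^ 2 + d1 * u + d0 = κ * (σ ^ 2 - (u - z) ^ 2) := fun u => by
      rw [hσ2, hz, show d2 = -κ by linarith]; field_simp; ring
    set γ := 1 / σ with hγ
    set δ := -z / σ with hδ
    have hγ0 : γ ≠ 0 := by positivity
    set S := -t1 / κ with hS
    set R := (γ * t0 - t1 * δ) / κ with hR
    set p := (S - R) / 2 with hp
    set q := (S + R) / 2 with hq
    have hDD : ∀ u : ℝ, γ ^ 2 * (d2 * u ^ 2 + d1 * u + d0) = κ * (fun v => 1 - v ^ 2 : ℝ → ℝ)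
        (γ * u + δ) := fun u => by
      rw [hDe]; simp only [hγ, hδ]; field_simp; ring
    have htt : ∀ u : ℝ, γ * (t1 * u + t0) = κ * (fun v => q - p - (p + q) * v : ℝ → ℝ)
        (γ * u + δ) := fun u => by
      have e1 : q - p = R := by rw [hp, hq]; ring
      have e2 : p + q = S := by rw [hp, hq]; ring
      simp only [e1, e2, hR, hS]
      field_simp
      ring
    have hWJ : W = {u | γ * u + δ ∈ Ioo (-1 : ℝ) 1} := by
      ext u
      rw [hmemW, mem_ofPred_eq]
      have h1 := hDD u
      have hg2 : 0 < γ ^ 2 := by positivity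
      have e : γ * u + δ ∈ Ioo (-1 : ℝ) 1 ↔ 0 < 1 - (γ * u + δ) ^ 2 := by
        rw [mem_Ioo, ← abs_lt, sub_pos, sq_lt_one_iff_abs_lt_one]
      rw [e]
      constructor
      · intro h'
        have h2 := mul_pos hg2 h'
        rw [h1] at h2
        exact (mul_pos_iff_of_pos_left hκ0).1 h2
      · intro h'
        have h2 := mul_pos hκ0 h'
        rw [← h1] at h2
        exact (mul_pos_iff_of_pos_left hg2).1 h2
    have hWc : W.OrdConnected := by
      refine ⟨fun x hx y hy w hw => ?_⟩
      rw [hWJ] at hx hy ⊢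
      have hg : 0 < γ := by positivity
      have := mul_le_mul_of_nonneg_left hw.1 hg.le
      have := mul_le_mul_of_nonneg_left hw.2 hg.le
      exact ⟨by linarith [hx.1], by linarith [hy.2]⟩
    obtain ⟨C, hC, hCe⟩ := density_eq_of_ode
      (f₀ := fun v : ℝ => (1 - v) ^ (p - 1) * (1 + v) ^ (q - 1)) hW
      hWc ⟨u₁, hu₁W⟩ hWD hpos hd
      (fun v hv => mul_pos (Real.rpow_pos_of_pos (by linarith [hv.2]) _)
        (Real.rpow_pos_of_pos (by linarith [hv.1]) _))
      (fun v hv => jacobi_ode p q hv) hγ0 hκ0 hDD htt hWJ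
    have hI := integrableOn_of_density
      (f₀ := fun v : ℝ => (1 - v) ^ (p - 1) * (1 + v) ^ (q - 1)) hγ0 hC measurableSet_Ioo hWJ hCe h0 hint
    have hq0 := pos_of_integrable_jacobi hI
    have hp0 : 0 < p := by
      rw [← integrable_indicator_iff measurableSet_Ioo] at hI
      have h2 := hI.comp_neg
      refine pos_of_integrable_jacobi (p := q) ?_
      rw [← integrable_indicator_iff measurableSet_Ioo]
      refine h2.congr (Eventually.of_forall fun v => ?_)
      simp only [indicator, mem_Ioo]
      by_cases hv : -1 < v ∧ v < 1
      · rw [if_pos hv, if_pos ⟨by linarith, by linarith⟩, sub_neg_eq_add, ← sub_eq_add_neg, mul_comm]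
      · rw [if_neg hv, if_neg fun h' => hv ⟨by linarith [h'.2], by linarith [h'.1]⟩]
    exact ⟨_, _, _, _, γ, _, κ, C, StdForm.jacobi p q hp0 hq0, hγ0, hκ0, hC, hDD, htt, hWJ, hCe⟩

end NormalForm

/-! ### Densities determined up to a factor by one-variable test functions are products -/

section Separation

/-- The hypothesis says that G / k does not depend on x in the weak sense. If G / k were at least α₁
near (x₁, u) and at most α₂ < α₁ near (x₂, u), testing with bumps at x₁ and x₂, weighted so that the
k-integral cancels, would give a positive number equal to zero. One-sided bounds are enough, so the
lemma also applies at points where G is not known to be continuous. -/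
lemma false_of_separated {I : Set ℝ} (hI : IsOpen I) {k : ℝ → ℝ} (hk : ContinuousOn k I)
    (hk0 : ∀ x ∈ I, 0 < k x) {G : ℝ × ℝ → ℝ}
    (hint : ∀ θ ψ, TestOn I θ → TestOn univ ψ → Integrable fun q : ℝ × ℝ => θ q.1 * ψ q.2 * G q)
    (heq : ∀ θ ψ, TestOn I θ → TestOn univ ψ → ∫ x, θ x * k x = 0 →
      ∫ q : ℝ × ℝ, θ q.1 * ψ q.2 * G q = 0)
    {x₁ x₂ u α₁ α₂ : ℝ} (hx₁ : x₁ ∈ I) (hx₂ : x₂ ∈ I) (hα : α₂ < α₁)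
    (h1 : ∀ᶠ q in 𝓝 (x₁, u), α₁ * k q.1 ≤ G q) (h2 : ∀ᶠ q in 𝓝 (x₂, u), G q ≤ α₂ * k q.1) :
    False := by
  obtain ⟨U₁, V₁, hU₁, hxU₁, hV₁, huV₁, hs₁⟩ := mem_nhds_prod_iff'.1 h1
  obtain ⟨U₂, V₂, hU₂, hxU₂, hV₂, huV₂, hs₂⟩ := mem_nhds_prod_iff'.1 h2
  obtain ⟨θ₁, ht₁, hp₁, ho₁⟩ := exists_bump (hU₁.inter hI) ⟨hxU₁, hx₁⟩
  obtain ⟨θ₂, ht₂, hp₂, ho₂⟩ := exists_bump (hU₂.inter hI) ⟨hxU₂, hx₂⟩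
  obtain ⟨ψ, hψ, hψp, hψo⟩ := exists_bump (hV₁.inter hV₂) ⟨huV₁, huV₂⟩
  have htI₁ : TestOn I θ₁ := ht₁.mono inter_subset_right
  have htI₂ : TestOn I θ₂ := ht₂.mono inter_subset_right
  have hψu : TestOn univ ψ := hψ.mono (subset_univ _)
  have i₁ := integral_bump_pos hI hx₁ htI₁ hp₁ ho₁ hk hk0
  have i₂ := integral_bump_pos hI hx₂ htI₂ hp₂ ho₂ hk hk0
  have iψ : 0 < ∫ v, ψ v := by
    have := integral_bump_pos (k := fun _ => 1) isOpen_univ (mem_univ u) hψu hψp hψo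
      continuousOn_const (fun _ _ => one_pos)
    simpa using this
  set I₁ := ∫ x, θ₁ x * k x with hI₁
  set I₂ := ∫ x, θ₂ x * k x with hI₂
  have n₁ := htI₁.integrable_mul hI hk
  have n₂ := htI₂.integrable_mul hI hk
  have nψ : Integrable ψ := hψ.smooth.continuous.integrable_of_hasCompactSupport hψ.compact
  have key := heq (fun x => I₂ * θ₁ x - I₁ * θ₂ x) ψ ((htI₁.smul _).sub (htI₂.smul _)) hψu (by
    have : ∀ x, (I₂ * θ₁ x - I₁ * θ₂ x) * k x = I₂ * (θ₁ x * k x) - I₁ * (θ₂ x * k x) :=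
      fun x => by ring
    simp only [this]
    rw [integral_sub (n₁.const_mul _) (n₂.const_mul _), integral_const_mul, integral_const_mul]
    ring)
  have e : ∀ q : ℝ × ℝ, (I₂ * θ₁ q.1 - I₁ * θ₂ q.1) * ψ q.2 * G q =
      I₂ * (θ₁ q.1 * ψ q.2 * G q) - I₁ * (θ₂ q.1 * ψ q.2 * G q) := fun q => by ring
  simp only [e] at key
  rw [integral_sub ((hint θ₁ ψ htI₁ hψu).const_mul _) ((hint θ₂ ψ htI₂ hψu).const_mul _),
    integral_const_mul, integral_const_mul] at key
  have m₁ : α₁ * (I₁ * ∫ v, ψ v) ≤ ∫ q : ℝ × ℝ, θ₁ q.1 * ψ q.2 * G q := by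
    rw [hI₁, ← integral_prod_mul, ← integral_const_mul]
    refine integral_mono ((n₁.mul_prod nψ).const_mul _) (hint θ₁ ψ htI₁ hψu) fun q => ?_
    by_cases hq : q.1 ∈ tsupport θ₁ ∧ q.2 ∈ tsupport ψ
    · have := hs₁ (show q ∈ U₁ ×ˢ V₁ from ⟨(ht₁.subset hq.1).1, (hψ.subset hq.2).1⟩)
      have h3 := mul_le_mul_of_nonneg_left this (mul_nonneg (hp₁ q.1) (hψp q.2))
      simp only
      linarith
    · have : θ₁ q.1 * ψ q.2 = 0 := by
        by_cases h' : q.1 ∈ tsupport θ₁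
        · rw [image_eq_zero_of_notMem_tsupport fun h'' => hq ⟨h', h''⟩, mul_zero]
        · rw [image_eq_zero_of_notMem_tsupport h', zero_mul]
      refine le_of_eq ?_
      simp only
      rw [this, show α₁ * (θ₁ q.1 * k q.1 * ψ q.2) = α₁ * k q.1 * (θ₁ q.1 * ψ q.2) by ring, this]
      ring
  have m₂ : ∫ q : ℝ × ℝ, θ₂ q.1 * ψ q.2 * G q ≤ α₂ * (I₂ * ∫ v, ψ v) := by
    rw [hI₂, ← integral_prod_mul, ← integral_const_mul]
    refine integral_mono (hint θ₂ ψ htI₂ hψu) ((n₂.mul_prod nψ).const_mul _) fun q => ?_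
    by_cases hq : q.1 ∈ tsupport θ₂ ∧ q.2 ∈ tsupport ψ
    · have := hs₂ (show q ∈ U₂ ×ˢ V₂ from ⟨(ht₂.subset hq.1).1, (hψ.subset hq.2).2⟩)
      have h3 := mul_le_mul_of_nonneg_left this (mul_nonneg (hp₂ q.1) (hψp q.2))
      simp only
      linarith
    · have : θ₂ q.1 * ψ q.2 = 0 := by
        by_cases h' : q.1 ∈ tsupport θ₂
        · rw [image_eq_zero_of_notMem_tsupport fun h'' => hq ⟨h', h''⟩, mul_zero]
        · rw [image_eq_zero_of_notMem_tsupport h', zero_mul]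
      refine le_of_eq ?_
      simp only
      rw [this, show α₂ * (θ₂ q.1 * k q.1 * ψ q.2) = α₂ * k q.1 * (θ₂ q.1 * ψ q.2) by ring, this]
      ring
  have f₁ := mul_le_mul_of_nonneg_left m₁ i₂.le
  have f₂ := mul_le_mul_of_nonneg_left m₂ i₁.le
  have f₃ : 0 < (α₁ - α₂) * (I₁ * I₂ * ∫ v, ψ v) :=
    mul_pos (sub_pos.2 hα) (mul_pos (mul_pos i₁ i₂) iψ)
  nlinarith

/-- A density whose pairing with `θ(x)ψ(u)` depends on `θ` through `∫ θ k` only is a product. -/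
lemma separated_of_integral_eq {I : Set ℝ} (hI : IsOpen I) {k : ℝ → ℝ} (hk : ContinuousOn k I)
    (hk0 : ∀ x ∈ I, 0 < k x) {G : ℝ × ℝ → ℝ} {Ω : Set (ℝ × ℝ)} (hΩ : IsOpen Ω)
    (hΩI : ∀ q ∈ Ω, q.1 ∈ I) (hG : ContinuousOn G Ω) (hG0 : ∀ q, q ∉ Ω → G q = 0)
    (hGn : ∀ q, 0 ≤ G q) (hreg : ∀ O : Set (ℝ × ℝ), IsOpen O → (∀ q ∈ O, q.1 ∈ I) →
      O ⊆ closure Ω → O ⊆ Ω)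
    (hint : ∀ θ ψ, TestOn I θ → TestOn univ ψ → Integrable fun q : ℝ × ℝ => θ q.1 * ψ q.2 * G q)
    (heq : ∀ θ ψ, TestOn I θ → TestOn univ ψ → ∫ x, θ x * k x = 0 →
      ∫ q : ℝ × ℝ, θ q.1 * ψ q.2 * G q = 0) :
    ∀ x₁ ∈ I, ∀ x₂ ∈ I, ∀ u, G (x₁, u) * k x₂ = G (x₂, u) * k x₁ := by
  have hmemΩ : ∀ q, 0 < G q → q ∈ Ω := fun q hq => by
    by_contra h; rw [hG0 q h] at hq; exact lt_irrefl _ hq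
  have hkat : ∀ q : ℝ × ℝ, q.1 ∈ I → ContinuousAt (fun q : ℝ × ℝ => k q.1) q := fun q hq =>
    ContinuousAt.comp (f := Prod.fst) (hk.continuousAt (hI.mem_nhds hq)) continuousAt_fst
  have hdiv : ∀ q : ℝ × ℝ, q ∈ Ω → ContinuousAt (fun q : ℝ × ℝ => G q / k q.1) q := fun q hq =>
    (hG.continuousAt (hΩ.mem_nhds hq)).div (hkat q (hΩI q hq)) (hk0 _ (hΩI q hq)).ne'
  have hlow : ∀ q ∈ Ω, ∀ α, α < G q / k q.1 → ∀ᶠ q' in 𝓝 q, α * k q'.1 ≤ G q' := by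
    intro q hq α hα
    filter_upwards [(hdiv q hq).eventually (lt_mem_nhds hα), hΩ.mem_nhds hq] with q' h1 h2
    rw [lt_div_iff₀ (hk0 _ (hΩI q' h2))] at h1
    exact h1.le
  have hup : ∀ q ∈ Ω, ∀ α, G q / k q.1 < α → ∀ᶠ q' in 𝓝 q, G q' ≤ α * k q'.1 := by
    intro q hq α hα
    filter_upwards [(hdiv q hq).eventually (gt_mem_nhds hα), hΩ.mem_nhds hq] with q' h1 h2
    rw [div_lt_iff₀ (hk0 _ (hΩI q' h2))] at h1
    exact h1.le
  -- Continuity of G is only known in Ω, so one first shows that positivity at height u for one x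
  -- puts the whole horizontal line over I into Ω. A point of a strip around it outside the closure
  -- of Ω would have G = 0 nearby, against `false_of_separated`; regularity of Ω then replaces the
  -- closure by Ω.
  have hcol : ∀ x₁ ∈ I, ∀ x₂ ∈ I, ∀ u, 0 < G (x₁, u) → (x₂, u) ∈ Ω := by
    intro x₁ hx₁ x₂ hx₂ u hpos
    have hcont := hG.continuousAt (hΩ.mem_nhds (hmemΩ _ hpos))
    have hc2 : ContinuousAt (fun v : ℝ => G (x₁, v)) u :=
      ContinuousAt.comp (f := fun v : ℝ => (x₁, v)) hcont (by fun_prop)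
    obtain ⟨V, hVsub, hV, huV⟩ := mem_nhds_iff.1 (hc2.eventually (lt_mem_nhds hpos))
    have hO : I ×ˢ V ⊆ closure Ω := by
      rintro ⟨x, v⟩ ⟨hx, hv⟩
      by_contra hncl
      have hv0 : 0 < G (x₁, v) := hVsub hv
      have hq := hmemΩ _ hv0
      have hr : 0 < G (x₁, v) / k x₁ := div_pos hv0 (hk0 _ hx₁)
      refine false_of_separated hI hk hk0 hint heq (α₁ := G (x₁, v) / k x₁ / 2) (α₂ := 0)
        hx₁ hx (by linarith) (hlow _ hq _ (by simp only; linarith)) ?_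
      filter_upwards [isClosed_closure.isOpen_compl.mem_nhds hncl] with q' hq'
      rw [hG0 q' fun h => hq' (subset_closure h), zero_mul]
    exact hreg _ (hI.prod hV) (fun q hq => hq.1) hO ⟨hx₂, huV⟩
  have hle : ∀ x₁ ∈ I, ∀ x₂ ∈ I, ∀ u, 0 < G (x₁, u) → G (x₁, u) / k x₁ ≤ G (x₂, u) / k x₂ := by
    intro x₁ hx₁ x₂ hx₂ u hpos
    by_contra hlt
    rw [not_le] at hlt
    obtain ⟨α₂, h1, h2⟩ := exists_between hlt
    obtain ⟨α₁, h3, h4⟩ := exists_between h2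
    exact false_of_separated hI hk hk0 hint heq hx₁ hx₂ h3
      (hlow _ (hmemΩ _ hpos) _ h4) (hup _ (hcol x₁ hx₁ x₂ hx₂ u hpos) _ h1)
  intro x₁ hx₁ x₂ hx₂ u
  have hle' : ∀ x₁ ∈ I, ∀ x₂ ∈ I, G (x₁, u) / k x₁ ≤ G (x₂, u) / k x₂ := by
    intro x₁ hx₁ x₂ hx₂
    rcases eq_or_lt_of_le (hGn (x₁, u)) with h | h
    · rw [← h, zero_div]; exact div_nonneg (hGn _) (hk0 _ hx₂).le
    · exact hle x₁ hx₁ x₂ hx₂ u h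
  have := le_antisymm (hle' x₁ hx₁ x₂ hx₂) (hle' x₂ hx₂ x₁ hx₁)
  rwa [div_eq_div_iff (hk0 _ hx₁).ne' (hk0 _ hx₂).ne'] at this

end Separation

/-! ### The coordinates (x, E(x) y - F(x)) -/

section Straightening

variable {Ω : Set (ℝ × ℝ)} {ρ : ℝ × ℝ → ℝ} {I : Set ℝ} {E F : ℝ → ℝ}

/-- The density in the coordinates `(x, u)`, `u = E(x) y - F(x)`. -/
noncomputable def straightDensity (ρ : ℝ × ℝ → ℝ) (E F : ℝ → ℝ) (q : ℝ × ℝ) : ℝ :=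
  ρ (q.1, (q.2 + F q.1) / E q.1) / E q.1

/-- The domain in the coordinates `(x, u)`, `u = E(x) y - F(x)`. -/
def straightDomain (Ω : Set (ℝ × ℝ)) (E F : ℝ → ℝ) : Set (ℝ × ℝ) :=
  {q | (q.1, (q.2 + F q.1) / E q.1) ∈ Ω}

lemma fst_mem_of_straight (hΩI : ∀ q ∈ Ω, q.1 ∈ I) {q : ℝ × ℝ}
    (hq : q ∈ straightDomain Ω E F) : q.1 ∈ I :=
  hΩI (q.1, (q.2 + F q.1) / E q.1) hq

lemma continuousOn_straight (hE : ContinuousOn E I) (hF : ContinuousOn F I)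
    (hE0 : ∀ x, 0 < E x) :
    ContinuousOn (fun q : ℝ × ℝ => (q.1, (q.2 + F q.1) / E q.1)) (I ×ˢ univ) := by
  have hE' : ContinuousOn (fun q : ℝ × ℝ => E q.1) (I ×ˢ univ) :=
    hE.comp continuousOn_fst fun q hq => hq.1
  have hF' : ContinuousOn (fun q : ℝ × ℝ => F q.1) (I ×ˢ univ) :=
    hF.comp continuousOn_fst fun q hq => hq.1
  exact continuousOn_fst.prodMk ((continuousOn_snd.add hF').div hE' fun q _ => (hE0 _).ne')

lemma isOpen_straightDomain (hI : IsOpen I) (hΩ : IsOpen Ω) (hΩI : ∀ q ∈ Ω, q.1 ∈ I)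
    (hE : ContinuousOn E I) (hF : ContinuousOn F I) (hE0 : ∀ x, 0 < E x) :
    IsOpen (straightDomain Ω E F) := by
  have := (continuousOn_straight hE hF hE0).isOpen_inter_preimage (hI.prod isOpen_univ) hΩ
  convert this using 1
  ext q
  exact ⟨fun h => ⟨⟨fst_mem_of_straight hΩI h, mem_univ _⟩, h⟩, fun h => h.2⟩

lemma continuousOn_straightDensity (hΩI : ∀ q ∈ Ω, q.1 ∈ I)
    (hE : ContinuousOn E I) (hF : ContinuousOn F I) (hE0 : ∀ x, 0 < E x)
    (hρ : ContinuousOn ρ Ω) : ContinuousOn (straightDensity ρ E F) (straightDomain Ω E F) := by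
  have hsub : straightDomain Ω E F ⊆ I ×ˢ univ := fun q hq =>
    ⟨fst_mem_of_straight hΩI hq, mem_univ _⟩
  have h1 := (continuousOn_straight hE hF hE0).mono hsub
  have hE' : ContinuousOn (fun q : ℝ × ℝ => E q.1) (straightDomain Ω E F) :=
    hE.comp continuousOn_fst fun q hq => fst_mem_of_straight hΩI hq
  exact (hρ.comp h1 fun q hq => hq).div hE' fun q _ => (hE0 _).ne'

/-- The straightening is a homeomorphism over I, so it carries the regularity of Ω along; the
restriction to open sets lying over I is needed because E and F are only controlled there. -/
lemma straight_regular (hI : IsOpen I) (hreg : interior (closure Ω) ⊆ Ω)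
    (hE : ContinuousOn E I) (hF : ContinuousOn F I) (hE0 : ∀ x, 0 < E x)
    (O : Set (ℝ × ℝ)) (hO : IsOpen O) (hOI : ∀ q ∈ O, q.1 ∈ I)
    (hcl : O ⊆ closure (straightDomain Ω E F)) : O ⊆ straightDomain Ω E F := by
  have hinv : ContinuousOn (fun p : ℝ × ℝ => (p.1, E p.1 * p.2 - F p.1)) (I ×ˢ univ) := by
    have hE' : ContinuousOn (fun q : ℝ × ℝ => E q.1) (I ×ˢ univ) :=
      hE.comp continuousOn_fst fun q hq => hq.1
    have hF' : ContinuousOn (fun q : ℝ × ℝ => F q.1) (I ×ˢ univ) :=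
      hF.comp continuousOn_fst fun q hq => hq.1
    exact continuousOn_fst.prodMk ((hE'.mul continuousOn_snd).sub hF')
  have hopen := hinv.isOpen_inter_preimage (hI.prod isOpen_univ) hO
  intro q hq
  refine hreg (mem_interior.2 ⟨_, ?_, hopen, ?_⟩)
  · rintro ⟨x, y⟩ ⟨-, hp⟩
    have hp' : (x, E x * y - F x) ∈ O := hp
    have h1 := (continuousOn_straight hE hF hE0).continuousAt
      ((hI.prod isOpen_univ).mem_nhds (show (x, E x * y - F x) ∈ I ×ˢ univ from
        ⟨hOI _ hp', mem_univ _⟩))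
    have h2 := mem_closure_image h1 (hcl hp')
    have e : ((x, E x * y - F x).1, ((x, E x * y - F x).2 + F (x, E x * y - F x).1) /
        E (x, E x * y - F x).1) = (x, y) := by
      have := (hE0 x).ne'
      simp only [Prod.mk.injEq, true_and]
      field_simp
      ring
    rw [e] at h2
    refine closure_mono ?_ h2
    rintro _ ⟨q', hq', rfl⟩
    exact hq'
  · refine ⟨⟨hOI q hq, mem_univ _⟩, ?_⟩
    have := (hE0 q.1).ne'
    have e : (q.1, E q.1 * ((q.2 + F q.1) / E q.1) - F q.1) = q := by
      refine Prod.ext rfl ?_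
      simp only
      field_simp
      ring
    change (q.1, E q.1 * ((q.2 + F q.1) / E q.1) - F q.1) ∈ O
    rwa [e]

lemma integrable_affine_iff {a b : ℝ} (ha : 0 < a) (K : ℝ → ℝ) :
    Integrable (fun u => K ((u + b) / a) / a) ↔ Integrable K := by
  constructor
  · intro h
    have h1 := (h.mul_const a).comp_add_right (-b)
    have h2 : Integrable fun u => K (a⁻¹ * u) := by
      refine h1.congr (Eventually.of_forall fun u => ?_)
      simp only
      rw [div_mul_cancel₀ _ ha.ne', div_eq_inv_mul]
      ring_nf
    exact (integrable_comp_mul_left_iff K (inv_ne_zero ha.ne')).1 h2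
  · intro h
    have h2 := ((integrable_comp_mul_left_iff K (inv_ne_zero ha.ne')).2 h).comp_add_right b
    refine (h2.div_const a).congr (Eventually.of_forall fun u => ?_)
    simp only
    rw [div_eq_inv_mul _ a, div_eq_inv_mul _ a, div_eq_inv_mul _ a]

lemma integral_affine {a b : ℝ} (ha : 0 < a) (K : ℝ → ℝ) :
    ∫ u, K ((u + b) / a) / a = ∫ y, K y := by
  rw [integral_div, integral_add_right_eq_self (fun u => K (u / a)) b,
    Measure.integral_comp_div K a, abs_of_pos ha, smul_eq_mul]
  field_simp

/-- By Fubini the change of variables is an affine one on each vertical line, so no two-dimensional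
Jacobian is needed and nothing is required of E and F outside I beyond E > 0. -/
lemma straight_integral (hI : IsOpen I) (hΩ : IsOpen Ω) (hΩI : ∀ q ∈ Ω, q.1 ∈ I)
    (hE : ContinuousOn E I) (hF : ContinuousOn F I) (hE0 : ∀ x, 0 < E x)
    (hρ : ContinuousOn ρ Ω) (hρ0 : ∀ p, p ∉ Ω → ρ p = 0) {H : ℝ × ℝ → ℝ}
    (hH : ContinuousOn H (I ×ˢ univ))
    (hint : Integrable fun p : ℝ × ℝ => H (p.1, E p.1 * p.2 - F p.1) * ρ p) :
    Integrable (fun q => H q * straightDensity ρ E F q) ∧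
      ∫ q, H q * straightDensity ρ E F q =
        ∫ p : ℝ × ℝ, H (p.1, E p.1 * p.2 - F p.1) * ρ p := by
  have hopen := isOpen_straightDomain hI hΩ hΩI hE hF hE0
  have hsub : straightDomain Ω E F ⊆ I ×ˢ univ := fun q hq =>
    ⟨fst_mem_of_straight hΩI hq, mem_univ _⟩
  have hmeas : AEStronglyMeasurable (fun q => H q * straightDensity ρ E F q) := by
    have h1 : ContinuousOn (fun q => H q * straightDensity ρ E F q) (straightDomain Ω E F) :=
      (hH.mono hsub).mul (continuousOn_straightDensity hΩI hE hF hE0 hρ)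
    have h2 := h1.aestronglyMeasurable (μ := volume) hopen.measurableSet
    rw [← aestronglyMeasurable_indicator_iff hopen.measurableSet] at h2
    refine h2.congr (Eventually.of_forall fun q => ?_)
    by_cases hq : q ∈ straightDomain Ω E F
    · simp [hq]
    · have : straightDensity ρ E F q = 0 := by
        rw [straightDensity, hρ0 _ hq, zero_div]
      simp [hq, this]
  have hsec : ∀ x u, H (x, u) * straightDensity ρ E F (x, u) =
      (fun y => H (x, E x * y - F x) * ρ (x, y)) ((u + F x) / E x) / E x := by
    intro x u
    have e : E x * ((u + F x) / E x) - F x = u := by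
      have := (hE0 x).ne'; field_simp; ring
    simp only [straightDensity, e]
    ring
  rw [Measure.volume_eq_prod] at hint
  have hi := (integrable_prod_iff hint.aestronglyMeasurable).1 hint
  have hInt : Integrable (fun q => H q * straightDensity ρ E F q) := by
    rw [Measure.volume_eq_prod] at hmeas ⊢
    rw [integrable_prod_iff hmeas]
    constructor
    · filter_upwards [hi.1] with x hx
      simp only [hsec]
      exact (integrable_affine_iff (hE0 x) fun y => H (x, E x * y - F x) * ρ (x, y)).2 hx
    · refine hi.2.congr (Eventually.of_forall fun x => ?_)
      simp only
      rw [← integral_affine (b := F x) (hE0 x)]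
      refine integral_congr_ae (Eventually.of_forall fun u => ?_)
      simp only
      rw [hsec, norm_div, Real.norm_of_nonneg (hE0 x).le]
  refine ⟨hInt, ?_⟩
  rw [Measure.volume_eq_prod] at hInt ⊢
  rw [integral_prod _ hInt, integral_prod _ hint]
  refine integral_congr_ae (Eventually.of_forall fun x => ?_)
  simp only [hsec]
  exact integral_affine (hE0 x) fun y => H (x, E x * y - F x) * ρ (x, y)

end Straightening

/-- The coefficient of `y²` in the determinant of the cometric. -/
noncomputable def disc₂ (A l : ℝ[X]) (c : ℝ) : ℝ[X] := A * C c - l ^ 2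

/-- The coefficient of `y` in the determinant of the cometric. -/
noncomputable def disc₁ (A l r m : ℝ[X]) : ℝ[X] := A * m - 2 * l * r

/-- The constant coefficient in the determinant of the cometric. -/
noncomputable def disc₀ (A r s : ℝ[X]) : ℝ[X] := A * s - r ^ 2

/-- The coefficient of `y` in the drift of the vertical equation. -/
noncomputable def drift₁ (A l β : ℝ[X]) (e : ℝ) : ℝ[X] :=
  A * (C e - derivative l) - l * (β - derivative A + l)

/-- The constant coefficient in the drift of the vertical equation. -/
noncomputable def drift₀ (A l r β B : ℝ[X]) : ℝ[X] :=
  A * (B - derivative r) - r * (β - derivative A + l)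

namespace WeakSolution

variable {Ω : Set (ℝ × ℝ)} {ρ : ℝ × ℝ → ℝ} {A l r m s β B : ℝ[X]} {c e : ℝ}

lemma isOpen_proj (ws : WeakSolution Ω ρ A l r m s β B c e) : IsOpen (Prod.fst '' Ω) :=
  isOpenMap_fst _ ws.isOpen

lemma ordConnected_proj (ws : WeakSolution Ω ρ A l r m s β B c e) :
    (Prod.fst '' Ω).OrdConnected :=
  (ws.isConnected.isPreconnected.image _ continuous_fst.continuousOn).ordConnected

lemma A_pos_proj (ws : WeakSolution Ω ρ A l r m s β B c e) :
    ∀ x ∈ Prod.fst '' Ω, 0 < A.eval x := by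
  rintro _ ⟨p, hp, rfl⟩
  exact ws.A_pos p hp

lemma integrable_density (ws : WeakSolution Ω ρ A l r m s β B c e) : Integrable ρ := by
  simpa using ws.moments 0 0

lemma integrable_mul (ws : WeakSolution Ω ρ A l r m s β B c e) {K : ℝ × ℝ → ℝ}
    (hK : Continuous K) (hc : HasCompactSupport K) : Integrable fun p => K p * ρ p := by
  obtain ⟨M, hM⟩ := hK.bounded_above_of_compact_support hc
  exact ws.integrable_density.bdd_mul hK.aestronglyMeasurable (Eventually.of_forall hM)

end WeakSolution

/-! ### Test functions adapted to the straightened coordinates, and the vertical equation -/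

section TestFunctions

lemma contDiff_eval (P : ℝ[X]) : ContDiff ℝ ∞ fun x => P.eval x := by
  simpa using P.contDiff_aeval (𝕜 := ℝ) ∞

variable {I : Set ℝ} {E F φ ψ : ℝ → ℝ}

lemma fderiv_fst_of_hasDerivAt {f : ℝ × ℝ → ℝ} (hf : ContDiff ℝ ∞ f) {p : ℝ × ℝ} {d : ℝ}
    (h : HasDerivAt (fun x => f (x, p.2)) d p.1) : fderiv ℝ f p (1, 0) = d := by
  have h1 : HasFDerivAt f (fderiv ℝ f p) (p.1, p.2) :=
    (hf.differentiable (by simp) p).hasFDerivAt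
  have h2 : HasDerivAt (fun x : ℝ => (x, p.2)) ((1 : ℝ), (0 : ℝ)) p.1 :=
    (hasDerivAt_id p.1).prodMk (hasDerivAt_const p.1 p.2)
  exact (h1.comp_hasDerivAt p.1 h2).unique h

lemma fderiv_snd_of_hasDerivAt {f : ℝ × ℝ → ℝ} (hf : ContDiff ℝ ∞ f) {p : ℝ × ℝ} {d : ℝ}
    (h : HasDerivAt (fun y => f (p.1, y)) d p.2) : fderiv ℝ f p (0, 1) = d := by
  have h1 : HasFDerivAt f (fderiv ℝ f p) (p.1, p.2) :=
    (hf.differentiable (by simp) p).hasFDerivAt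
  have h2 : HasDerivAt (fun y : ℝ => (p.1, y)) ((0 : ℝ), (1 : ℝ)) p.2 :=
    (hasDerivAt_const p.2 p.1).prodMk (hasDerivAt_id p.2)
  exact (h1.comp_hasDerivAt p.2 h2).unique h

/-- The test function `φ(x) ψ(E(x) y - F(x))`. -/
def sepTest (E F φ ψ : ℝ → ℝ) (p : ℝ × ℝ) : ℝ := φ p.1 * ψ (E p.1 * p.2 - F p.1)

lemma contDiff_sepTest (hI : IsOpen I) (hE : ContDiffOn ℝ ∞ E I) (hF : ContDiffOn ℝ ∞ F I)
    (hφ : TestOn I φ) (hψ : ContDiff ℝ ∞ ψ) : ContDiff ℝ ∞ (sepTest E F φ ψ) := by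
  refine contDiff_mul_of_tsupport (U := I ×ˢ univ) (hI.prod isOpen_univ)
    (hφ.smooth.comp contDiff_fst) ?_ ?_
  · refine (closure_minimal (t := Prod.fst ⁻¹' tsupport φ) (fun p hp => ?_)
      ((isClosed_tsupport φ).preimage continuous_fst)).trans
      fun p hp => ⟨hφ.subset hp, mem_univ _⟩
    exact subset_tsupport φ hp
  · have hE' : ContDiffOn ℝ ∞ (fun q : ℝ × ℝ => E q.1) (I ×ˢ univ) :=
      hE.comp contDiffOn_fst fun q hq => hq.1
    have hF' : ContDiffOn ℝ ∞ (fun q : ℝ × ℝ => F q.1) (I ×ˢ univ) :=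
      hF.comp contDiffOn_fst fun q hq => hq.1
    exact hψ.comp_contDiffOn ((hE'.mul contDiffOn_snd).sub hF')

lemma hasCompactSupport_sepTest (hE : ContinuousOn E I) (hF : ContinuousOn F I)
    (hE0 : ∀ x, 0 < E x) (hφ : TestOn I φ) (hψ : HasCompactSupport ψ) :
    HasCompactSupport (sepTest E F φ ψ) := by
  have hK : IsCompact ((fun q : ℝ × ℝ => (q.1, (q.2 + F q.1) / E q.1)) ''
      (tsupport φ ×ˢ tsupport ψ)) :=
    (hφ.compact.isCompact.prod hψ.isCompact).image_of_continuousOn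
      ((continuousOn_straight hE hF hE0).mono fun q hq => ⟨hφ.subset hq.1, mem_univ _⟩)
  refine HasCompactSupport.intro hK fun p hp => ?_
  rw [sepTest]
  by_cases h1 : p.1 ∈ tsupport φ
  · by_cases h2 : E p.1 * p.2 - F p.1 ∈ tsupport ψ
    · refine absurd ⟨(p.1, E p.1 * p.2 - F p.1), ⟨h1, h2⟩, ?_⟩ hp
      have := (hE0 p.1).ne'
      refine Prod.ext rfl ?_
      simp only
      field_simp
      ring
    · rw [image_eq_zero_of_notMem_tsupport h2, mul_zero]
  · rw [image_eq_zero_of_notMem_tsupport h1, zero_mul]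

lemma fderiv_fst_sepTest (hI : IsOpen I) (hE : ContDiffOn ℝ ∞ E I) (hF : ContDiffOn ℝ ∞ F I)
    (hφ : TestOn I φ) (hψ : ContDiff ℝ ∞ ψ) {p : ℝ × ℝ} {E' F' : ℝ}
    (hEd : HasDerivAt E E' p.1) (hFd : HasDerivAt F F' p.1) :
    fderiv ℝ (sepTest E F φ ψ) p (1, 0) = deriv φ p.1 * ψ (E p.1 * p.2 - F p.1) +
      φ p.1 * (deriv ψ (E p.1 * p.2 - F p.1) * (E' * p.2 - F')) := by
  refine fderiv_fst_of_hasDerivAt (contDiff_sepTest hI hE hF hφ hψ) ?_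
  have h1 : HasDerivAt φ (deriv φ p.1) p.1 := (hφ.smooth.differentiable (by simp) _).hasDerivAt
  have h2 : HasDerivAt ψ (deriv ψ (E p.1 * p.2 - F p.1)) (E p.1 * p.2 - F p.1) :=
    (hψ.differentiable (by simp) _).hasDerivAt
  have h3 : HasDerivAt (fun x => E x * p.2 - F x) (E' * p.2 - F') p.1 :=
    (hEd.mul_const p.2).sub hFd
  exact h1.mul (HasDerivAt.comp p.1 (h := fun x => E x * p.2 - F x) h2 h3)

lemma fderiv_snd_sepTest (hI : IsOpen I) (hE : ContDiffOn ℝ ∞ E I) (hF : ContDiffOn ℝ ∞ F I)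
    (hφ : TestOn I φ) (hψ : ContDiff ℝ ∞ ψ) (p : ℝ × ℝ) :
    fderiv ℝ (sepTest E F φ ψ) p (0, 1) =
      φ p.1 * (deriv ψ (E p.1 * p.2 - F p.1) * E p.1) := by
  refine fderiv_snd_of_hasDerivAt (contDiff_sepTest hI hE hF hφ hψ) ?_
  have h2 : HasDerivAt ψ (deriv ψ (E p.1 * p.2 - F p.1)) (E p.1 * p.2 - F p.1) :=
    (hψ.differentiable (by simp) _).hasDerivAt
  have h3 : HasDerivAt (fun y => E p.1 * y - F p.1) (E p.1) p.2 :=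
    hasDerivAt_of_eq (((hasDerivAt_id p.2).const_mul (E p.1)).sub_const (F p.1)) (fun _ => rfl)
      (by simp)
  exact (HasDerivAt.comp p.2 (h := fun y => E p.1 * y - F p.1) h2 h3).const_mul (φ p.1)

end TestFunctions

namespace WeakSolution

variable {Ω : Set (ℝ × ℝ)} {ρ : ℝ × ℝ → ℝ} {A l r m s β B : ℝ[X]} {c e : ℝ}

/-- The combination of the two integration by parts formulas which contains only vertical
derivatives. -/
lemma eq_vertical (ws : WeakSolution Ω ρ A l r m s β B c e) {f : ℝ × ℝ → ℝ}
    (hf : ContDiff ℝ ∞ f) (hfc : HasCompactSupport f) :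
    ∫ p, (((drift₁ A l β e).eval p.1 * p.2 + (drift₀ A l r β B).eval p.1) * f p +
      ((disc₂ A l c).eval p.1 * p.2 ^ 2 + (disc₁ A l r m).eval p.1 * p.2 +
        (disc₀ A r s).eval p.1) * fderiv ℝ f p (0, 1)) * ρ p = 0 := by
  have hev : ∀ P : ℝ[X], ContDiff ℝ ∞ fun p : ℝ × ℝ => P.eval p.1 := fun P =>
    (contDiff_eval P).comp contDiff_fst
  -- Testing the first equation with g¹² f and the second with g¹¹ f makes the ∂ₓf terms equal. In
  -- the difference the coefficient of ∂ᵧf is g¹¹ g²² - (g¹²)² = det g.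
  have hf1 : ContDiff ℝ ∞ fun p : ℝ × ℝ => (l.eval p.1 * p.2 + r.eval p.1) * f p :=
    (((hev l).mul contDiff_snd).add (hev r)).mul hf
  have hf2 : ContDiff ℝ ∞ fun p : ℝ × ℝ => A.eval p.1 * f p := (hev A).mul hf
  have e1 := ws.eq_fst _ hf1 hfc.mul_left
  have e2 := ws.eq_snd _ hf2 hfc.mul_left
  have hfx : ∀ p : ℝ × ℝ, HasDerivAt (fun x => f (x, p.2)) (fderiv ℝ f p (1, 0)) p.1 := by
    intro p
    have h1 : HasFDerivAt f (fderiv ℝ f p) (p.1, p.2) :=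
      (hf.differentiable (by simp) p).hasFDerivAt
    exact h1.comp_hasDerivAt p.1 ((hasDerivAt_id p.1).prodMk (hasDerivAt_const p.1 p.2))
  have hfy : ∀ p : ℝ × ℝ, HasDerivAt (fun y => f (p.1, y)) (fderiv ℝ f p (0, 1)) p.2 := by
    intro p
    have h1 : HasFDerivAt f (fderiv ℝ f p) (p.1, p.2) :=
      (hf.differentiable (by simp) p).hasFDerivAt
    exact h1.comp_hasDerivAt p.2 ((hasDerivAt_const p.2 p.1).prodMk (hasDerivAt_id p.2))
  have d1x : ∀ p, fderiv ℝ (fun p : ℝ × ℝ => (l.eval p.1 * p.2 + r.eval p.1) * f p) p (1, 0) =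
      ((derivative l).eval p.1 * p.2 + (derivative r).eval p.1) * f p +
        (l.eval p.1 * p.2 + r.eval p.1) * fderiv ℝ f p (1, 0) := fun p =>
    fderiv_fst_of_hasDerivAt hf1
      ((((l.hasDerivAt p.1).mul_const p.2).add (r.hasDerivAt p.1)).mul (hfx p))
  have d1y : ∀ p, fderiv ℝ (fun p : ℝ × ℝ => (l.eval p.1 * p.2 + r.eval p.1) * f p) p (0, 1) =
      l.eval p.1 * f p + (l.eval p.1 * p.2 + r.eval p.1) * fderiv ℝ f p (0, 1) := fun p => by
    refine fderiv_snd_of_hasDerivAt hf1 (hasDerivAt_of_eq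
      ((((hasDerivAt_id p.2).const_mul (l.eval p.1)).add_const (r.eval p.1)).mul (hfy p))
      (fun _ => rfl) (by simp))
  have d2x : ∀ p, fderiv ℝ (fun p : ℝ × ℝ => A.eval p.1 * f p) p (1, 0) =
      (derivative A).eval p.1 * f p + A.eval p.1 * fderiv ℝ f p (1, 0) := fun p =>
    fderiv_fst_of_hasDerivAt hf2 ((A.hasDerivAt p.1).mul (hfx p))
  have d2y : ∀ p, fderiv ℝ (fun p : ℝ × ℝ => A.eval p.1 * f p) p (0, 1) =
      A.eval p.1 * fderiv ℝ f p (0, 1) := fun p =>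
    fderiv_snd_of_hasDerivAt hf2 ((hfy p).const_mul (A.eval p.1))
  simp only [d1x, d1y] at e1
  simp only [d2x, d2y] at e2
  have hfx' : Continuous fun p => fderiv ℝ f p (1, 0) :=
    (hf.continuous_fderiv (by simp)).clm_apply continuous_const
  have hfy' : Continuous fun p => fderiv ℝ f p (0, 1) :=
    (hf.continuous_fderiv (by simp)).clm_apply continuous_const
  have hcx : HasCompactSupport fun p => fderiv ℝ f p (1, 0) := hfc.fderiv_apply (𝕜 := ℝ) _
  have hcy : HasCompactSupport fun p => fderiv ℝ f p (0, 1) := hfc.fderiv_apply (𝕜 := ℝ) _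
  have hcf := hf.continuous
  have hPc : ∀ P : ℝ[X], Continuous fun p : ℝ × ℝ => P.eval p.1 := fun P => (hev P).continuous
  have i1 : Integrable fun p : ℝ × ℝ => (β.eval p.1 * ((l.eval p.1 * p.2 + r.eval p.1) * f p) +
      (A.eval p.1 * (((derivative l).eval p.1 * p.2 + (derivative r).eval p.1) * f p +
        (l.eval p.1 * p.2 + r.eval p.1) * fderiv ℝ f p (1, 0)) +
      (l.eval p.1 * p.2 + r.eval p.1) * (l.eval p.1 * f p +
        (l.eval p.1 * p.2 + r.eval p.1) * fderiv ℝ f p (0, 1)))) * ρ p := by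
    refine ws.integrable_mul (by fun_prop) ?_
    exact (hfc.mul_left.mul_left).add ((((hfc.mul_left).add hcx.mul_left).mul_left).add
      ((hfc.mul_left.add hcy.mul_left).mul_left))
  have i2 : Integrable fun p : ℝ × ℝ => ((e * p.2 + B.eval p.1) * (A.eval p.1 * f p) +
      ((l.eval p.1 * p.2 + r.eval p.1) * ((derivative A).eval p.1 * f p +
        A.eval p.1 * fderiv ℝ f p (1, 0)) +
      (c * p.2 ^ 2 + m.eval p.1 * p.2 + s.eval p.1) *
        (A.eval p.1 * fderiv ℝ f p (0, 1)))) * ρ p := by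
    refine ws.integrable_mul (by fun_prop) ?_
    exact (hfc.mul_left.mul_left).add ((((hfc.mul_left).add hcx.mul_left).mul_left).add
      (hcy.mul_left.mul_left))
  have key := integral_sub i2 i1
  rw [e1, e2, sub_zero] at key
  refine Eq.trans ?_ key
  refine integral_congr_ae (Eventually.of_forall fun p => ?_)
  simp only [drift₁, drift₀, disc₂, disc₁, disc₀, eval_add, eval_sub, eval_mul, eval_pow, eval_C,
    eval_ofNat]
  ring

end WeakSolution

lemma eq_zero_of_integral_testOn {I : Set ℝ} (hI : IsOpen I) {f : ℝ → ℝ} (hf : ContinuousOn f I)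
    (h : ∀ φ, TestOn I φ → ∫ x, φ x * f x = 0) : ∀ x ∈ I, f x = 0 := by
  have hae := hI.ae_eq_zero_of_integral_contDiff_smul_eq_zero (μ := volume)
    (hf.locallyIntegrableOn hI.measurableSet) fun g h1 h2 h3 => h g ⟨h1, h2, h3⟩
  refine Measure.eqOn_open_of_ae_eq (μ := volume) (g := fun _ => 0) ?_ hI hf continuousOn_const
  rw [EventuallyEq, ae_restrict_iff' hI.measurableSet]
  exact hae

/-- Since G is a product over I, Fubini turns the pairing into ∫ φ k ∑ fᵢ (∫ gᵢ h). As φ is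
arbitrary, the continuous function multiplying it vanishes at every x, and not merely almost
everywhere. -/
lemma sum_fiber_integral_eq_zero {ι : Type*} [Fintype ι] {I : Set ℝ} (hI : IsOpen I) {k h : ℝ → ℝ}
    (hkc : ContinuousOn k I) (hk0 : ∀ x ∈ I, 0 < k x) {G : ℝ × ℝ → ℝ}
    (hGk : ∀ x ∈ I, ∀ u, G (x, u) = k x * h u) {f g : ι → ℝ → ℝ}
    (hf : ∀ i, ContinuousOn (f i) I) (hg : ∀ i, Integrable fun u => g i u * h u)
    (hpair : ∀ φ, TestOn I φ → ∫ q : ℝ × ℝ, φ q.1 * (∑ i, f i q.1 * g i q.2) * G q = 0)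
    {x : ℝ} (hx : x ∈ I) : ∫ u, (∑ i, f i x * g i u) * h u = 0 := by
  have hzero : ∀ x ∈ I, k x * ∑ i, f i x * ∫ u, g i u * h u = 0 := by
    refine eq_zero_of_integral_testOn hI
      (hkc.mul (continuousOn_finsetSum _ fun i _ => (hf i).mul continuousOn_const)) fun φ hφ => ?_
    have hi : ∀ i, Integrable fun x => φ x * (k x * f i x) := fun i =>
      hφ.integrable_mul hI (hkc.mul (hf i))
    have hig : ∀ i, Integrable (fun q : ℝ × ℝ => φ q.1 * (k q.1 * f i q.1) * (g i q.2 * h q.2))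
        (volume.prod volume) := fun i => (hi i).mul_prod (hg i)
    have hic : ∀ i, Integrable fun x => φ x * (k x * f i x) * ∫ u, g i u * h u := fun i =>
      (hi i).mul_const _
    refine Eq.trans ?_ (hpair φ hφ)
    have e1 : ∀ q : ℝ × ℝ, φ q.1 * (∑ i, f i q.1 * g i q.2) * G q =
        ∑ i, φ q.1 * (k q.1 * f i q.1) * (g i q.2 * h q.2) := by
      intro q
      by_cases hq : q.1 ∈ I
      · rw [show G q = k q.1 * h q.2 from hGk q.1 hq q.2, Finset.mul_sum, Finset.sum_mul]
        exact Finset.sum_congr rfl fun i _ => by ring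
      · have : φ q.1 = 0 := image_eq_zero_of_notMem_tsupport fun h' => hq (hφ.subset h')
        simp [this]
    have e2 : ∀ x, φ x * (k x * ∑ i, f i x * ∫ u, g i u * h u) =
        ∑ i, φ x * (k x * f i x) * ∫ u, g i u * h u := by
      intro x
      rw [Finset.mul_sum, Finset.mul_sum]
      exact Finset.sum_congr rfl fun i _ => by ring
    simp only [e1, e2]
    rw [integral_finsetSum _ fun i _ => hic i, Measure.volume_eq_prod,
      integral_finsetSum _ fun i _ => hig i]
    refine Finset.sum_congr rfl fun i _ => ?_
    rw [integral_mul_const]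
    exact (integral_prod_mul (fun x => φ x * (k x * f i x)) fun u => g i u * h u).symm
  have h1 := (mul_eq_zero.1 (hzero x hx)).resolve_left (hk0 x hx).ne'
  simp only [Finset.sum_mul, mul_assoc]
  rw [integral_finsetSum _ fun i _ => (hg i).const_mul _]
  simpa only [integral_const_mul] using h1

lemma fiber_integral_eq_zero {I : Set ℝ} (hI : IsOpen I) {k h : ℝ → ℝ} (hkc : ContinuousOn k I)
    (hk0 : ∀ x ∈ I, 0 < k x) (hhint : Integrable h) {G : ℝ × ℝ → ℝ}
    (hGk : ∀ x ∈ I, ∀ u, G (x, u) = k x * h u) {D2 D1 D0 S1 S0 : ℝ → ℝ}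
    (cD2 : ContinuousOn D2 I) (cD1 : ContinuousOn D1 I) (cD0 : ContinuousOn D0 I)
    (cS1 : ContinuousOn S1 I) (cS0 : ContinuousOn S0 I) {ψ : ℝ → ℝ} (hψ : ContDiff ℝ ∞ ψ)
    (hψc : HasCompactSupport ψ)
    (hpair : ∀ φ, TestOn I φ → ∫ q : ℝ × ℝ, φ q.1 * ((D2 q.1 * q.2 ^ 2 + D1 q.1 * q.2 + D0 q.1) *
        deriv ψ q.2 + (S1 q.1 * q.2 + S0 q.1) * ψ q.2) * G q = 0) {x : ℝ} (hx : x ∈ I) :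
    ∫ u, ((D2 x * u ^ 2 + D1 x * u + D0 x) * deriv ψ u + (S1 x * u + S0 x) * ψ u) * h u = 0 := by
  have hψ' : Continuous (deriv ψ) := hψ.continuous_deriv (by simp)
  have hψc' : HasCompactSupport (deriv ψ) := hψc.deriv
  have hbi : ∀ K : ℝ → ℝ, Continuous K → HasCompactSupport K → Integrable fun u => K u * h u := by
    intro K hK hKc
    obtain ⟨M, hM⟩ := hK.bounded_above_of_compact_support hKc
    exact hhint.bdd_mul hK.aestronglyMeasurable (Eventually.of_forall hM)
  have key := sum_fiber_integral_eq_zero (ι := Fin 5) hI hkc hk0 hGk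
    (f := ![D2, D1, D0, S1, S0])
    (g := ![fun u => u ^ 2 * deriv ψ u, fun u => u * deriv ψ u, deriv ψ, fun u => u * ψ u, ψ])
    (fun i => by fin_cases i; exacts [cD2, cD1, cD0, cS1, cS0])
    (fun i => by
      fin_cases i
      exacts [hbi _ ((continuous_pow 2).mul hψ') hψc'.mul_left,
        hbi _ (continuous_id.mul hψ') hψc'.mul_left, hbi _ hψ' hψc',
        hbi _ (continuous_id.mul hψ.continuous) hψc.mul_left, hbi _ hψ.continuous hψc])
    (fun φ hφ => by
      refine Eq.trans ?_ (hpair φ hφ)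
      refine integral_congr_ae (Eventually.of_forall fun q => ?_)
      simp [Fin.sum_univ_five]
      ring_nf
      simp) hx
  refine Eq.trans ?_ key
  refine integral_congr_ae (Eventually.of_forall fun u => ?_)
  simp [Fin.sum_univ_five]
  ring_nf
  simp

lemma continuous_vertical (P₁ P₀ Q₂ Q₁ Q₀ : ℝ[X]) {f g : ℝ × ℝ → ℝ} (hf : Continuous f)
    (hg : Continuous g) : Continuous fun p : ℝ × ℝ => (P₁.eval p.1 * p.2 + P₀.eval p.1) * f p +
      (Q₂.eval p.1 * p.2 ^ 2 + Q₁.eval p.1 * p.2 + Q₀.eval p.1) * g p := by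
  have h : ∀ P : ℝ[X], Continuous fun p : ℝ × ℝ => P.eval p.1 := fun P =>
    (contDiff_eval P).continuous.comp continuous_fst
  exact ((((h _).mul continuous_snd).add (h _)).mul hf).add
    (((((h _).mul (continuous_snd.pow 2)).add ((h _).mul continuous_snd)).add (h _)).mul hg)

lemma hasCompactSupport_vertical (P₁ P₀ Q₂ Q₁ Q₀ : ℝ[X]) {f g : ℝ × ℝ → ℝ}
    (hf : HasCompactSupport f) (hg : HasCompactSupport g) :
    HasCompactSupport fun p : ℝ × ℝ => (P₁.eval p.1 * p.2 + P₀.eval p.1) * f p +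
      (Q₂.eval p.1 * p.2 ^ 2 + Q₁.eval p.1 * p.2 + Q₀.eval p.1) * g p :=
  HasCompactSupport.add
    (hf.mul_left (f := fun p : ℝ × ℝ => P₁.eval p.1 * p.2 + P₀.eval p.1))
    (hg.mul_left (f := fun p : ℝ × ℝ => Q₂.eval p.1 * p.2 ^ 2 + Q₁.eval p.1 * p.2 + Q₀.eval p.1))

/-! ### Separation of the density -/

namespace WeakSolution

variable {Ω : Set (ℝ × ℝ)} {ρ : ℝ × ℝ → ℝ} {A l r m s β B : ℝ[X]} {c e : ℝ}

/-- Fubini gives finite moments on almost every vertical line, for all exponents at once because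
they are countable; a single such line suffices to give h all its moments. -/
lemma integrable_eval_section (ws : WeakSolution Ω ρ A l r m s β B c e) :
    ∃ x ∈ Prod.fst '' Ω, ∀ P : ℝ[X], Integrable fun y => P.eval y * ρ (x, y) := by
  have h1 : ∀ᵐ x : ℝ, ∀ j : ℕ, Integrable fun y : ℝ => y ^ j * ρ (x, y) := by
    rw [ae_all_iff]
    intro j
    have := ws.moments 0 j
    rw [Measure.volume_eq_prod] at this
    simpa using this.prod_right_ae
  have hne : (Prod.fst '' Ω).Nonempty := ws.isConnected.nonempty.image _
  have hpos := ws.isOpen_proj.measure_pos volume hne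
  obtain ⟨x, hx, hx'⟩ : ∃ x ∈ Prod.fst '' Ω, ∀ j : ℕ, Integrable fun y : ℝ => y ^ j * ρ (x, y) := by
    by_contra hcon
    push Not at hcon
    refine hpos.ne' (measure_mono_null (fun x hx => ?_) (ae_iff.1 h1))
    intro h'
    obtain ⟨j, hj⟩ := hcon x hx
    exact hj (h' j)
  refine ⟨x, hx, fun P => ?_⟩
  simp only [eval_eq_sum_range, Finset.sum_mul, mul_assoc]
  exact integrable_finsetSum _ fun j _ => (hx' j).const_mul _

set_option maxHeartbeats 1000000 in
/-- In suitable coordinates `(x, u)`, with `u` affine in `y`, the density is a product, and its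
second factor satisfies a family of Pearson equations. -/
lemma exists_separation (ws : WeakSolution Ω ρ A l r m s β B c e) :
    ∃ E F k h : ℝ → ℝ, (∀ x, 0 < E x) ∧
      (∀ x ∈ Prod.fst '' Ω, HasDerivAt E (-(l.eval x / A.eval x) * E x) x) ∧
      (∀ x ∈ Prod.fst '' Ω, HasDerivAt F (E x * r.eval x / A.eval x) x) ∧
      ContinuousOn k (Prod.fst '' Ω) ∧ (∀ x ∈ Prod.fst '' Ω, 0 < k x) ∧
      (∀ u, 0 ≤ h u) ∧ (∃ u, 0 < h u) ∧ (∀ n : ℕ, Integrable fun u => u ^ n * h u) ∧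
      (∀ x ∈ Prod.fst '' Ω, ∀ u, straightDensity ρ E F (x, u) = k x * h u) ∧
      (∀ x ∈ Prod.fst '' Ω, ContinuousOn h {u | (x, u) ∈ straightDomain Ω E F}) ∧
      (∀ x ∈ Prod.fst '' Ω,
        interior (closure {u | 0 < h u}) ⊆ {u | (x, u) ∈ straightDomain Ω E F}) ∧
      ∀ x ∈ Prod.fst '' Ω, ∀ ψ, ContDiff ℝ ∞ ψ → HasCompactSupport ψ →
        ∫ u, (((disc₂ A l c).eval x / E x * u ^ 2 +
            ((disc₁ A l r m).eval x + 2 * (disc₂ A l c).eval x * (F x / E x)) * u +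
            E x * ((disc₂ A l c).eval x * (F x / E x) ^ 2 + (disc₁ A l r m).eval x * (F x / E x) +
              (disc₀ A r s).eval x)) * deriv ψ u +
          ((drift₁ A l β e).eval x / E x * u +
            ((drift₁ A l β e).eval x * (F x / E x) + (drift₀ A l r β B).eval x)) * ψ u) * h u
          = 0 := by
  set I := Prod.fst '' Ω with hIdef
  have hI : IsOpen I := ws.isOpen_proj
  have hIc : I.OrdConnected := ws.ordConnected_proj
  have hA0 : ∀ x ∈ I, 0 < A.eval x := ws.A_pos_proj
  have hA0' : ∀ x ∈ I, A.eval x ≠ 0 := fun x hx => (hA0 x hx).ne'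
  have hev : ∀ P : ℝ[X], ContDiffOn ℝ ∞ (fun x => P.eval x) I := fun P => (contDiff_eval P).contDiffOn
  have hΩI : ∀ q ∈ Ω, q.1 ∈ I := fun q hq => ⟨q, hq, rfl⟩
  obtain ⟨p₀, hp₀⟩ := ws.isConnected.nonempty
  have hx₀ : p₀.1 ∈ I := hΩI _ hp₀
  set x₀ := p₀.1
  -- These equations for E and F say that A ∂ₓ + (l y + r) ∂ᵧ annihilates E(x) y - F(x).
  obtain ⟨E, hE0, hEd, hEs⟩ := exists_integrating_factor hI hIc hx₀
    (s := fun x => -(l.eval x / A.eval x)) ((hev l).div (hev A) hA0').neg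
  obtain ⟨F, hFd, hFs⟩ := exists_antideriv hI hIc hx₀ (s := fun x => E x * r.eval x / A.eval x)
    ((hEs.mul (hev r)).div (hev A) hA0')
  obtain ⟨w, hw0, hwd, hws⟩ := exists_integrating_factor hI hIc hx₀
    (s := fun x => β.eval x / A.eval x) ((hev β).div (hev A) hA0')
  set k : ℝ → ℝ := fun x => w x / A.eval x with hk
  have hkc : ContinuousOn k I := hws.continuousOn.div (hev A).continuousOn hA0'
  have hk0 : ∀ x ∈ I, 0 < k x := fun x hx => div_pos (hw0 x) (hA0 x hx)
  have hEc := hEs.continuousOn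
  have hFc := hFs.continuousOn
  have hstraight := fun {H : ℝ × ℝ → ℝ} (hH : ContinuousOn H (I ×ˢ univ)) =>
    straight_integral (H := H) hI ws.isOpen hΩI hEc hFc hE0 ws.cont ws.zero_off hH
  have hsepc : ∀ {θ ψ : ℝ → ℝ}, TestOn I θ → Continuous ψ →
      ContinuousOn (fun q : ℝ × ℝ => θ q.1 * ψ q.2) (I ×ˢ univ) := fun hθ hψ =>
    ((hθ.smooth.continuous.comp continuous_fst).mul (hψ.comp continuous_snd)).continuousOn
  have hsepi : ∀ {θ ψ : ℝ → ℝ}, TestOn I θ → TestOn univ ψ →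
      Integrable fun p => sepTest E F θ ψ p * ρ p := fun hθ hψ =>
    ws.integrable_mul (contDiff_sepTest hI hEs hFs hθ hψ.smooth).continuous
      (hasCompactSupport_sepTest hEc hFc hE0 hθ hψ.compact)
  set G := straightDensity ρ E F with hG
  have hGn : ∀ q, 0 ≤ G q := fun q => div_nonneg (ws.nonneg _) (hE0 _).le
  have hG0 : ∀ q, q ∉ straightDomain Ω E F → G q = 0 := fun q hq => by
    rw [hG, straightDensity, ws.zero_off _ hq, zero_div]
  have hsep := separated_of_integral_eq hI hkc hk0
    (isOpen_straightDomain hI ws.isOpen hΩI hEc hFc hE0) (fun q hq => fst_mem_of_straight hΩI hq)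
    (continuousOn_straightDensity hΩI hEc hFc hE0 ws.cont) hG0 hGn
    (straight_regular hI ws.regular hEc hFc hE0)
    (fun θ ψ hθ hψ => (hstraight (hsepc hθ hψ.smooth.continuous) (hsepi hθ hψ)).1)
    (fun θ ψ hθ hψ h0 => by
      rw [(hstraight (hsepc hθ hψ.smooth.continuous) (hsepi hθ hψ)).2]
      -- Solve A φ' + β φ = θ. In the first equation tested with φ(x) ψ(u), the terms containing ψ'
      -- cancel, and what is left is ∫ θ(x) ψ(u) ρ.
      obtain ⟨φ, hφ, hφe⟩ := exists_testOn_solution hI hIc (hev A) hA0' hws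
        (fun x _ => (hw0 x).ne') hwd hθ h0
      have := ws.eq_fst _ (contDiff_sepTest hI hEs hFs hφ hψ.smooth)
        (hasCompactSupport_sepTest hEc hFc hE0 hφ hψ.compact)
      refine Eq.trans ?_ this
      refine integral_congr_ae (Eventually.of_forall fun p => ?_)
      by_cases hp : p ∈ Ω
      · have hpI := hΩI p hp
        have hA := hA0' _ hpI
        simp only
        rw [fderiv_fst_sepTest hI hEs hFs hφ hψ.smooth (hEd _ hpI) (hFd _ hpI),
          fderiv_snd_sepTest hI hEs hFs hφ hψ.smooth, ← hφe p.1, sepTest]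
        field_simp
        ring
      · simp [ws.zero_off p hp])
  set h : ℝ → ℝ := fun u => G (x₀, u) / k x₀ with hh
  have hGk : ∀ x ∈ I, ∀ u, G (x, u) = k x * h u := fun x hx u => by
    have h1 := hsep x hx x₀ hx₀ u
    have h2 := (hk0 _ hx₀).ne'
    simp only [hh]
    field_simp
    linarith
  have hhn : ∀ u, 0 ≤ h u := fun u => div_nonneg (hGn _) (hk0 _ hx₀).le
  have hmem : ∀ x ∈ I, ∀ u, 0 < h u → (x, u) ∈ straightDomain Ω E F := fun x hx u hu => by
    by_contra h'
    have h1 := hG0 _ h'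
    rw [hGk x hx u] at h1
    exact (mul_pos (hk0 x hx) hu).ne' h1
  have hhpos : ∃ u, 0 < h u := by
    by_contra hcon
    push Not at hcon
    have hz : ∀ p, ρ p = 0 := by
      intro p
      by_cases hp : p ∈ Ω
      · have h1 := hGk p.1 (hΩI p hp) (E p.1 * p.2 - F p.1)
        rw [le_antisymm (hcon _) (hhn _), mul_zero] at h1
        have h2 := (hE0 p.1).ne'
        have h3 : (E p.1 * p.2 - F p.1 + F p.1) / E p.1 = p.2 := by field_simp; ring
        simp only [hG, straightDensity, h3] at h1
        simpa [h2] using h1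
      · exact ws.zero_off p hp
    have := ws.integral_one
    simp [hz] at this
  have hhm : ∀ n : ℕ, Integrable fun u => u ^ n * h u := by
    intro n
    obtain ⟨x, hx, hP⟩ := ws.integrable_eval_section
    have h1 := hP ((C (E x) * X - C (F x)) ^ n)
    rw [← integrable_affine_iff (b := F x) (hE0 x)] at h1
    refine (h1.const_mul (k x)⁻¹).congr (Eventually.of_forall fun u => ?_)
    have h2 := hGk x hx u
    simp only [hG, straightDensity] at h2
    have h3 := (hk0 x hx).ne'
    have h4 := (hE0 x).ne'
    have h5 : E x * ((u + F x) / E x) - F x = u := by field_simp; ring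
    simp only [eval_pow, eval_sub, eval_mul, eval_C, eval_X, h5]
    rw [mul_div_assoc, h2]
    field_simp
  have hhint : Integrable h := by simpa using hhm 0
  refine ⟨E, F, k, h, hE0, hEd, hFd, hkc, hk0, hhn, hhpos, hhm, hGk, ?_, ?_, ?_⟩
  · intro x hx
    have h1 : ContinuousOn (fun u : ℝ => G (x, u)) {u | (x, u) ∈ straightDomain Ω E F} :=
      (continuousOn_straightDensity hΩI hEc hFc hE0 ws.cont).comp (by fun_prop) fun u hu => hu
    refine (h1.div_const (k x)).congr fun u hu => ?_
    have := (hk0 x hx).ne'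
    simp only
    rw [hGk x hx u]
    field_simp
  · intro x hx u hu
    -- The positivity set of h lies in every vertical section of the domain, so its product with I
    -- lies in the domain; regularity fills in the interior of the closure.
    refine straight_regular hI ws.regular hEc hFc hE0 (I ×ˢ interior (closure {u | 0 < h u}))
      (hI.prod isOpen_interior) (fun q hq => hq.1) ?_ ⟨hx, hu⟩
    rintro ⟨y, v⟩ ⟨hy, hv⟩
    have h1 : (y, v) ∈ closure ((fun v => (y, v)) '' {u | 0 < h u}) :=
      mem_closure_image (f := fun v : ℝ => (y, v)) (by fun_prop) (interior_subset hv)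
    refine closure_mono ?_ h1
    rintro _ ⟨v', hv', rfl⟩
    exact hmem y hy v' hv'
  · intro x hx ψ hψ hψc
    -- These are the coefficients in u of E · det g and of the vertical drift, after substituting y
    -- = (u + F) / E. The factor E in front of det g comes from ∂ᵧ ψ(u) = E ψ'(u).
    set D2 : ℝ → ℝ := fun x => (disc₂ A l c).eval x / E x with hD2
    set D1 : ℝ → ℝ := fun x => (disc₁ A l r m).eval x + 2 * (disc₂ A l c).eval x * (F x / E x)
      with hD1
    set D0 : ℝ → ℝ := fun x => E x * ((disc₂ A l c).eval x * (F x / E x) ^ 2 +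
      (disc₁ A l r m).eval x * (F x / E x) + (disc₀ A r s).eval x) with hD0
    set S1 : ℝ → ℝ := fun x => (drift₁ A l β e).eval x / E x with hS1
    set S0 : ℝ → ℝ := fun x => (drift₁ A l β e).eval x * (F x / E x) + (drift₀ A l r β B).eval x
      with hS0
    have hevc : ∀ P : ℝ[X], ContinuousOn (fun x => P.eval x) I := fun P => (hev P).continuousOn
    have hFE : ContinuousOn (fun x => F x / E x) I := hFc.div hEc fun x _ => (hE0 x).ne'
    have cD2 : ContinuousOn D2 I := (hevc _).div hEc fun x _ => (hE0 x).ne'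
    have cD1 : ContinuousOn D1 I := (hevc _).add ((continuousOn_const.mul (hevc _)).mul hFE)
    have cD0 : ContinuousOn D0 I :=
      hEc.mul ((((hevc _).mul (hFE.pow 2)).add ((hevc _).mul hFE)).add (hevc _))
    have cS1 : ContinuousOn S1 I := (hevc _).div hEc fun x _ => (hE0 x).ne'
    have cS0 : ContinuousOn S0 I := ((hevc _).mul hFE).add (hevc _)
    refine fiber_integral_eq_zero hI hkc hk0 hhint hGk cD2 cD1 cD0 cS1 cS0 hψ hψc
      (fun φ hφ => ?_) hx
    have hf := contDiff_sepTest hI hEs hFs hφ hψ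
    have hfc := hasCompactSupport_sepTest hEc hFc hE0 hφ hψc
    have hv := ws.eq_vertical hf hfc
    have hfy' : Continuous fun p => fderiv ℝ (sepTest E F φ ψ) p (0, 1) :=
      (hf.continuous_fderiv (by simp)).clm_apply continuous_const
    have hcy : HasCompactSupport fun p => fderiv ℝ (sepTest E F φ ψ) p (0, 1) :=
      hfc.fderiv_apply (𝕜 := ℝ) _
    have hPc : ∀ P : ℝ[X], Continuous fun p : ℝ × ℝ => P.eval p.1 := fun P =>
      (contDiff_eval P).continuous.comp continuous_fst
    have hfcont := hf.continuous
    set H : ℝ × ℝ → ℝ := fun q => φ q.1 * ((D2 q.1 * q.2 ^ 2 + D1 q.1 * q.2 + D0 q.1) *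
      deriv ψ q.2 + (S1 q.1 * q.2 + S0 q.1) * ψ q.2) with hH
    have hpt : ∀ p : ℝ × ℝ, (((drift₁ A l β e).eval p.1 * p.2 + (drift₀ A l r β B).eval p.1) *
        sepTest E F φ ψ p + ((disc₂ A l c).eval p.1 * p.2 ^ 2 + (disc₁ A l r m).eval p.1 * p.2 +
        (disc₀ A r s).eval p.1) * fderiv ℝ (sepTest E F φ ψ) p (0, 1)) * ρ p =
        H (p.1, E p.1 * p.2 - F p.1) * ρ p := by
      intro p
      by_cases hp : p ∈ Ω
      · congr 1
        rw [fderiv_snd_sepTest hI hEs hFs hφ hψ, sepTest]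
        have := (hE0 p.1).ne'
        simp only [hH, hD2, hD1, hD0, hS1, hS0]
        field_simp
        ring
      · simp [ws.zero_off p hp]
    have hint := ws.integrable_mul
      (continuous_vertical (drift₁ A l β e) (drift₀ A l r β B) (disc₂ A l c) (disc₁ A l r m)
        (disc₀ A r s) hfcont hfy')
      (hasCompactSupport_vertical _ _ _ _ _ hfc hcy)
    simp only [hpt] at hv hint
    have hlift : ∀ {f : ℝ → ℝ}, ContinuousOn f I →
        ContinuousOn (fun q : ℝ × ℝ => f q.1) (I ×ˢ univ) := fun hf =>
      hf.comp continuousOn_fst fun q hq => hq.1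
    have hlift' : ∀ {f : ℝ → ℝ}, Continuous f →
        ContinuousOn (fun q : ℝ × ℝ => f q.2) (I ×ˢ (univ : Set ℝ)) := fun hf =>
      (hf.comp continuous_snd).continuousOn
    have hψ' : Continuous (deriv ψ) := hψ.continuous_deriv (by simp)
    have hHc : ContinuousOn H (I ×ˢ univ) :=
      (hlift hφ.smooth.continuous.continuousOn).mul
        ((((((hlift cD2).mul (continuousOn_snd.pow 2)).add ((hlift cD1).mul continuousOn_snd)).add
          (hlift cD0)).mul (hlift' hψ')).add
          ((((hlift cS1).mul continuousOn_snd).add (hlift cS0)).mul (hlift' hψ.continuous)))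
    rw [← (hstraight hHc hint).2] at hv
    exact hv

end WeakSolution

/-! ### The first marginal -/

lemma tendsto_integral_cutoff {a b ρ : ℝ × ℝ → ℝ}
    (ha : Integrable fun p => a p * ρ p) (hb : Integrable fun p => b p * ρ p) {χ : ℝ → ℝ}
    (hχ : ContDiff ℝ ∞ χ) (hχ1 : ∀ᶠ y in 𝓝 0, χ y = 1) (hχM : ∀ y, |χ y| ≤ 1) {M : ℝ}
    (hχ' : ∀ y, |deriv χ y| ≤ M) :
    Tendsto (fun n : ℕ => ∫ p, (a p * χ (p.2 / (n + 1)) + b p * (deriv χ (p.2 / (n + 1)) / (n + 1)))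
      * ρ p) atTop (𝓝 (∫ p, a p * ρ p)) := by
  have hM : 0 ≤ M := (abs_nonneg _).trans (hχ' 0)
  refine tendsto_integral_of_dominated_convergence
    (fun p => |a p * ρ p| + M * |b p * ρ p|) ?_ (ha.abs.add (hb.abs.const_mul M)) ?_ ?_
  · intro n
    have h1 : Continuous fun p : ℝ × ℝ => χ (p.2 / (n + 1)) :=
      hχ.continuous.comp (continuous_snd.div_const _)
    have h2 : Continuous fun p : ℝ × ℝ => deriv χ (p.2 / (n + 1)) / (n + 1) :=
      ((hχ.continuous_deriv (by simp)).comp (continuous_snd.div_const _)).div_const _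
    refine ((h1.aestronglyMeasurable.mul ha.aestronglyMeasurable).add
      (h2.aestronglyMeasurable.mul hb.aestronglyMeasurable)).congr
      (Eventually.of_forall fun p => ?_)
    simp only [Pi.add_apply, Pi.mul_apply]
    ring
  · intro n
    refine Eventually.of_forall fun p => ?_
    have hn : (1 : ℝ) ≤ n + 1 := by simp
    have h1 : |deriv χ (p.2 / (n + 1)) / (n + 1)| ≤ M := by
      rw [abs_div, abs_of_pos (by linarith : (0 : ℝ) < n + 1)]
      exact (div_le_self (abs_nonneg _) hn).trans (hχ' _)
    rw [Real.norm_eq_abs, add_mul]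
    refine (abs_add_le _ _).trans ?_
    rw [show a p * χ (p.2 / (n + 1)) * ρ p = χ (p.2 / (n + 1)) * (a p * ρ p) by ring,
      show b p * (deriv χ (p.2 / (n + 1)) / (n + 1)) * ρ p =
        (deriv χ (p.2 / (n + 1)) / (n + 1)) * (b p * ρ p) by ring, abs_mul, abs_mul _ (b p * ρ p)]
    gcongr
    exact mul_le_of_le_one_left (abs_nonneg _) (hχM _)
  · refine Eventually.of_forall fun p => ?_
    have hn : Tendsto (fun n : ℕ => 1 / ((n : ℝ) + 1)) atTop (𝓝 0) :=
      tendsto_one_div_add_atTop_nhds_zero_nat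
    have h0 : Tendsto (fun n : ℕ => p.2 / ((n : ℝ) + 1)) atTop (𝓝 0) := by
      have := hn.const_mul p.2
      rw [mul_zero] at this
      exact this.congr fun n => by ring
    have h1 : Tendsto (fun n : ℕ => χ (p.2 / ((n : ℝ) + 1))) atTop (𝓝 1) :=
      tendsto_const_nhds.congr' ((h0.eventually hχ1).mono fun n hn => hn.symm)
    have h2 : Tendsto (fun n : ℕ => deriv χ (p.2 / ((n : ℝ) + 1)) / (n + 1)) atTop (𝓝 0) := by
      refine squeeze_zero_norm (a := fun n : ℕ => M * (1 / ((n : ℝ) + 1))) (fun n => ?_) ?_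
      · have hn : (0 : ℝ) < n + 1 := by positivity
        rw [Real.norm_eq_abs, abs_div, abs_of_pos hn, mul_one_div]
        exact div_le_div_of_nonneg_right (hχ' _) hn.le
      · simpa using hn.const_mul M
    have := ((h1.const_mul (a p)).add (h2.const_mul (b p))).mul_const (ρ p)
    simpa using this

namespace WeakSolution

variable {Ω : Set (ℝ × ℝ)} {ρ : ℝ × ℝ → ℝ} {A l r m s β B : ℝ[X]} {c e : ℝ}

/-- A function of x alone is not compactly supported in the plane, so it is multiplied by χ(y / (n +
1)). The error involves (l y + r) φ χ' / (n + 1), which tends to 0 by dominated convergence, the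
density having a first moment in y. -/
lemma integral_fst_eq_zero (ws : WeakSolution Ω ρ A l r m s β B c e) {φ : ℝ → ℝ}
    (hφ : ContDiff ℝ ∞ φ) (hφc : HasCompactSupport φ) :
    ∫ p : ℝ × ℝ, (A.eval p.1 * deriv φ p.1 + β.eval p.1 * φ p.1) * ρ p = 0 := by
  have hφ' : Continuous (deriv φ) := hφ.continuous_deriv (by simp)
  have hPc : ∀ P : ℝ[X], Continuous fun x => P.eval x := fun P => (contDiff_eval P).continuous
  have hbd : ∀ {K : ℝ → ℝ} {j : ℕ}, Continuous K → HasCompactSupport K →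
      Integrable fun p : ℝ × ℝ => K p.1 * (p.2 ^ j * ρ p) := by
    intro K j hK hKc
    obtain ⟨M, hM⟩ := hK.bounded_above_of_compact_support hKc
    refine Integrable.bdd_mul (c := M) (by simpa using ws.moments 0 j)
      (hK.comp continuous_fst).aestronglyMeasurable (Eventually.of_forall fun p => hM _)
  obtain ⟨χ, hχ, hχ0, hχ1, hχM⟩ : ∃ χ : ℝ → ℝ, ContDiff ℝ ∞ χ ∧ HasCompactSupport χ ∧
      (∀ᶠ y in 𝓝 0, χ y = 1) ∧ ∀ y, |χ y| ≤ 1 := by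
    let χ : ContDiffBump (0 : ℝ) := ⟨1, 2, one_pos, one_lt_two⟩
    exact ⟨χ, χ.contDiff, χ.hasCompactSupport, χ.eventuallyEq_one, fun y => by
      rw [abs_of_nonneg χ.nonneg]; exact χ.le_one⟩
  obtain ⟨M, hM⟩ := (hχ.continuous_deriv (by simp)).bounded_above_of_compact_support hχ0.deriv
  have ha : Integrable fun p : ℝ × ℝ => (A.eval p.1 * deriv φ p.1 + β.eval p.1 * φ p.1) * ρ p := by
    refine (hbd (K := fun x => A.eval x * deriv φ x + β.eval x * φ x) (j := 0)
      (((hPc A).mul hφ').add ((hPc β).mul hφ.continuous))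
      (hφc.deriv.mul_left.add hφc.mul_left)).congr (Eventually.of_forall fun p => ?_)
    simp
  have hb : Integrable fun p : ℝ × ℝ => ((l.eval p.1 * p.2 + r.eval p.1) * φ p.1) * ρ p := by
    refine ((hbd (K := fun x => l.eval x * φ x) (j := 1) ((hPc l).mul hφ.continuous)
      hφc.mul_left).add (hbd (K := fun x => r.eval x * φ x) (j := 0)
      ((hPc r).mul hφ.continuous) hφc.mul_left)).congr (Eventually.of_forall fun p => ?_)
    simp
    ring
  refine tendsto_nhds_unique (tendsto_integral_cutoff ha hb hχ hχ1 hχM hM) ?_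
  refine tendsto_const_nhds.congr fun n => ?_
  have hn : (n : ℝ) + 1 ≠ 0 := by positivity
  have hf : ContDiff ℝ ∞ fun p : ℝ × ℝ => φ p.1 * χ (p.2 / (n + 1)) :=
    (hφ.comp contDiff_fst).mul (hχ.comp (contDiff_snd.div_const _))
  have hfc : HasCompactSupport fun p : ℝ × ℝ => φ p.1 * χ (p.2 / (n + 1)) := by
    have hc : IsCompact (tsupport φ ×ˢ ((fun y => ((n : ℝ) + 1) * y) '' tsupport χ)) :=
      hφc.isCompact.prod (hχ0.isCompact.image (by fun_prop))
    refine HasCompactSupport.intro hc fun p hp => ?_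
    by_contra hne
    refine hp ⟨subset_tsupport _ fun h => hne (by simp [h]), ⟨p.2 / (n + 1), subset_tsupport _
      fun h => hne (by simp [h]), by field_simp⟩⟩
  refine (ws.eq_fst _ hf hfc).symm.trans ?_
  refine integral_congr_ae (Eventually.of_forall fun p => ?_)
  have h1 : fderiv ℝ (fun p : ℝ × ℝ => φ p.1 * χ (p.2 / (n + 1))) p (1, 0) =
      deriv φ p.1 * χ (p.2 / (n + 1)) :=
    fderiv_fst_of_hasDerivAt hf
      ((hφ.differentiable (by simp) p.1).hasDerivAt.mul_const (χ (p.2 / (n + 1))))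
  have h2 : fderiv ℝ (fun p : ℝ × ℝ => φ p.1 * χ (p.2 / (n + 1))) p (0, 1) =
      φ p.1 * (deriv χ (p.2 / (n + 1)) * (1 / (n + 1))) :=
    fderiv_snd_of_hasDerivAt hf (((hχ.differentiable (by simp)
      (p.2 / (n + 1))).hasDerivAt.comp p.2 ((hasDerivAt_id p.2).div_const (n + 1))).const_mul (φ p.1))
  simp only [h1, h2]
  ring

/-- The first marginal satisfies a Pearson equation. -/
lemma exists_fst_normal (ws : WeakSolution Ω ρ A l r m s β B c e) {k : ℝ → ℝ} {H : ℝ}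
    (hk : ContinuousOn k (Prod.fst '' Ω)) (hk0 : ∀ x ∈ Prod.fst '' Ω, 0 < k x)
    (hH : ∀ x ∈ Prod.fst '' Ω, ∫ y, ρ (x, y) = k x * H) :
    ∃ (J : Set ℝ) (D₀ t₀ f₀ : ℝ → ℝ) (γ δ κ C : ℝ), StdForm J D₀ t₀ f₀ ∧ γ ≠ 0 ∧ 0 < κ ∧ 0 < C ∧
      (∀ u, γ ^ 2 * A.eval u = κ * D₀ (γ * u + δ)) ∧
      (∀ u, γ * β.eval u = κ * t₀ (γ * u + δ)) ∧
      Prod.fst '' Ω = {u | γ * u + δ ∈ J} ∧ ∀ u ∈ Prod.fst '' Ω, k u = C * f₀ (γ * u + δ) := by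
  set I := Prod.fst '' Ω with hI
  have hIo : IsOpen I := ws.isOpen_proj
  have hIc : I.OrdConnected := ws.ordConnected_proj
  -- The marginal is k' H, with k' extended by zero. The constant H is nonzero because the total
  -- mass is 1, so it can be divided out of the weak equation and of the moments.
  set k' : ℝ → ℝ := I.indicator k with hk'
  have hk'e : ∀ x ∈ I, k' x = k x := fun x hx => indicator_of_mem hx k
  have hk'0 : ∀ x, x ∉ I → k' x = 0 := fun x hx => indicator_of_notMem hx k
  have hfib : ∀ x, ∫ y, ρ (x, y) = k' x * H := by
    intro x
    by_cases hx : x ∈ I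
    · rw [hk'e x hx, hH x hx]
    · have : ∀ y, ρ (x, y) = 0 := fun y => ws.zero_off _ fun h => hx ⟨_, h, rfl⟩
      simp [this, hk'0 x hx]
  have hpush : ∀ a : ℝ → ℝ, Integrable (fun p : ℝ × ℝ => a p.1 * ρ p) →
      (Integrable fun x => a x * (k' x * H)) ∧
        ∫ p : ℝ × ℝ, a p.1 * ρ p = ∫ x, a x * (k' x * H) := by
    intro a ha
    rw [Measure.volume_eq_prod] at ha ⊢
    refine ⟨?_, ?_⟩
    · simpa only [integral_const_mul, hfib] using ha.integral_prod_left
    · rw [integral_prod _ ha]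
      simp only [integral_const_mul, hfib]
  have hH0 : H ≠ 0 := by
    rintro rfl
    have h1 := (hpush (fun _ => 1) (by simpa using ws.integrable_density)).2
    simp [ws.integral_one] at h1
  have hweak : ∀ φ, ContDiff ℝ ∞ φ → HasCompactSupport φ →
      ∫ u, (A.eval u * deriv φ u + β.eval u * φ u) * k' u = 0 := by
    intro φ hφ hφc
    have hPc : ∀ P : ℝ[X], Continuous fun x => P.eval x := fun P => (contDiff_eval P).continuous
    have hK : Continuous fun x => A.eval x * deriv φ x + β.eval x * φ x :=
      ((hPc A).mul (hφ.continuous_deriv (by simp))).add ((hPc β).mul hφ.continuous)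
    obtain ⟨M, hM⟩ := hK.bounded_above_of_compact_support (hφc.deriv.mul_left.add hφc.mul_left)
    have h1 := (hpush (fun x => A.eval x * deriv φ x + β.eval x * φ x)
      (ws.integrable_density.bdd_mul (f := fun p : ℝ × ℝ => A.eval p.1 * deriv φ p.1 +
        β.eval p.1 * φ p.1) (hK.comp continuous_fst).aestronglyMeasurable (Eventually.of_forall fun p => hM p.1))).2
    rw [ws.integral_fst_eq_zero hφ hφc] at h1
    simp only [← mul_assoc, integral_mul_const] at h1
    exact (mul_eq_zero.1 h1.symm).resolve_right hH0
  have hm : ∀ n : ℕ, Integrable fun u => u ^ n * k' u := by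
    intro n
    have h1 := (hpush (fun x => x ^ n) (by simpa using ws.moments n 0)).1
    refine (h1.mul_const H⁻¹).congr (Eventually.of_forall fun x => ?_)
    field_simp
  obtain ⟨x₀, hx₀⟩ : I.Nonempty := ws.isConnected.nonempty.image _
  have hA : ∀ u, A.eval u = A.coeff 2 * u ^ 2 + A.coeff 1 * u + A.coeff 0 := fun u => by
    rw [eval_eq_sum_range' (n := 3) (by have := ws.A_deg; omega)]
    simp [Finset.sum_range_succ]
    ring
  have hβ : ∀ u, β.eval u = β.coeff 1 * u + β.coeff 0 := fun u => by
    rw [eval_eq_sum_range' (n := 2) (by have := ws.β_deg; omega)]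
    simp [Finset.sum_range_succ]
    ring
  have hfill : interior (closure {u | 0 < k' u}) ⊆ I := by
    refine (interior_mono (closure_mono (t := I) fun u hu => ?_)).trans ?_
    · by_contra h
      rw [mem_ofPred_eq, hk'0 u h] at hu
      exact lt_irrefl _ hu
    · have hconv : Convex ℝ I := hIc.convex
      rw [hconv.interior_closure_eq_interior_of_nonempty_interior
        (by rw [hIo.interior_eq]; exact ⟨x₀, hx₀⟩), hIo.interior_eq]
  have hIA : ∀ u ∈ I, 0 < A.coeff 2 * u ^ 2 + A.coeff 1 * u + A.coeff 0 := fun u hu => by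
    rw [← hA]; exact ws.A_pos_proj u hu
  simp only [hA, hβ] at hweak ⊢
  obtain ⟨J, D₀, t₀, f₀, γ, δ, κ, C, h1, h2, h3, h4, h5, h6, h7, h8⟩ :=
    pearson_normal hIA hIo (hk.congr hk'e) hk'0 ⟨x₀, by rw [hk'e _ hx₀]; exact hk0 _ hx₀⟩
      hfill hm hweak
  exact ⟨J, D₀, t₀, f₀, γ, δ, κ, C, h1, h2, h3, h4, h5, h6, h7,
    fun u hu => (hk'e u hu).symm.trans (h8 u hu)⟩

end WeakSolution

/-! ### Rigidity of the standard forms, and the splitting of the solution -/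

lemma StdForm.ode {J : Set ℝ} {D₀ t₀ f₀ : ℝ → ℝ} (h : StdForm J D₀ t₀ f₀) :
    ∀ v ∈ J, HasDerivAt (fun v => D₀ v * f₀ v) (t₀ v * f₀ v) v := by
  cases h with
  | hermite => exact fun v _ => hermite_ode v
  | laguerre a ha => exact fun v hv => laguerre_ode a hv
  | jacobi p q hp hq => exact fun v hv => jacobi_ode p q hv

/-- A quadratic polynomial without positive leading coefficient which is positive exactly on a
standard interval is proportional to the standard one. -/
lemma StdForm.eq_const_mul {J : Set ℝ} {D₀ t₀ f₀ : ℝ → ℝ} (h : StdForm J D₀ t₀ f₀)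
    {a b d : ℝ} (ha : a ≤ 0) (hJ : ∀ v, v ∈ J ↔ 0 < a * v ^ 2 + b * v + d) :
    ∃ κ, 0 < κ ∧ ∀ v, a * v ^ 2 + b * v + d = κ * D₀ v := by
  -- At an endpoint of J the quadratic is nonnegative by continuity and not positive, as the
  -- endpoint is outside J. So it vanishes at the endpoints, and a ≤ 0 settles the unbounded cases.
  have hcl : ∀ v ∈ closure J, 0 ≤ a * v ^ 2 + b * v + d := by
    intro v hv
    have h1 : IsClosed {v : ℝ | 0 ≤ a * v ^ 2 + b * v + d} :=
      isClosed_le continuous_const (by fun_prop)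
    exact closure_minimal (fun v hv => ((hJ v).1 hv).le) h1 hv
  cases h with
  | hermite =>
    have hp : ∀ v, 0 < a * v ^ 2 + b * v + d := fun v => (hJ v).1 (mem_univ v)
    have hd : 0 < d := by simpa using hp 0
    have ha0 : a = 0 := by
      by_contra hne
      have ha' : a < 0 := lt_of_le_of_ne ha hne
      have h1 := hp (1 - d / a)
      have h2 := hp (-(1 - d / a))
      have h3 : 0 < a * (1 - d / a) ^ 2 + d := by linarith
      have h4 : d / a < 0 := div_neg_of_pos_of_neg hd ha'
      have h5 : a * (1 - d / a) ^ 2 + d = a * (1 - d / a + (d / a) ^ 2) := by field_simp; ring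
      rw [h5] at h3
      nlinarith [sq_nonneg (d / a)]
    subst ha0
    have hb : b = 0 := by
      by_contra hne
      have h1 := hp (-d / b)
      have h2 : b * (-d / b) = -d := by field_simp
      simp [h2] at h1
    exact ⟨d, hd, fun v => by rw [hb]; ring⟩
  | laguerre q hq =>
    have h0 : ¬ (0 < a * (0 : ℝ) ^ 2 + b * 0 + d) := fun h => lt_irrefl (0 : ℝ) ((hJ 0).2 h)
    have h0' := hcl 0 (by simp)
    have hd : d = 0 := by
      simp at h0 h0'
      linarith
    subst hd
    have hp : ∀ v, 0 < v → 0 < a * v + b := fun v hv => by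
      have := (hJ v).1 hv
      have h2 : 0 < v * (a * v + b) := by linarith
      exact (mul_pos_iff_of_pos_left hv).1 h2
    have ha0 : a = 0 := by
      by_contra hne
      have ha' : a < 0 := lt_of_le_of_ne ha hne
      have h1 := hp (1 + |b| / (-a)) (by have := neg_pos.2 ha'; positivity)
      have h2 : a * (1 + |b| / (-a)) = a - |b| := by field_simp; ring
      rw [h2] at h1
      linarith [le_abs_self b]
    subst ha0
    exact ⟨b, by simpa using hp 1 one_pos, fun v => by ring⟩
  | jacobi p q hp hq =>
    have h1 : ¬ (0 < a * (1 : ℝ) ^ 2 + b * 1 + d) := fun h => lt_irrefl _ ((hJ 1).2 h).2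
    have h2 : ¬ (0 < a * (-1 : ℝ) ^ 2 + b * (-1) + d) := fun h => lt_irrefl _ ((hJ (-1)).2 h).1
    have hc : closure (Ioo (-1 : ℝ) 1) = Icc (-1) 1 := closure_Ioo (by norm_num)
    have h1' := hcl 1 (by rw [hc]; simp)
    have h2' := hcl (-1) (by rw [hc]; simp)
    have h3 := (hJ 0).1 (by simp)
    have hb : b = 0 := by linarith
    have hd : d = -a := by linarith
    subst hb hd
    exact ⟨-a, by simpa using h3, fun v => by ring⟩

lemma StdForm.isOpen {J : Set ℝ} {D₀ t₀ f₀ : ℝ → ℝ} (h : StdForm J D₀ t₀ f₀) : IsOpen J := by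
  cases h with
  | hermite => exact isOpen_univ
  | laguerre a ha => exact isOpen_Ioi
  | jacobi p q hp hq => exact isOpen_Ioo

lemma StdForm.nonempty {J : Set ℝ} {D₀ t₀ f₀ : ℝ → ℝ} (h : StdForm J D₀ t₀ f₀) : J.Nonempty := by
  cases h with
  | hermite => exact univ_nonempty
  | laguerre a ha => exact ⟨1, mem_Ioi.2 one_pos⟩
  | jacobi p q hp hq => exact ⟨0, by simp⟩

lemma StdForm.exists_drift {J : Set ℝ} {D₀ t₀ f₀ : ℝ → ℝ} (h : StdForm J D₀ t₀ f₀) :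
    ∃ a b : ℝ, a < 0 ∧ ∀ v, t₀ v = a * v + b := by
  cases h with
  | hermite => exact ⟨-1, 0, by norm_num, fun v => by ring⟩
  | laguerre a ha => exact ⟨-1, a, by norm_num, fun v => by ring⟩
  | jacobi p q hp hq => exact ⟨-(p + q), q - p, by linarith, fun v => by ring⟩

lemma affine_eq_of_eqOn_open {U : Set ℝ} (hU : IsOpen U) (hne : U.Nonempty) {a b a' b' : ℝ}
    (h : ∀ u ∈ U, a * u + b = a' * u + b') : a = a' ∧ b = b' := by
  obtain ⟨u, hu⟩ := hne
  obtain ⟨ε, hε, hb⟩ := Metric.isOpen_iff.1 hU u hu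
  have h1 := h u hu
  have h2 := h (u + ε / 2) (hb (by
    rw [Metric.mem_ball, Real.dist_eq, add_sub_cancel_left, abs_of_pos] <;> linarith))
  have h3 : a = a' := by
    have : (a - a') * (ε / 2) = 0 := by linarith
    rcases mul_eq_zero.1 this with h | h <;> linarith
  subst h3
  exact ⟨rfl, by linarith⟩

/-- Once D and h are known, the equation (D h)' = t h determines t where h > 0. Both candidates for
t are affine, so agreement on a nonempty open set gives agreement everywhere. -/
lemma drift_eq_of_ode {J : Set ℝ} {D₀ t₀ f₀ : ℝ → ℝ} (hs : StdForm J D₀ t₀ f₀) {γ δ C κ : ℝ}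
    (hγ : γ ≠ 0) (hC : 0 < C) {h D : ℝ → ℝ} {t1 t0 : ℝ}
    (hh : ∀ u, γ * u + δ ∈ J → h u = C * f₀ (γ * u + δ)) (hD : ∀ u, D u = κ * D₀ (γ * u + δ))
    (hd : ∀ u, γ * u + δ ∈ J → HasDerivAt (fun u => D u * h u) ((t1 * u + t0) * h u) u) :
    ∀ u, t1 * u + t0 = κ * γ * t₀ (γ * u + δ) := by
  obtain ⟨a, b, -, hab⟩ := hs.exists_drift
  have hcont : Continuous fun u : ℝ => γ * u + δ := by fun_prop
  have hWo : IsOpen {u : ℝ | γ * u + δ ∈ J} := hs.isOpen.preimage hcont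
  obtain ⟨v, hv⟩ := hs.nonempty
  have hne : {u : ℝ | γ * u + δ ∈ J}.Nonempty :=
    ⟨(v - δ) / γ, by rw [mem_ofPred_eq, mul_div_cancel₀ _ hγ, sub_add_cancel]; exact hv⟩
  have h1 : ∀ u ∈ {u : ℝ | γ * u + δ ∈ J}, t1 * u + t0 =
      κ * γ * a * γ * u + κ * γ * (a * δ + b) := by
    intro u hu
    have e1 : HasDerivAt (fun u : ℝ => γ * u + δ) γ u :=
      hasDerivAt_of_eq (((hasDerivAt_id u).const_mul γ).add_const δ) (fun _ => rfl) (mul_one _)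
    have e2 := ((hs.ode _ hu).comp u e1).const_mul (κ * C)
    have e3 : (fun u => D u * h u) =ᶠ[𝓝 u]
        fun u => κ * C * ((fun v => D₀ v * f₀ v) ∘ fun u => γ * u + δ) u := by
      filter_upwards [hWo.mem_nhds hu] with w hw
      rw [hD, hh w hw, Function.comp_apply]
      ring
    have e4 := (hd u hu).unique (e2.congr_of_eventuallyEq e3)
    have e5 := hs.pos _ hu
    rw [hh u hu, hab] at e4
    have e6 : C * f₀ (γ * u + δ) ≠ 0 := by positivity
    refine mul_right_cancel₀ e6 (e4.trans ?_)
    ring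
  obtain ⟨h2, h3⟩ := affine_eq_of_eqOn_open hWo hne h1
  intro u
  rw [hab, h2, h3]
  ring

/-- The solution splits as a product of two standard one-dimensional families, in the coordinates
`γ x + δ` and `E(x) y - F(x)`. -/
structure SplitForm (Ω : Set (ℝ × ℝ)) (ρ : ℝ × ℝ → ℝ) (A l r m s β B : ℝ[X]) (c e : ℝ)
    (J₁ : Set ℝ) (D₁ t₁ f₁ : ℝ → ℝ) (γ δ κ : ℝ) (J₂ : Set ℝ) (D₂ t₂ f₂ E F K : ℝ → ℝ) (C : ℝ) :
    Prop where
  std₁ : StdForm J₁ D₁ t₁ f₁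
  γ_ne : γ ≠ 0
  κ_pos : 0 < κ
  A_eq : ∀ x, γ ^ 2 * A.eval x = κ * D₁ (γ * x + δ)
  β_eq : ∀ x, γ * β.eval x = κ * t₁ (γ * x + δ)
  std₂ : StdForm J₂ D₂ t₂ f₂
  E_ne : ∀ x, E x ≠ 0
  E_sign : ∃ σ : ℝ, σ ^ 2 = 1 ∧ ∀ x, |E x| = σ * E x
  E_ode : ∀ x, γ * x + δ ∈ J₁ → HasDerivAt E (-(l.eval x / A.eval x) * E x) x
  F_ode : ∀ x, γ * x + δ ∈ J₁ → HasDerivAt F (E x * r.eval x / A.eval x) x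
  K_pos : ∀ x, γ * x + δ ∈ J₁ → 0 < K x
  disc_eq : ∀ x, γ * x + δ ∈ J₁ → ∀ y, (disc₂ A l c).eval x * y ^ 2 + (disc₁ A l r m).eval x * y +
    (disc₀ A r s).eval x = K x * D₂ (E x * y - F x)
  drift_eq : ∀ x, γ * x + δ ∈ J₁ → ∀ y, (drift₁ A l β e).eval x * y + (drift₀ A l r β B).eval x =
    K x * E x * t₂ (E x * y - F x)
  mem_iff : ∀ p : ℝ × ℝ, p ∈ Ω ↔ γ * p.1 + δ ∈ J₁ ∧ E p.1 * p.2 - F p.1 ∈ J₂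
  C_pos : 0 < C
  density_eq : ∀ p ∈ Ω, ρ p = C * |E p.1| * f₁ (γ * p.1 + δ) * f₂ (E p.1 * p.2 - F p.1)

namespace WeakSolution

variable {Ω : Set (ℝ × ℝ)} {ρ : ℝ × ℝ → ℝ} {A l r m s β B : ℝ[X]} {c e : ℝ}

lemma straight_quad (a₂ a₁ a₀ : ℝ) {E F : ℝ} (hE : E ≠ 0) (y : ℝ) :
    a₂ / E * (E * y - F) ^ 2 + (a₁ + 2 * a₂ * (F / E)) * (E * y - F) +
      E * (a₂ * (F / E) ^ 2 + a₁ * (F / E) + a₀) = E * (a₂ * y ^ 2 + a₁ * y + a₀) := by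
  field_simp
  ring

set_option maxHeartbeats 1000000 in
lemma exists_splitForm (ws : WeakSolution Ω ρ A l r m s β B c e) :
    ∃ J₁ D₁ t₁ f₁ γ δ κ J₂ D₂ t₂ f₂ E F K C,
      SplitForm Ω ρ A l r m s β B c e J₁ D₁ t₁ f₁ γ δ κ J₂ D₂ t₂ f₂ E F K C := by
  obtain ⟨E, F, k, h, hE0, hEd, hFd, hkc, hk0, hhn, hhpos, hhm, hGk, hhc, hfill, hweak⟩ :=
    ws.exists_separation
  have hmemI : ∀ p ∈ Ω, p.1 ∈ Prod.fst '' Ω := fun p hp => ⟨p, hp, rfl⟩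
  have hEy : ∀ x y, (E x * y - F x + F x) / E x = y := fun x y => by
    have := (hE0 x).ne'
    field_simp
    ring
  have hρ : ∀ x ∈ Prod.fst '' Ω, ∀ y, ρ (x, y) = E x * k x * h (E x * y - F x) := by
    intro x hx y
    have h1 := hGk x hx (E x * y - F x)
    rw [straightDensity, hEy] at h1
    rw [div_eq_iff (hE0 x).ne'] at h1
    rw [h1]
    ring
  have hH : ∀ x ∈ Prod.fst '' Ω, ∫ y, ρ (x, y) = k x * ∫ u, h u := by
    intro x hx
    rw [← integral_affine (b := F x) (hE0 x) fun y => ρ (x, y), ← integral_const_mul]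
    exact integral_congr_ae (Eventually.of_forall fun u => hGk x hx u)
  obtain ⟨J₁, D₁, t₁, f₁, γ, δ, κ, C₁, hs1, hγ, hκ, hC1, hA, hβ, hI, hk⟩ :=
    ws.exists_fst_normal hkc hk0 hH
  have hIiff : ∀ x, x ∈ Prod.fst '' Ω ↔ γ * x + δ ∈ J₁ := fun x => by rw [hI]; rfl
  have hW : ∀ x, {u | (x, u) ∈ straightDomain Ω E F} =
      {u | (x, (u + F x) / E x) ∈ Ω} := fun x => rfl
  have hWo : ∀ x, IsOpen {u | (x, u) ∈ straightDomain Ω E F} := fun x =>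
    ws.isOpen.preimage (f := fun u => (x, (u + F x) / E x)) (by fun_prop)
  have hW0 : ∀ x ∈ Prod.fst '' Ω, ∀ u, u ∉ {u | (x, u) ∈ straightDomain Ω E F} → h u = 0 := by
    intro x hx u hu
    have h1 := hGk x hx u
    rw [straightDensity, ws.zero_off _ hu, zero_div] at h1
    exact (mul_eq_zero.1 h1.symm).resolve_left (hk0 x hx).ne'
  have hWD : ∀ x ∈ Prod.fst '' Ω, ∀ u ∈ {u | (x, u) ∈ straightDomain Ω E F},
      0 < (disc₂ A l c).eval x / E x * u ^ 2 +
            ((disc₁ A l r m).eval x + 2 * (disc₂ A l c).eval x * (F x / E x)) * u +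
            E x * ((disc₂ A l c).eval x * (F x / E x) ^ 2 + (disc₁ A l r m).eval x * (F x / E x) +
              (disc₀ A r s).eval x) := by
    intro x hx u hu
    have h1 := ws.disc_pos _ hu
    have h2 := straight_quad ((disc₂ A l c).eval x) ((disc₁ A l r m).eval x)
      ((disc₀ A r s).eval x) (F := F x) (hE0 x).ne' ((u + F x) / E x)
    have h3 : E x * ((u + F x) / E x) - F x = u := by
      have := (hE0 x).ne'
      field_simp
      ring
    rw [h3] at h2
    rw [h2]
    refine mul_pos (hE0 x) ?_
    simp only [disc₂, disc₁, disc₀, eval_sub, eval_mul, eval_pow, eval_C, eval_ofNat]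
    simp only at h1
    linarith
  obtain ⟨x₀, hx₀⟩ : (Prod.fst '' Ω).Nonempty := ws.isConnected.nonempty.image _
  -- The family of h is fixed once, over one x₀. Over any other x the same h, with the same
  -- positivity set, solves a Pearson equation, whose coefficients must therefore be multiples of
  -- the standard ones; the multiple, divided by E, is K(x).
  obtain ⟨J₂, D₂, t₂, f₂, γ₂, δ₂, κ₂, C₂, hs2, hγ2, hκ2, hC2, -, -, hW2, hh2⟩ :=
    pearson_normal (hWD x₀ hx₀) (hWo x₀) (hhc x₀ hx₀) (hW0 x₀ hx₀) hhpos (hfill x₀ hx₀) hhm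
      (hweak x₀ hx₀)
  have hpos2 : ∀ u, 0 < h u ↔ γ₂ * u + δ₂ ∈ J₂ := by
    intro u
    constructor
    · intro hu
      have : u ∈ {u | (x₀, u) ∈ straightDomain Ω E F} := by
        by_contra h'
        exact hu.ne' (hW0 x₀ hx₀ u h')
      rw [hW2] at this
      exact this
    · intro hu
      have : u ∈ {u | (x₀, u) ∈ straightDomain Ω E F} := by rw [hW2]; exact hu
      rw [hh2 u this]
      exact mul_pos hC2 (hs2.pos _ hu)
  have hh2' : ∀ u, γ₂ * u + δ₂ ∈ J₂ → h u = C₂ * f₂ (γ₂ * u + δ₂) := fun u hu =>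
    hh2 u (by rw [hW2]; exact hu)
  have hfiber : ∀ x ∈ Prod.fst '' Ω,
      (∀ u, (x, u) ∈ straightDomain Ω E F ↔ γ₂ * u + δ₂ ∈ J₂) ∧ ∃ K, 0 < K ∧
      (∀ y, (disc₂ A l c).eval x * y ^ 2 + (disc₁ A l r m).eval x * y + (disc₀ A r s).eval x =
        K * D₂ (γ₂ * (E x * y - F x) + δ₂)) ∧
      ∀ y, (drift₁ A l β e).eval x * y + (drift₀ A l r β B).eval x =
        K * (γ₂ * E x) * t₂ (γ₂ * (E x * y - F x) + δ₂) := by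
    intro x hx
    obtain ⟨hd2, hWx, hode⟩ := pearson_basic (hWD x hx) (hWo x) (hhc x hx) (hW0 x hx) hhpos
      (hfill x hx) hhm (hweak x hx)
    have hmem : ∀ u, (x, u) ∈ straightDomain Ω E F ↔ γ₂ * u + δ₂ ∈ J₂ := by
      intro u
      rw [← hpos2]
      exact ⟨fun hu => (hode u hu).1, fun hu => by
        by_contra h'
        exact hu.ne' (hW0 x hx u h')⟩
    refine ⟨hmem, ?_⟩
    set a₂ := (disc₂ A l c).eval x
    set a₁ := (disc₁ A l r m).eval x
    set a₀ := (disc₀ A r s).eval x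
    set b₂ := a₂ / E x with hb₂
    set b₁ := a₁ + 2 * a₂ * (F x / E x) with hb₁
    set b₀ := E x * (a₂ * (F x / E x) ^ 2 + a₁ * (F x / E x) + a₀) with hb₀
    have hsub : ∀ u, b₂ * u ^ 2 + b₁ * u + b₀ = b₂ / γ₂ ^ 2 * (γ₂ * u + δ₂) ^ 2 +
        (b₁ / γ₂ - 2 * δ₂ * b₂ / γ₂ ^ 2) * (γ₂ * u + δ₂) +
        (b₂ * δ₂ ^ 2 / γ₂ ^ 2 - b₁ * δ₂ / γ₂ + b₀) := by
      intro u
      field_simp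
      ring
    obtain ⟨κ', hκ', hD⟩ := hs2.eq_const_mul (a := b₂ / γ₂ ^ 2)
      (b := b₁ / γ₂ - 2 * δ₂ * b₂ / γ₂ ^ 2) (d := b₂ * δ₂ ^ 2 / γ₂ ^ 2 - b₁ * δ₂ / γ₂ + b₀)
      (div_nonpos_of_nonpos_of_nonneg hd2 (sq_nonneg _)) (fun v => by
        have h1 : γ₂ * ((v - δ₂) / γ₂) + δ₂ = v := by field_simp; ring
        have h2 := hmem ((v - δ₂) / γ₂)
        have h3 := hsub ((v - δ₂) / γ₂)
        rw [h1] at h2 h3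
        rw [← h2, ← h3]
        exact Set.ext_iff.1 hWx _)
    have hD' : ∀ u, b₂ * u ^ 2 + b₁ * u + b₀ = κ' * D₂ (γ₂ * u + δ₂) := fun u => by
      rw [hsub, hD]
    have ht := drift_eq_of_ode hs2 hγ2 hC2 hh2' hD' fun u hu => (hode u ((hmem u).2 hu)).2
    have hEx := (hE0 x).ne'
    refine ⟨κ' / E x, div_pos hκ' (hE0 x), fun y => ?_, fun y => ?_⟩
    · have h1 := straight_quad a₂ a₁ a₀ (F := F x) hEx y
      rw [← hb₂, ← hb₁, ← hb₀, hD'] at h1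
      rw [div_mul_eq_mul_div, h1, mul_div_cancel_left₀ _ hEx]
    · have h1 := ht (E x * y - F x)
      rw [show κ' / E x * (γ₂ * E x) = κ' * γ₂ by field_simp, ← h1]
      field_simp
      ring
  choose! hmem K hK hdisc hdrift using hfiber
  have hv : ∀ x y, γ₂ * E x * y - (γ₂ * F x - δ₂) = γ₂ * (E x * y - F x) + δ₂ := fun x y => by ring
  -- The affine map v = γ₂ u + δ₂ is absorbed into E and F. Then E may be negative, but its sign is
  -- constant, which `E_sign` records.
  refine ⟨J₁, D₁, t₁, f₁, γ, δ, κ, J₂, D₂, t₂, f₂, fun x => γ₂ * E x, fun x => γ₂ * F x - δ₂, K,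
    C₁ * C₂ / |γ₂|, hs1, hγ, hκ, hA, hβ, hs2, fun x => mul_ne_zero hγ2 (hE0 x).ne', ?_, ?_, ?_, ?_,
    ?_, ?_, ?_, div_pos (mul_pos hC1 hC2) (abs_pos.2 hγ2), ?_⟩
  · refine ⟨|γ₂| / γ₂, by rw [div_pow, sq_abs, div_self (pow_ne_zero 2 hγ2)], fun x => ?_⟩
    rw [abs_mul, abs_of_pos (hE0 x)]
    field_simp
  · intro x hx
    exact hasDerivAt_of_eq ((hEd x ((hIiff x).2 hx)).const_mul γ₂) (fun _ => rfl) (by ring)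
  · intro x hx
    exact hasDerivAt_of_eq (((hFd x ((hIiff x).2 hx)).const_mul γ₂).sub_const δ₂) (fun _ => rfl)
      (by ring)
  · exact fun x hx => hK x ((hIiff x).2 hx)
  · intro x hx y
    rw [hv]
    exact hdisc x ((hIiff x).2 hx) y
  · intro x hx y
    rw [hv]
    exact hdrift x ((hIiff x).2 hx) y
  · rintro ⟨x, y⟩
    rw [hv, ← hIiff]
    constructor
    · intro hp
      have hx := hmemI _ hp
      refine ⟨hx, (hmem x hx _).1 ?_⟩
      rw [straightDomain, mem_ofPred_eq]
      simpa only [hEy] using hp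
    · rintro ⟨hx, hy⟩
      have := (hmem x hx _).2 hy
      rw [straightDomain, mem_ofPred_eq] at this
      simpa only [hEy] using this
  · rintro ⟨x, y⟩ hp
    have hx := hmemI _ hp
    have hy : γ₂ * (E x * y - F x) + δ₂ ∈ J₂ := (hmem x hx _).1 (by
      rw [straightDomain, mem_ofPred_eq]
      simpa only [hEy] using hp)
    simp only [hv]
    rw [hρ x hx, hk x hx, hh2' _ hy, abs_mul, abs_of_pos (hE0 x)]
    have := abs_ne_zero.2 hγ2
    field_simp

end WeakSolution

/-! ### Rational solutions of first order linear equations are polynomials -/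

lemma poly_eq_of_eqOn {I : Set ℝ} (hI : IsOpen I) (hne : I.Nonempty) {P Q : ℝ[X]}
    (h : ∀ x ∈ I, P.eval x = Q.eval x) : P = Q := by
  refine eq_of_infinite_eval_eq P Q (Set.Infinite.mono h ?_)
  obtain ⟨x, hx⟩ := hne
  exact infinite_of_mem_nhds x (hI.mem_nhds hx)

/-- A fraction `N / D` in lowest terms which solves a first order linear equation with polynomial
coefficients has a constant denominator, if the equation is regular enough. -/
lemma isUnit_of_riccati {A l r D N : ℝ[X]} (hA : Squarefree A) (hD : D ≠ 0) (hND : IsCoprime N D)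
    (hl : ∀ π, Irreducible π → π ∣ D → π ∣ A → π ∣ l)
    (h : A * (derivative N * D - N * derivative D) = l * N * D + r * D ^ 2) : IsUnit D := by
  by_contra hu
  -- Suppose q = N / D has a pole of order b + 1 along π. Then q' has order b + 2, which the right
  -- side l q + r cannot match unless π divides A. In that case π divides l too, so the right side
  -- has order at most b, while A q' has order exactly b + 1, A being squarefree.
  obtain ⟨π, hπ, hπD⟩ := WfDvdMonoid.exists_irreducible_factor hu hD
  have hp : Prime π := hπ.prime
  have hfin : FiniteMultiplicity π D := FiniteMultiplicity.of_prime_left hp hD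
  obtain ⟨u, hDu, hπu⟩ := hfin.exists_eq_pow_mul_and_not_dvd
  obtain ⟨b, hb⟩ : ∃ b, multiplicity π D = b + 1 := by
    refine Nat.exists_eq_succ_of_ne_zero fun h0 => hπu ?_
    rw [h0, pow_zero, one_mul] at hDu
    rwa [← hDu]
  rw [hb] at hDu
  have hπN : ¬ π ∣ N := fun hN => hπ.not_isUnit (hND.isUnit_of_dvd' hN hπD)
  have hπ' : ¬ π ∣ derivative π := fun h' =>
    hπ.not_isUnit (IsCoprime.isUnit_of_dvd' hπ.separable dvd_rfl h')
  have hnat : ¬ π ∣ C ((b : ℝ) + 1) := fun h' => hπ.not_isUnit (isUnit_of_dvd_unit h'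
    (isUnit_C.2 (isUnit_iff_ne_zero.2 (by positivity))))
  have hD' : derivative D = π ^ b * (C ((b : ℝ) + 1) * derivative π * u + π * derivative u) := by
    rw [hDu, derivative_mul, derivative_pow_succ]
    ring
  have hπb : π ^ b ≠ 0 := pow_ne_zero _ hπ.ne_zero
  have h1 : A * (derivative N * π * u - N * (C ((b : ℝ) + 1) * derivative π * u +
      π * derivative u)) = l * N * π * u + r * π ^ (b + 2) * u ^ 2 := by
    refine mul_left_cancel₀ hπb ?_
    rw [hD', hDu] at h
    calc _ = A * (derivative N * (π ^ (b + 1) * u) -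
        N * (π ^ b * (C ((b : ℝ) + 1) * derivative π * u + π * derivative u))) := by ring
      _ = _ := h
      _ = _ := by ring
  -- The leading coefficient of the pole of q' is prime to π; characteristic 0 is used for b + 1 and
  -- for π'.
  have key : ∀ Z : ℝ[X], π ∣ Z * (N * (C ((b : ℝ) + 1) * derivative π * u)) → π ∣ Z := by
    intro Z hZ
    refine (hp.dvd_or_dvd hZ).resolve_right fun h' => ?_
    rcases hp.dvd_or_dvd h' with h' | h'
    · exact hπN h'
    rcases hp.dvd_or_dvd h' with h' | h'
    · rcases hp.dvd_or_dvd h' with h' | h'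
      exacts [hnat h', hπ' h']
    · exact hπu h'
  have hπA : π ∣ A := key A ⟨A * (derivative N * u - N * derivative u) -
    l * N * u - r * π ^ (b + 1) * u ^ 2, by linear_combination -h1⟩
  obtain ⟨l₁, rfl⟩ := hl π hπ hπD hπA
  obtain ⟨A₁, rfl⟩ := hπA
  have h2 : A₁ * (derivative N * π * u - N * (C ((b : ℝ) + 1) * derivative π * u +
      π * derivative u)) = l₁ * N * π * u + r * π ^ (b + 1) * u ^ 2 :=
    mul_left_cancel₀ hπ.ne_zero (by linear_combination h1)
  have hπA₁ : π ∣ A₁ := key A₁ ⟨A₁ * (derivative N * u - N * derivative u) -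
    l₁ * N * u - r * π ^ b * u ^ 2, by linear_combination -h2⟩
  obtain ⟨A₂, rfl⟩ := hπA₁
  exact hπ.not_isUnit (hA π ⟨A₂, by ring⟩)

/-- The fraction N / D representing q is reduced to lowest terms and the ODE becomes an identity of
polynomials, since it holds on an open set. The condition on the irreducible factors of D passes to
the reduced denominator, which is then a unit. -/
lemma exists_polynomial_of_ode {I : Set ℝ} (hI : IsOpen I) (hne : I.Nonempty) {A l r D N : ℝ[X]}
    (hA : Squarefree A) (hl : ∀ π, Irreducible π → π ∣ D → π ∣ A → π ∣ l)
    (hA0 : ∀ x ∈ I, A.eval x ≠ 0) (hD0 : ∀ x ∈ I, D.eval x ≠ 0) {q : ℝ → ℝ}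
    (hq : ∀ x ∈ I, D.eval x * q x = N.eval x)
    (hode : ∀ x ∈ I, HasDerivAt q ((l.eval x * q x + r.eval x) / A.eval x) x) :
    ∃ Q : ℝ[X], (∀ x ∈ I, q x = Q.eval x) ∧ A * derivative Q = l * Q + r := by
  have hDne : D ≠ 0 := by
    rintro rfl
    obtain ⟨x, hx⟩ := hne
    exact hD0 x hx (by simp)
  obtain ⟨g, D₁, N₁, hcop, hDg, hNg⟩ : ∃ g D₁ N₁ : ℝ[X], IsCoprime N₁ D₁ ∧ D = g * D₁ ∧
      N = g * N₁ := by
    have hg : GCDMonoid.gcd N D ≠ 0 := gcd_ne_zero_of_right hDne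
    exact ⟨GCDMonoid.gcd N D, D / GCDMonoid.gcd N D, N / GCDMonoid.gcd N D,
      isCoprime_div_gcd_div_gcd hDne,
      (EuclideanDomain.mul_div_cancel' hg (gcd_dvd_right _ _)).symm,
      (EuclideanDomain.mul_div_cancel' hg (gcd_dvd_left _ _)).symm⟩
  have hg0 : ∀ x ∈ I, g.eval x ≠ 0 := fun x hx h0 => hD0 x hx (by rw [hDg, eval_mul, h0, zero_mul])
  have hD1 : D₁ ≠ 0 := by
    rintro rfl
    exact hDne (by rw [hDg, mul_zero])
  have hq1 : ∀ x ∈ I, D₁.eval x * q x = N₁.eval x := fun x hx => by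
    have := hq x hx
    rw [hDg, hNg, eval_mul, eval_mul, mul_assoc] at this
    exact mul_left_cancel₀ (hg0 x hx) this
  have hder : ∀ x ∈ I, (derivative D₁).eval x * q x +
      D₁.eval x * ((l.eval x * q x + r.eval x) / A.eval x) = (derivative N₁).eval x := by
    intro x hx
    have h1 := (D₁.hasDerivAt x).mul (hode x hx)
    refine h1.unique ((N₁.hasDerivAt x).congr_of_eventuallyEq ?_)
    filter_upwards [hI.mem_nhds hx] with y hy using hq1 y hy
  have hunit : IsUnit D₁ := by
    refine isUnit_of_riccati hA hD1 hcop
      (fun π h1 h2 => hl π h1 (by rw [hDg]; exact dvd_mul_of_dvd_right h2 _))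
      (poly_eq_of_eqOn hI hne fun x hx => ?_) (r := r)
    have h1 := hder x hx
    have h2 := hA0 x hx
    simp only [eval_mul, eval_sub, eval_add, eval_pow]
    rw [← h1, ← hq1 x hx]
    field_simp
    ring
  obtain ⟨d, hd, rfl⟩ := Polynomial.isUnit_iff.1 hunit
  have hd0 : d ≠ 0 := hd.ne_zero
  have hQ : ∀ x ∈ I, q x = (C d⁻¹ * N₁).eval x := fun x hx => by
    have := hq1 x hx
    rw [eval_C] at this
    rw [eval_mul, eval_C, ← this, inv_mul_cancel_left₀ hd0]
  refine ⟨C d⁻¹ * N₁, hQ, poly_eq_of_eqOn hI hne fun x hx => ?_⟩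
  have h1 := (hode x hx).unique (((C d⁻¹ * N₁).hasDerivAt x).congr_of_eventuallyEq
    (by filter_upwards [hI.mem_nhds hx] with y hy using hQ y hy))
  rw [eval_mul, ← h1, mul_div_cancel₀ _ (hA0 x hx), hQ x hx]
  simp only [eval_add, eval_mul]

lemma StdForm.D_pos {J : Set ℝ} {D₀ t₀ f₀ : ℝ → ℝ} (h : StdForm J D₀ t₀ f₀) :
    ∀ v ∈ J, 0 < D₀ v := by
  cases h with
  | hermite => exact fun v _ => one_pos
  | laguerre a ha => exact fun v hv => hv
  | jacobi p q hp hq => exact fun v hv => by nlinarith [hv.1, hv.2]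

lemma StdForm.ordConnected {J : Set ℝ} {D₀ t₀ f₀ : ℝ → ℝ} (h : StdForm J D₀ t₀ f₀) :
    J.OrdConnected := by
  cases h with
  | hermite => exact ordConnected_univ
  | laguerre a ha => exact ordConnected_Ioi
  | jacobi p q hp hq => exact ordConnected_Ioo

lemma StdForm.squarefree {J : Set ℝ} {D₀ t₀ f₀ : ℝ → ℝ} (h : StdForm J D₀ t₀ f₀) {A : ℝ[X]}
    {γ δ κ : ℝ} (hγ : γ ≠ 0) (hκ : 0 < κ)
    (hA : ∀ x, γ ^ 2 * A.eval x = κ * D₀ (γ * x + δ)) : Squarefree A := by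
  refine Separable.squarefree ?_
  have hA' : ∀ x, A.eval x = κ / γ ^ 2 * D₀ (γ * x + δ) := fun x => by
    rw [div_mul_eq_mul_div, ← hA]
    field_simp
  rw [separable_def']
  cases h with
  | hermite =>
    have : A = C (κ / γ ^ 2) := funext fun x => by rw [hA']; simp
    subst this
    refine ⟨C (γ ^ 2 / κ), 0, ?_⟩
    rw [← C_mul, zero_mul, add_zero, ← C_1]
    congr 1
    field_simp
  | laguerre a ha =>
    have : A = C (κ / γ ^ 2) * (C γ * X + C δ) := funext fun x => by rw [hA']; simp
    subst this
    refine ⟨0, C (γ / κ), ?_⟩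
    simp only [derivative_mul, derivative_C, derivative_add, derivative_X, zero_mul, zero_add,
      add_zero, mul_one, ← C_mul]
    rw [← C_1]
    congr 1
    field_simp
  | jacobi p q hp hq =>
    have : A = C (κ / γ ^ 2) * (1 - (C γ * X + C δ) ^ 2) := funext fun x => by rw [hA']; simp
    subst this
    refine ⟨C (γ ^ 2 / κ), C (-(γ / (2 * κ))) * (C γ * X + C δ), funext fun x => ?_⟩
    simp [derivative_pow]
    field_simp
    ring

lemma quadratic_coeff_eq {a b d a' b' d' : ℝ}
    (h : ∀ y : ℝ, a * y ^ 2 + b * y + d = a' * y ^ 2 + b' * y + d') : a = a' ∧ b = b' ∧ d = d' := by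
  have h0 := h 0
  have h1 := h 1
  have h2 := h (-1)
  norm_num at h0 h1 h2
  exact ⟨by linarith, by linarith, h0⟩

/-- A nonzero polynomial does not satisfy an equation `A Q' = l Q` with `A` constant. -/
lemma eq_zero_of_const_mul_derivative {A l Q : ℝ[X]} (hA : A.natDegree = 0) (hl : l ≠ 0)
    (h : A * derivative Q = l * Q) : Q = 0 := by
  by_contra hQ
  have h1 : (l * Q).natDegree = l.natDegree + Q.natDegree := natDegree_mul hl hQ
  have h2 : (A * derivative Q).natDegree ≤ (derivative Q).natDegree := by
    refine natDegree_mul_le.trans ?_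
    rw [hA, zero_add]
  rcases eq_or_ne Q.natDegree 0 with h0 | h0
  · rw [derivative_of_natDegree_zero h0, mul_zero] at h
    exact mul_ne_zero hl hQ h.symm
  · have h3 := natDegree_derivative_lt h0
    rw [h, h1] at h2
    omega

/-- The nonzero polynomial solutions of `α (x - x₀) R' = 2 l R`. -/
lemma exists_eq_pow_of_mul_derivative {α x₀ : ℝ} (hα : α ≠ 0) {l R : ℝ[X]} (hR : R ≠ 0)
    (h : C α * (X - C x₀) * derivative R = 2 * l * R) :
    ∃ (n : ℕ) (a : ℝ), l = C (α * n / 2) ∧ R = C a * (X - C x₀) ^ n := by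
  obtain ⟨R₁, hR₁, hnd⟩ := exists_eq_pow_rootMultiplicity_mul_and_not_dvd R hR x₀
  -- The degrees on the two sides force l to be constant. With R = (X - x₀)ⁿ R₁, evaluation at x₀
  -- gives α n = 2 l, and what remains says R₁' = 0.
  set n := rootMultiplicity x₀ R
  have hl : l.natDegree = 0 := by
    by_contra hl
    have hl0 : l ≠ 0 := by rintro rfl; exact hl natDegree_zero
    have h2 : (2 * l * R).natDegree = l.natDegree + R.natDegree := by
      rw [natDegree_mul (mul_ne_zero two_ne_zero hl0) hR]
      congr 1
      rw [show (2 : ℝ[X]) = C 2 from rfl, natDegree_C_mul two_ne_zero]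
    have h1 : (C α * (X - C x₀) * derivative R).natDegree ≤ R.natDegree := by
      rcases eq_or_ne R.natDegree 0 with h0 | h0
      · rw [derivative_of_natDegree_zero h0, mul_zero, natDegree_zero]
        exact Nat.zero_le _
      · refine natDegree_mul_le.trans ?_
        rw [natDegree_C_mul hα, natDegree_X_sub_C]
        have := natDegree_derivative_lt h0
        omega
    rw [h, h2] at h1
    omega
  obtain ⟨l₀, rfl⟩ := natDegree_eq_zero.1 hl
  have hX : (X - C x₀ : ℝ[X]) ≠ 0 := X_sub_C_ne_zero _
  have h1 : C (α * n) * R₁ + C α * (X - C x₀) * derivative R₁ = C (2 * l₀) * R₁ := by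
    refine mul_left_cancel₀ (pow_ne_zero n hX) ?_
    rw [hR₁] at h
    have hd : (X - C x₀) * derivative ((X - C x₀) ^ n * R₁) =
        (X - C x₀) ^ n * (C (n : ℝ) * R₁ + (X - C x₀) * derivative R₁) := by
      rcases n with _ | n
      · simp
      · rw [derivative_mul, derivative_pow_succ]
        simp only [derivative_sub, derivative_X, derivative_C, sub_zero, mul_one, Nat.cast_add,
          Nat.cast_one]
        ring
    have hC2 : (C (2 * l₀) : ℝ[X]) = 2 * C l₀ := by rw [C_mul]; rfl
    rw [hC2, C_mul]
    linear_combination h - C α * hd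
  have hroot : R₁.eval x₀ ≠ 0 := fun h0 => hnd (dvd_iff_isRoot.2 h0)
  have h2 := congrArg (eval x₀) h1
  simp only [eval_add, eval_mul, eval_C, eval_sub, eval_X, sub_self, mul_zero, zero_mul,
    add_zero] at h2
  have h3 : α * n = 2 * l₀ := mul_right_cancel₀ hroot h2
  have h4 : derivative R₁ = 0 := by
    rw [h3] at h1
    have : C α * (X - C x₀) * derivative R₁ = 0 := by linear_combination h1
    exact (mul_eq_zero.1 this).resolve_left (mul_ne_zero (C_ne_zero.2 hα) hX)
  refine ⟨n, R₁.coeff 0, by rw [h3]; congr 1; ring, ?_⟩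
  rw [hR₁, mul_comm]
  congr 1
  exact eq_C_of_natDegree_eq_zero (derivative_eq_zero.1 h4)

/-! ### Case analysis: l = 0, or l ≠ 0 with the two one-dimensional families -/

namespace SplitForm

variable {Ω : Set (ℝ × ℝ)} {ρ : ℝ × ℝ → ℝ} {A l r m s β B : ℝ[X]} {c e : ℝ}
  {J₁ : Set ℝ} {D₁ t₁ f₁ : ℝ → ℝ} {γ δ κ : ℝ} {J₂ : Set ℝ} {D₂ t₂ f₂ E F K : ℝ → ℝ} {C₀ : ℝ}

section

variable (h : SplitForm Ω ρ A l r m s β B c e J₁ D₁ t₁ f₁ γ δ κ J₂ D₂ t₂ f₂ E F K C₀)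
include h

lemma isOpen_base : IsOpen {x | γ * x + δ ∈ J₁} :=
  h.std₁.isOpen.preimage (by fun_prop : Continuous fun x => γ * x + δ)

lemma nonempty_base : {x | γ * x + δ ∈ J₁}.Nonempty := by
  obtain ⟨v, hv⟩ := h.std₁.nonempty
  refine ⟨(v - δ) / γ, ?_⟩
  rw [mem_ofPred_eq, mul_div_cancel₀ _ h.γ_ne, sub_add_cancel]
  exact hv

end

end SplitForm

namespace SplitForm

variable {Ω : Set (ℝ × ℝ)} {ρ : ℝ × ℝ → ℝ} {A l r m s β B : ℝ[X]} {c e : ℝ}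
  {J₁ : Set ℝ} {D₁ t₁ f₁ : ℝ → ℝ} {γ δ κ : ℝ} {J₂ : Set ℝ} {D₂ t₂ f₂ E F K : ℝ → ℝ} {C₀ : ℝ}

section

variable (h : SplitForm Ω ρ A l r m s β B c e J₁ D₁ t₁ f₁ γ δ κ J₂ D₂ t₂ f₂ E F K C₀)
include h

lemma A_pos {x : ℝ} (hx : γ * x + δ ∈ J₁) : 0 < A.eval x := by
  have h1 := mul_pos h.κ_pos (h.std₁.D_pos _ hx)
  rw [← h.A_eq] at h1
  exact (mul_pos_iff_of_pos_left (by have := h.γ_ne; positivity)).1 h1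

lemma squarefree : Squarefree A := h.std₁.squarefree h.γ_ne h.κ_pos h.A_eq

lemma poly_eq {P Q : ℝ[X]} (hPQ : ∀ x, γ * x + δ ∈ J₁ → P.eval x = Q.eval x) : P = Q :=
  poly_eq_of_eqOn h.isOpen_base h.nonempty_base hPQ

lemma hasDerivAt_shift {x : ℝ} (hx : γ * x + δ ∈ J₁) :
    HasDerivAt (fun x => F x / E x) ((l.eval x * (F x / E x) + r.eval x) / A.eval x) x := by
  have h1 := h.E_ne x
  have h2 := (h.A_pos hx).ne'
  refine hasDerivAt_of_eq ((h.F_ode x hx).div (h.E_ode x hx) h1) (fun _ => rfl) ?_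
  field_simp
  ring

/-- The case in which the off-diagonal coefficient does not depend on `y`. -/
lemma exists_product (hl : l = 0) : ∃ (Q : ℝ[X]) (ε κ₂ : ℝ), ε ≠ 0 ∧ 0 < κ₂ ∧
    A * derivative Q = r ∧ ∀ x, γ * x + δ ∈ J₁ → E x = ε ∧ F x = ε * Q.eval x ∧
      ε ^ 2 * K x = κ₂ * A.eval x := by
  subst hl
  obtain ⟨a, b, ha, hab⟩ := h.std₂.exists_drift
  obtain ⟨x₀, hx₀⟩ := h.nonempty_base
  have hE : ∀ x, γ * x + δ ∈ J₁ → E x = E x₀ := by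
    intro x hx
    have hd : ∀ y ∈ {x | γ * x + δ ∈ J₁}, HasDerivAt E 0 y := fun y hy => by
      simpa using h.E_ode y hy
    have hc : IsPreconnected {x | γ * x + δ ∈ J₁} := by
      refine (Convex.isPreconnected ?_)
      have h1 : Convex ℝ J₁ := h.std₁.ordConnected.convex
      exact h1.affine_preimage (AffineMap.lineMap δ (γ + δ) : ℝ →ᵃ[ℝ] ℝ) |> fun h2 => by
        refine (congrArg (Convex ℝ) (Set.ext fun x => ?_)).mp h2
        simp [AffineMap.lineMap_apply, mul_comm]
    exact h.isOpen_base.is_const_of_deriv_eq_zero hc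
      (fun y hy => (hd y hy).differentiableAt.differentiableWithinAt)
      (fun y hy => (hd y hy).deriv) hx hx₀
  -- The drift is affine in y. Its y-coefficient makes K proportional to A, and its constant term
  -- then expresses F as a rational function.
  have hdr : ∀ x, γ * x + δ ∈ J₁ → A.eval x * e = K x * E x₀ ^ 2 * a ∧
      (drift₀ A 0 r β B).eval x = K x * E x₀ * (b - a * F x) := by
    intro x hx
    obtain ⟨-, h1, h2⟩ := quadratic_coeff_eq (a := 0) (b := (drift₁ A 0 β e).eval x)
      (d := (drift₀ A 0 r β B).eval x) (a' := 0) (b' := K x * E x * (a * E x))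
      (d' := K x * E x * (b - a * F x)) fun y => by
        have := h.drift_eq x hx y
        rw [hab] at this
        linear_combination this
    rw [hE x hx] at h1 h2
    refine ⟨?_, h2⟩
    simp only [drift₁, derivative_zero, sub_zero, zero_mul, eval_mul, eval_C] at h1
    linear_combination h1
  have hE0 := h.E_ne x₀
  have hK : ∀ x, γ * x + δ ∈ J₁ → E x₀ ^ 2 * K x = e / a * A.eval x := fun x hx => by
    have := (hdr x hx).1
    have := ha.ne
    field_simp
    linarith
  have hκ₂ : 0 < e / a := by
    have h1 := hK x₀ hx₀
    have h2 : 0 < E x₀ ^ 2 * K x₀ := mul_pos (by positivity) (h.K_pos x₀ hx₀)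
    rw [h1] at h2
    exact (mul_pos_iff_of_pos_right (h.A_pos hx₀)).1 h2
  obtain ⟨Q, hQ, hQA⟩ := exists_polynomial_of_ode h.isOpen_base h.nonempty_base (l := 0) (r := r)
    (D := C (a * (e / a)) * A) (N := C (b * (e / a) / E x₀) * A - drift₀ A 0 r β B) h.squarefree
    (fun π _ _ _ => dvd_zero _) (fun x hx => (h.A_pos hx).ne')
    (fun x hx => by
      rw [eval_mul, eval_C]
      exact mul_ne_zero (mul_ne_zero ha.ne hκ₂.ne') (h.A_pos hx).ne')
    (q := fun x => F x / E x)
    (fun x hx => by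
      have h1 := (hdr x hx).2
      have h2 := hK x hx
      simp only [eval_mul, eval_C, eval_sub]
      rw [h1, hE x hx]
      field_simp at h2 ⊢
      linear_combination (b - a * F x) * h2)
    (fun x hx => h.hasDerivAt_shift hx)
  refine ⟨Q, E x₀, e / a, hE0, hκ₂, by simpa using hQA, fun x hx => ⟨hE x hx, ?_, hK x hx⟩⟩
  rw [← hQ x hx, hE x hx, mul_div_cancel₀ _ hE0]

/-- From A c = l² and A squarefree, l is a unit, so A and l are nonzero constants and E is a genuine
exponential. A power E ^ j with j ≠ 0 that is rational would be a polynomial solution of A q' = -j l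
q, hence zero for degree reasons. -/
lemma disc₂_eq_zero_false (hl : l ≠ 0) (h2 : disc₂ A l c = 0) {P : ℝ[X]} {j : ℕ} (hj : j ≠ 0)
    (hP : ∀ x, γ * x + δ ∈ J₁ → P.eval x ≠ 0) {N : ℝ[X]}
    (hN : ∀ x, γ * x + δ ∈ J₁ → P.eval x * E x ^ j = N.eval x) : False := by
  have hAl : A * C c = l ^ 2 := sub_eq_zero.1 h2
  have hc : c ≠ 0 := by
    rintro rfl
    rw [C_0, mul_zero] at hAl
    exact hl (pow_eq_zero_iff two_ne_zero |>.1 hAl.symm)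
  have hunit : IsUnit l := h.squarefree l ⟨C c⁻¹, by
    rw [← sq, ← hAl, mul_assoc, ← C_mul, mul_inv_cancel₀ hc, C_1, mul_one]⟩
  have hl0 : l.natDegree = 0 := natDegree_eq_zero_of_isUnit hunit
  have hA0 : A.natDegree = 0 := by
    have h3 : (A * C c).natDegree = A.natDegree := natDegree_mul_C hc
    rw [← h3, hAl, natDegree_pow, hl0, mul_zero]
  have hAu : IsUnit A := by
    obtain ⟨a, rfl⟩ := natDegree_eq_zero.1 hA0
    exact isUnit_C.2 (isUnit_iff_ne_zero.2 fun h0 => by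
      obtain ⟨x, hx⟩ := h.nonempty_base
      have := h.A_pos hx
      simp [h0] at this)
  obtain ⟨Q, hQ, hQA⟩ := exists_polynomial_of_ode h.isOpen_base h.nonempty_base
    (l := -(C (j : ℝ) * l)) (r := 0) (D := P) (N := N) (A := A) h.squarefree
    (fun π h1 _ h3 => (h1.not_isUnit (isUnit_of_dvd_unit h3 hAu)).elim)
    (fun x hx => (h.A_pos hx).ne') hP (q := fun x => E x ^ j) hN (fun x hx => by
      refine hasDerivAt_of_eq ((h.E_ode x hx).pow j) (fun _ => rfl) ?_
      obtain ⟨i, rfl⟩ := Nat.exists_eq_succ_of_ne_zero hj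
      have := (h.A_pos hx).ne'
      simp only [eval_neg, eval_mul, eval_C, eval_zero, Nat.succ_eq_add_one, add_tsub_cancel_right]
      field_simp
      ring)
  have hQ0 := eq_zero_of_const_mul_derivative hA0 (neg_ne_zero.2
    (mul_ne_zero (C_ne_zero.2 (Nat.cast_ne_zero.2 hj)) hl)) (hQA.trans (add_zero _))
  obtain ⟨x, hx⟩ := h.nonempty_base
  have := hQ x hx
  rw [hQ0, eval_zero] at this
  exact h.E_ne x (pow_eq_zero_iff hj |>.1 this)

end

/-- Immediate from `disc₂` = A c - l²; this is the hypothesis on poles in `exists_polynomial_of_ode`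
for denominators built from `disc₂`. -/
lemma dvd_of_dvd_disc₂ {π : ℝ[X]} (h1 : Irreducible π) (h2 : π ∣ disc₂ A l c) (h3 : π ∣ A) : π ∣ l := by
  refine h1.prime.dvd_of_dvd_pow (n := 2) ?_
  have := dvd_sub (dvd_mul_of_dvd_left h3 (C c)) h2
  rwa [disc₂, sub_sub_cancel] at this

/-- Here det g does not depend on y, and E² = -`drift₁` / `disc₀` is rational. -/
lemma hermite_false (hl : l ≠ 0) (h : SplitForm Ω ρ A l r m s β B c e J₁ D₁ t₁ f₁ γ δ κ
    univ (fun _ => 1) (fun v => -v) f₂ E F K C₀) : False := by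
  have hd : ∀ x, γ * x + δ ∈ J₁ → (disc₂ A l c).eval x = 0 ∧ (disc₀ A r s).eval x = K x := by
    intro x hx
    obtain ⟨h1, -, h3⟩ := quadratic_coeff_eq (a' := 0) (b' := 0) (d' := K x) fun y => by
      rw [h.disc_eq x hx y]; ring
    exact ⟨h1, h3⟩
  have ht : ∀ x, γ * x + δ ∈ J₁ → (drift₁ A l β e).eval x = -(K x * E x ^ 2) := by
    intro x hx
    obtain ⟨-, h1, -⟩ := quadratic_coeff_eq (a := 0) (b := (drift₁ A l β e).eval x)
      (d := (drift₀ A l r β B).eval x) (a' := 0) (b' := -(K x * E x ^ 2))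
      (d' := K x * E x * F x) fun y => by
        linear_combination h.drift_eq x hx y
    exact h1
  refine h.disc₂_eq_zero_false hl (h.poly_eq fun x hx => by rw [(hd x hx).1, eval_zero])
    two_ne_zero (P := disc₀ A r s) (N := -drift₁ A l β e)
    (fun x hx => by rw [(hd x hx).2]; exact (h.K_pos x hx).ne') fun x hx => ?_
  rw [(hd x hx).2, eval_neg, ht x hx, neg_neg]

/-- Here det g is affine in y, and E = -`drift₁` / `disc₁` is itself rational. -/
lemma laguerre_false {a : ℝ} (hl : l ≠ 0) (h : SplitForm Ω ρ A l r m s β B c e J₁ D₁ t₁ f₁ γ δ κ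
    (Ioi 0) (fun v => v) (fun v => a - v) f₂ E F K C₀) : False := by
  have hd : ∀ x, γ * x + δ ∈ J₁ → (disc₂ A l c).eval x = 0 ∧
      (disc₁ A l r m).eval x = K x * E x := by
    intro x hx
    obtain ⟨h1, h2, -⟩ := quadratic_coeff_eq (a' := 0) (b' := K x * E x) (d' := -(K x * F x))
      fun y => by rw [h.disc_eq x hx y]; ring
    exact ⟨h1, h2⟩
  have ht : ∀ x, γ * x + δ ∈ J₁ → (drift₁ A l β e).eval x = -(K x * E x ^ 2) := by
    intro x hx
    obtain ⟨-, h1, -⟩ := quadratic_coeff_eq (a := 0) (b := (drift₁ A l β e).eval x)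
      (d := (drift₀ A l r β B).eval x) (a' := 0) (b' := -(K x * E x ^ 2))
      (d' := K x * E x * (a + F x)) fun y => by
        linear_combination h.drift_eq x hx y
    exact h1
  refine h.disc₂_eq_zero_false hl (h.poly_eq fun x hx => by rw [(hd x hx).1, eval_zero])
    one_ne_zero (P := disc₁ A l r m) (N := -drift₁ A l β e)
    (fun x hx => by rw [(hd x hx).2]; exact mul_ne_zero (h.K_pos x hx).ne' (h.E_ne x))
    fun x hx => ?_
  rw [(hd x hx).2, eval_neg, ht x hx]
  ring

section

variable {p q : ℝ} (h : SplitForm Ω ρ A l r m s β B c e J₁ D₁ t₁ f₁ γ δ κ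
    (Ioo (-1) 1) (fun v => 1 - v ^ 2) (fun v => q - p - (p + q) * v) f₂ E F K C₀)
include h

lemma jacobi_disc {x : ℝ} (hx : γ * x + δ ∈ J₁) : (disc₂ A l c).eval x = -(K x * E x ^ 2) ∧
    (disc₁ A l r m).eval x = 2 * K x * E x * F x ∧
    (disc₀ A r s).eval x = K x * (1 - F x ^ 2) :=
  quadratic_coeff_eq fun y => by rw [h.disc_eq x hx y]; ring

lemma jacobi_drift {x : ℝ} (hx : γ * x + δ ∈ J₁) :
    (drift₁ A l β e).eval x = -((p + q) * (K x * E x ^ 2)) ∧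
    (drift₀ A l r β B).eval x = K x * E x * (q - p + (p + q) * F x) :=
  (quadratic_coeff_eq (a := 0) (a' := 0) fun y => by
    rw [zero_mul, zero_add, h.drift_eq x hx y]; ring).2

lemma jacobi_disc₂_ne {x : ℝ} (hx : γ * x + δ ∈ J₁) : (disc₂ A l c).eval x ≠ 0 := by
  rw [(h.jacobi_disc hx).1]
  exact neg_ne_zero.2 (mul_ne_zero (h.K_pos x hx).ne' (pow_ne_zero 2 (h.E_ne x)))

/-- From det g = K (1 - (E y - F)²) one reads F / E = -`disc₁` / (2 `disc₂`) and, from the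
discriminant in y, 1 / E² = (`disc₁`² - 4 `disc₂` `disc₀`) / (4 `disc₂`²). Both solve linear ODEs,
so they are polynomials Q and R, and the vertical sections of Ω are (y - Q)² < R. -/
lemma jacobi_polynomials : ∃ Q R : ℝ[X], (∀ x, γ * x + δ ∈ J₁ → F x = E x * Q.eval x) ∧
    (∀ x, γ * x + δ ∈ J₁ → E x ^ 2 * R.eval x = 1) ∧ A * derivative Q = l * Q + r ∧
    A * derivative R = 2 * l * R := by
  obtain ⟨Q, hQ, hQA⟩ := exists_polynomial_of_ode h.isOpen_base h.nonempty_base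
    (l := l) (r := r) (D := disc₂ A l c) (N := C (-1 / 2) * disc₁ A l r m) (A := A) h.squarefree
    (fun _ => dvd_of_dvd_disc₂) (fun x hx => (h.A_pos hx).ne') (fun x hx => h.jacobi_disc₂_ne hx)
    (q := fun x => F x / E x) (fun x hx => by
      obtain ⟨h1, h2, -⟩ := h.jacobi_disc hx
      have := h.E_ne x
      rw [eval_mul, eval_C, h1, h2]
      field_simp)
    (fun x hx => h.hasDerivAt_shift hx)
  obtain ⟨R, hR, hRA⟩ := exists_polynomial_of_ode h.isOpen_base h.nonempty_base
    (l := 2 * l) (r := 0) (D := disc₂ A l c ^ 2)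
    (N := C (1 / 4) * (disc₁ A l r m ^ 2 - C 4 * disc₂ A l c * disc₀ A r s)) (A := A) h.squarefree
    (fun π h1 h2 h3 => dvd_mul_of_dvd_right (dvd_of_dvd_disc₂ h1 (h1.prime.dvd_of_dvd_pow h2) h3) _)
    (fun x hx => (h.A_pos hx).ne')
    (fun x hx => by rw [eval_pow]; exact pow_ne_zero 2 (h.jacobi_disc₂_ne hx))
    (q := fun x => 1 / E x ^ 2) (fun x hx => by
      obtain ⟨h1, h2, h3⟩ := h.jacobi_disc hx
      have := h.E_ne x
      simp only [eval_mul, eval_C, eval_pow, eval_sub]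
      rw [h1, h2, h3]
      field_simp
      ring)
    (fun x hx => by
      have h1 := h.E_ne x
      have h2 := (h.A_pos hx).ne'
      refine hasDerivAt_of_eq (((h.E_ode x hx).pow 2).inv (pow_ne_zero 2 h1))
        (fun y => by simp) ?_
      simp only [eval_mul, eval_ofNat, eval_zero]
      field_simp
      simp
      ring)
  refine ⟨Q, R, fun x hx => ?_, fun x hx => ?_, hQA, by rw [hRA, add_zero]⟩
  · rw [← hQ x hx, mul_div_cancel₀ _ (h.E_ne x)]
  · rw [← hR x hx, mul_one_div_cancel (pow_ne_zero 2 (h.E_ne x))]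

end

end SplitForm

namespace SplitForm

variable {Ω : Set (ℝ × ℝ)} {ρ : ℝ × ℝ → ℝ} {A l r m s β B : ℝ[X]} {c e : ℝ}
  {J₁ : Set ℝ} {D₁ t₁ f₁ : ℝ → ℝ} {γ δ κ : ℝ} {J₂ : Set ℝ} {D₂ t₂ f₂ E F K : ℝ → ℝ} {C₀ : ℝ}

lemma R_ne_zero {J : Set ℝ} (hne : {x : ℝ | γ * x + δ ∈ J}.Nonempty) {R : ℝ[X]}
    (hER : ∀ x, γ * x + δ ∈ J → E x ^ 2 * R.eval x = 1) : R ≠ 0 := by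
  rintro rfl
  obtain ⟨x, hx⟩ := hne
  simpa using hER x hx

/-- With A constant, A R' = 2 l R has no nonzero polynomial solution when l ≠ 0. -/
lemma hermite_jacobi_false {p q : ℝ} (hl : l ≠ 0) (h : SplitForm Ω ρ A l r m s β B c e
    univ (fun _ => 1) t₁ f₁ γ δ κ
    (Ioo (-1) 1) (fun v => 1 - v ^ 2) (fun v => q - p - (p + q) * v) f₂ E F K C₀) : False := by
  obtain ⟨Q, R, -, hER, -, hR⟩ := h.jacobi_polynomials
  have hA : A = C (κ / γ ^ 2) := funext fun x => by
    rw [eval_C, eq_div_iff (pow_ne_zero 2 h.γ_ne), mul_comm, h.A_eq, mul_one]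
  exact R_ne_zero h.nonempty_base hER (eq_zero_of_const_mul_derivative
    (by rw [hA, natDegree_C]) (mul_ne_zero two_ne_zero hl) hR)

/-- The base is a bounded interval, on which the polynomials Q and R are bounded, and (y - Q)² ≤ R.
-/
lemma jacobi_jacobi_bounded {p q : ℝ} (h : SplitForm Ω ρ A l r m s β B c e
    (Ioo (-1) 1) D₁ t₁ f₁ γ δ κ
    (Ioo (-1) 1) (fun v => 1 - v ^ 2) (fun v => q - p - (p + q) * v) f₂ E F K C₀) :
    Bornology.IsBounded Ω := by
  obtain ⟨Q, R, hF, hER, -, -⟩ := h.jacobi_polynomials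
  have hcomp : IsCompact {x : ℝ | γ * x + δ ∈ Icc (-1) 1} := by
    have : {x : ℝ | γ * x + δ ∈ Icc (-1) 1} = (fun v => (v - δ) / γ) '' Icc (-1) 1 := by
      have := h.γ_ne
      ext x
      constructor
      · exact fun hx => ⟨γ * x + δ, hx, by field_simp; ring⟩
      · rintro ⟨v, hv, rfl⟩
        rw [mem_ofPred_eq, mul_div_cancel₀ _ this, sub_add_cancel]
        exact hv
    rw [this]
    exact isCompact_Icc.image (by fun_prop)
  obtain ⟨M₁, hM₁⟩ := hcomp.exists_bound_of_continuousOn (f := fun x => Q.eval x)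
    Q.continuous.continuousOn
  obtain ⟨M₂, hM₂⟩ := hcomp.exists_bound_of_continuousOn (f := fun x => R.eval x)
    R.continuous.continuousOn
  refine (hcomp.isBounded.prod (Metric.isBounded_Icc (-(M₁ + M₂ + 1)) (M₁ + M₂ + 1))).subset ?_
  rintro ⟨x, y⟩ hxy
  obtain ⟨hx, hy⟩ := (h.mem_iff _).1 hxy
  simp only at hx hy
  have hx' : x ∈ {x : ℝ | γ * x + δ ∈ Icc (-1) 1} := Ioo_subset_Icc_self hx
  have h1 := abs_le.1 (hM₁ x hx')
  have h2 := (abs_le.1 (hM₂ x hx')).2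
  have h3 := hER x hx
  rw [hF x hx, show E x * y - E x * Q.eval x = E x * (y - Q.eval x) by ring] at hy
  have h4 : (y - Q.eval x) ^ 2 ≤ R.eval x := by
    have h5 : (E x * (y - Q.eval x)) ^ 2 < 1 := by nlinarith [hy.1, hy.2]
    have h6 : 0 < E x ^ 2 := by have := h.E_ne x; positivity
    nlinarith
  refine ⟨hx', abs_le.1 ?_⟩
  have h5 : |y - Q.eval x| ≤ M₂ + 1 := abs_le_of_sq_le_sq' (by nlinarith) (by nlinarith) |> abs_le.2
  rw [abs_le] at h5 ⊢
  constructor <;> linarith [h1.1, h1.2, h5.1, h5.2]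

/-- The case of a domain with a cusp. -/
lemma exists_cusp {a p q : ℝ} (hl : l ≠ 0) (h : SplitForm Ω ρ A l r m s β B c e
    (Ioi 0) (fun v => v) (fun v => a - v) f₁ γ δ κ
    (Ioo (-1) 1) (fun v => 1 - v ^ 2) (fun v => q - p - (p + q) * v) f₂ E F K C₀) :
    ∃ (Q : ℝ[X]) (n : ℕ) (b : ℝ), 1 ≤ n ∧ 0 < b ∧ l = C (κ / γ * n / 2) ∧
      A * derivative Q = l * Q + r ∧
      (∀ x, 0 < γ * x + δ → F x = E x * Q.eval x ∧ E x ^ 2 * (b * ((γ * x + δ) / κ) ^ n) = 1) ∧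
      a = 1 + n / 2 * (p + q - 1) ∧ (Odd n → p = q) ∧ c ≤ 0 := by
  obtain ⟨Q, R, hF, hER, hQ, hR⟩ := h.jacobi_polynomials
  have hγ := h.γ_ne
  have hκ := h.κ_pos
  have hα : κ / γ ≠ 0 := div_ne_zero hκ.ne' hγ
  have hR0 := R_ne_zero h.nonempty_base hER
  obtain ⟨x₀, hx₀⟩ : ∃ x₀, x₀ = -δ / γ := ⟨_, rfl⟩
  have hγx₀ : γ * x₀ + δ = 0 := by rw [hx₀]; field_simp; ring
  have hA : A = C (κ / γ) * (X - C x₀) := funext fun x => by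
    have := h.A_eq x
    simp only [eval_mul, eval_C, eval_sub, eval_X]
    rw [hx₀]
    field_simp
    linarith
  obtain ⟨n, b, hln, hRb⟩ := exists_eq_pow_of_mul_derivative hα hR0 (by rw [← hA]; exact hR)
  have hn : n ≠ 0 := by
    rintro rfl
    exact hl (by rw [hln]; simp)
  have hRx : ∀ x, R.eval x = b * (κ / γ) ^ n * ((γ * x + δ) / κ) ^ n := by
    intro x
    rw [hRb, mul_assoc, ← mul_pow]
    simp only [eval_mul, eval_C, eval_sub, eval_X, eval_pow]
    congr 2
    rw [hx₀]
    field_simp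
    ring
  have hA0 : A.eval x₀ = 0 := by rw [hA]; simp
  have hA' : (derivative A).eval x₀ = κ / γ := by rw [hA]; simp
  have hl' : l.eval x₀ = κ / γ * n / 2 := by rw [hln, eval_C]
  obtain ⟨x₁, hx₁⟩ := h.nonempty_base
  refine ⟨Q, n, b * (κ / γ) ^ n, Nat.one_le_iff_ne_zero.2 hn, ?_, hln, hQ,
    fun x hx => ⟨hF x hx, by rw [← hRx]; exact hER x hx⟩, ?_, ?_, ?_⟩
  · have h1 := hER x₁ hx₁
    rw [hRx, ← mul_assoc] at h1
    have h2 : 0 < E x₁ ^ 2 * (b * (κ / γ) ^ n) * ((γ * x₁ + δ) / κ) ^ n := by rw [h1]; exact one_pos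
    have h3 : 0 < ((γ * x₁ + δ) / κ) ^ n := pow_pos (div_pos hx₁ hκ) n
    have h4 := (mul_pos_iff_of_pos_right h3).1 h2
    exact (mul_pos_iff_of_pos_left (by have := h.E_ne x₁; positivity)).1 h4
  -- The relation between the exponents is this identity at the cusp x₀, where A = 0: it reads β -
  -- A' + l = (p + q) l.
  · have h1 : drift₁ A l β e = C (p + q) * disc₂ A l c := h.poly_eq fun x hx => by
      rw [eval_mul, eval_C, (h.jacobi_disc hx).1, (h.jacobi_drift hx).1]
      ring
    have h2 := congrArg (eval x₀) h1
    simp only [drift₁, disc₂, eval_sub, eval_add, eval_mul, eval_C, eval_pow, hA0, hA', hl',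
      zero_mul, zero_sub] at h2
    have h3 := h.β_eq x₀
    rw [hγx₀, sub_zero] at h3
    have h4 : β.eval x₀ = κ * a / γ := by field_simp; linarith
    rw [h4] at h2
    have hn' : (n : ℝ) ≠ 0 := Nat.cast_ne_zero.2 hn
    have hκ' := hκ.ne'
    field_simp at h2
    linarith
  · intro hodd
    by_contra hpq
    -- Both sides equal (q - p)² K² E². If p ≠ q, then R would be the quotient of two squares of
    -- polynomials, so its order n at x₀ would be even.
    have h1 : (drift₀ A l r β B + C (p + q) * disc₂ A l c * Q) ^ 2 =
        C (q - p) ^ 2 * disc₂ A l c ^ 2 * R := h.poly_eq fun x hx => by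
      simp only [eval_pow, eval_mul, eval_C, eval_add]
      rw [(h.jacobi_disc hx).1, (h.jacobi_drift hx).2, hF x hx]
      linear_combination -(q - p) ^ 2 * (K x * E x) ^ 2 * hER x hx
    have hd : disc₂ A l c ≠ 0 := fun h0 => h.jacobi_disc₂_ne hx₁ (by rw [h0, eval_zero])
    have hqp : (C (q - p) : ℝ[X]) ≠ 0 := C_ne_zero.2 (sub_ne_zero.2 (Ne.symm hpq))
    have hb : b ≠ 0 := by
      rintro rfl
      exact hR0 (by rw [hRb]; simp)
    have hS : C b * (C (q - p) * disc₂ A l c) ^ 2 ≠ 0 :=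
      mul_ne_zero (C_ne_zero.2 hb) (pow_ne_zero 2 (mul_ne_zero hqp hd))
    have hsq : ∀ Z : ℝ[X], rootMultiplicity x₀ (Z ^ 2) = 2 * rootMultiplicity x₀ Z := fun Z => by
      rcases eq_or_ne Z 0 with rfl | hZ
      · simp
      · rw [sq, rootMultiplicity_mul (mul_ne_zero hZ hZ), two_mul]
    have h2 := congrArg (rootMultiplicity x₀) h1
    rw [hRb, show C (q - p) ^ 2 * disc₂ A l c ^ 2 * (C b * (X - C x₀) ^ n) =
      C b * (C (q - p) * disc₂ A l c) ^ 2 * (X - C x₀) ^ n by ring,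
      rootMultiplicity_mul_X_sub_C_pow hS, rootMultiplicity_mul hS, rootMultiplicity_C, zero_add,
      hsq, hsq] at h2
    obtain ⟨j, hj⟩ := hodd
    omega
  · by_contra hc
    rw [not_le] at hc
    -- If c > 0, the point chosen here has A = l² / c + 1, so A c - l² = c > 0, whereas this
    -- quantity equals -K E² < 0.
    have hx : γ * ((γ * ((κ / γ * n / 2) ^ 2 / c + 1) / κ * γ - δ) / γ) + δ =
        γ ^ 2 * ((κ / γ * n / 2) ^ 2 / c + 1) / κ := by
      field_simp
      ring
    set x := (γ * ((κ / γ * n / 2) ^ 2 / c + 1) / κ * γ - δ) / γ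
    have hpos : 0 < γ * x + δ := by
      rw [hx]
      positivity
    have h1 := (h.jacobi_disc (x := x) hpos).1
    have h2 : 0 < K x * E x ^ 2 := mul_pos (h.K_pos x hpos) (by have := h.E_ne x; positivity)
    have h3 : A.eval x = (κ / γ * n / 2) ^ 2 / c + 1 := by
      have := h.A_eq x
      rw [hx] at this
      have hκ' := hκ.ne'
      refine mul_left_cancel₀ (pow_ne_zero 2 hγ) (this.trans ?_)
      field_simp
    simp only [disc₂, eval_sub, eval_mul, eval_C, eval_pow, h3] at h1
    rw [hln, eval_C] at h1
    have h4 : ((κ / γ * n / 2) ^ 2 / c + 1) * c = (κ / γ * n / 2) ^ 2 + c := by field_simp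
    rw [h4] at h1
    linarith

end SplitForm

/-! ### Triangular changes of variables: Jacobian, cometric and density -/

section ChangeOfVariables

/-- The admissible change of variables `(x, y) ↦ (a x + b, d (y - Q(x)))`. -/
noncomputable def triangular (a b d : ℝ) (Q : ℝ[X]) (ha : a ≠ 0) (hd : d ≠ 0) :
    (Fin 2 → ℝ) ≃ (Fin 2 → ℝ) where
  toFun x := ![a * x 0 + b, d * (x 1 - Q.eval (x 0))]
  invFun X := ![(X 0 - b) / a, X 1 / d + Q.eval ((X 0 - b) / a)]
  left_inv x := by
    have h1 : (a * x 0 + b - b) / a = x 0 := by field_simp; ring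
    ext i
    fin_cases i
    · simpa using h1
    · simp only [Fin.mk_one, Matrix.cons_val_one, Matrix.cons_val_zero, h1]
      field_simp
      ring
  right_inv X := by
    ext i
    fin_cases i
    · simp
      field_simp
      ring
    · simp
      field_simp

variable {a b d : ℝ} {Q : ℝ[X]} (ha : a ≠ 0) (hd : d ≠ 0)

lemma triangular_apply (x : Fin 2 → ℝ) :
    triangular a b d Q ha hd x = ![a * x 0 + b, d * (x 1 - Q.eval (x 0))] := rfl

lemma triangular_admissible : IsInftyAdmissible (triangular a b d Q ha hd) :=
  ⟨a, b, d, -(C d * Q), ha, hd, fun x => by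
    rw [triangular_apply, eval_neg, eval_mul, eval_C, mul_sub, sub_eq_add_neg]⟩

/-- The matrix of partial derivatives of a triangular change of variables. -/
noncomputable def triangularMatrix (a d : ℝ) (Q : ℝ[X]) (x : Fin 2 → ℝ) :
    Matrix (Fin 2) (Fin 2) ℝ :=
  !![a, 0; -(d * (derivative Q).eval (x 0)), d]

lemma hasFDerivAt_triangular (x : Fin 2 → ℝ) :
    HasFDerivAt (triangular a b d Q ha hd)
      (LinearMap.toContinuousLinearMap (Matrix.toLin' (triangularMatrix a d Q x))) x := by
  have h0 : HasFDerivAt (fun x : Fin 2 → ℝ => x 0)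
    (ContinuousLinearMap.proj (R := ℝ) (φ := fun _ : Fin 2 => ℝ) 0) x := hasFDerivAt_apply 0 x
  have h1 : HasFDerivAt (fun x : Fin 2 → ℝ => x 1)
    (ContinuousLinearMap.proj (R := ℝ) (φ := fun _ : Fin 2 => ℝ) 1) x := hasFDerivAt_apply 1 x
  rw [hasFDerivAt_pi']
  intro i
  fin_cases i
  · refine ((h0.const_mul a).add_const b).congr_fderiv ?_
    ext v
    simp [triangularMatrix, dotProduct, Fin.sum_univ_two]
  · refine ((h1.sub ((Q.hasDerivAt (x 0)).comp_hasFDerivAt x h0)).const_mul d).congr_fderiv ?_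
    ext v
    simp [triangularMatrix, dotProduct, Fin.sum_univ_two]
    ring

lemma jacobian_triangular (x : Fin 2 → ℝ) :
    jacobian (triangular a b d Q ha hd) x = triangularMatrix a d Q x := by
  ext i k
  have h1 := hasFDerivAt_pi'.1 (hasFDerivAt_triangular (b := b) (Q := Q) ha hd x) i
  rw [jacobian, Matrix.of_apply, partialDeriv, h1.fderiv]
  simp

lemma det_triangularMatrix (x : Fin 2 → ℝ) : (triangularMatrix a d Q x).det = a * d := by
  simp [triangularMatrix, Matrix.det_fin_two]

lemma pushDensity_triangular (ρ : (Fin 2 → ℝ) → ℝ) (x : Fin 2 → ℝ) :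
    pushDensity (triangular a b d Q ha hd) ρ (triangular a b d Q ha hd x) = ρ x / |a * d| := by
  rw [pushDensity, Equiv.symm_apply_apply, jacobian_triangular, det_triangularMatrix]

lemma pushCometric_triangular {g : (Fin 2 → ℝ) → Matrix (Fin 2) (Fin 2) ℝ} {x : Fin 2 → ℝ}
    {g₁₁ g₁₂ g₂₂ : ℝ} (hg : g x = !![g₁₁, g₁₂; g₁₂, g₂₂]) :
    pushCometric (triangular a b d Q ha hd) g (triangular a b d Q ha hd x) =
      !![a ^ 2 * g₁₁, a * d * (g₁₂ - (derivative Q).eval (x 0) * g₁₁);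
        a * d * (g₁₂ - (derivative Q).eval (x 0) * g₁₁),
        d ^ 2 * (g₂₂ - 2 * (derivative Q).eval (x 0) * g₁₂ +
          (derivative Q).eval (x 0) ^ 2 * g₁₁)] := by
  rw [pushCometric, Equiv.symm_apply_apply, jacobian_triangular, hg, triangularMatrix]
  ext i j
  fin_cases i <;> fin_cases j <;>
    simp [Matrix.mul_apply, Fin.sum_univ_two, Matrix.transpose_apply] <;> ring

/-- Conservation of total mass; it identifies the normalizing constants in the new coordinates
without computing them. -/
lemma setIntegral_pushDensity {Ω : Set (Fin 2 → ℝ)} (hΩ : IsOpen Ω) (ρ : (Fin 2 → ℝ) → ℝ) :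
    ∫ X in triangular a b d Q ha hd '' Ω, pushDensity (triangular a b d Q ha hd) ρ X =
      ∫ x in Ω, ρ x := by
  rw [integral_image_eq_integral_abs_det_fderiv_smul volume hΩ.measurableSet
    (fun x _ => (hasFDerivAt_triangular ha hd x).hasFDerivWithinAt)
    (triangular a b d Q ha hd).injective.injOn]
  refine integral_congr_ae (Eventually.of_forall fun x => ?_)
  have h1 : (LinearMap.toContinuousLinearMap (Matrix.toLin' (triangularMatrix a d Q x))).det =
      a * d := by
    rw [← det_triangularMatrix (a := a) (d := d) (Q := Q) x, ContinuousLinearMap.det,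
      LinearMap.coe_toContinuousLinearMap, LinearMap.det_toLin']
  have h2 : |a * d| ≠ 0 := abs_ne_zero.2 (mul_ne_zero ha hd)
  simp only [h1, pushDensity_triangular, smul_eq_mul]
  rw [mul_div_cancel₀ _ h2]

lemma image_triangular {Ω S : Set (Fin 2 → ℝ)}
    (h : ∀ x, x ∈ Ω ↔ triangular a b d Q ha hd x ∈ S) : triangular a b d Q ha hd '' Ω = S := by
  ext X
  constructor
  · rintro ⟨x, hx, rfl⟩
    exact (h x).1 hx
  · intro hX
    obtain ⟨x, rfl⟩ := (triangular a b d Q ha hd).surjective X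
    exact ⟨x, (h x).2 hX, rfl⟩

end ChangeOfVariables

lemma isNormalizationOn_of_eq {E : Type*} [MeasureSpace E] {S : Set E} (hS : MeasurableSet S)
    {ρ f : E → ℝ} {k : ℝ} (h : ∀ x ∈ S, ρ x = k * f x) (h1 : ∫ x in S, ρ x = 1) :
    IsNormalizationOn S ρ f := by
  rw [setIntegral_congr_fun hS h, integral_const_mul] at h1
  intro x hx
  rw [h x hx, eq_div_iff (right_ne_zero_of_mul (h1.trans_ne one_ne_zero))]
  linear_combination f x * h1

lemma StdForm.isClassicalSolution {J : Set ℝ} {D₀ t₀ f₀ : ℝ → ℝ} (h : StdForm J D₀ t₀ f₀) :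
    IsClassicalSolution J D₀ fun x => f₀ x / ∫ y in J, f₀ y := by
  cases h with
  | hermite => exact Or.inl ⟨rfl, fun _ _ => rfl, fun _ _ => rfl⟩
  | laguerre a ha => exact Or.inr (Or.inl ⟨rfl, fun _ _ => rfl, a, ha, fun _ _ => rfl⟩)
  | jacobi p q hp hq =>
    exact Or.inr (Or.inr ⟨rfl, fun _ _ => rfl, p, q, hp, hq, fun _ _ => rfl⟩)

lemma setIntegral_prod_plane {J₁ J₂ : Set ℝ} (h₁ : MeasurableSet J₁) (h₂ : MeasurableSet J₂)
    (f₁ f₂ : ℝ → ℝ) : ∫ X in {X : Fin 2 → ℝ | X 0 ∈ J₁ ∧ X 1 ∈ J₂}, f₁ (X 0) * f₂ (X 1) =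
      (∫ t in J₁, f₁ t) * ∫ t in J₂, f₂ t := by
  have hm : MeasurableSet {X : Fin 2 → ℝ | X 0 ∈ J₁ ∧ X 1 ∈ J₂} :=
    (h₁.preimage (measurable_pi_apply 0)).inter (h₂.preimage (measurable_pi_apply 1))
  rw [← integral_indicator hm, ← integral_indicator h₁, ← integral_indicator h₂,
    ← integral_prod_mul, ← Measure.volume_eq_prod,
    ← integral_plane_comp fun p => J₁.indicator f₁ p.1 * J₂.indicator f₂ p.2]
  refine integral_congr_ae (Eventually.of_forall fun X => ?_)
  by_cases hx : X 0 ∈ J₁ <;> by_cases hy : X 1 ∈ J₂ <;> simp [hx, hy, indicator]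

lemma setIntegral_eq_one {Ω : Set (Fin 2 → ℝ)} (hΩ : IsOpen Ω) {ρ : (Fin 2 → ℝ) → ℝ}
    (h : ∫ p, planeDensity Ω ρ p = 1) : ∫ X in Ω, ρ X = 1 := by
  rw [← h, ← integral_plane_comp, ← integral_indicator hΩ.measurableSet]
  simp only [planeDensity, vec_eta]

/-! ### Translation of the split form into the two cases -/

section Final

variable {Ω : Set (Fin 2 → ℝ)} {ρ : (Fin 2 → ℝ) → ℝ} {g : (Fin 2 → ℝ) → Matrix (Fin 2) (Fin 2) ℝ}
  {A l r m s β B : ℝ[X]} {c e : ℝ}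
  {J₁ : Set ℝ} {D₁ t₁ f₁ : ℝ → ℝ} {γ δ κ : ℝ} {J₂ : Set ℝ} {D₂ t₂ f₂ E F K : ℝ → ℝ} {C₀ : ℝ}

lemma mem_planeDomain (x : Fin 2 → ℝ) : (x 0, x 1) ∈ planeDomain Ω ↔ x ∈ Ω := by
  rw [planeDomain, mem_ofPred_eq]
  simp only [vec_eta]

lemma planeDensity_of_mem {x : Fin 2 → ℝ} (hx : x ∈ Ω) : planeDensity Ω ρ (x 0, x 1) = ρ x := by
  simp only [planeDensity, vec_eta]
  exact indicator_of_mem hx ρ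

lemma det_split (h : SplitForm (planeDomain Ω) (planeDensity Ω ρ) A l r m s β B c e
      J₁ D₁ t₁ f₁ γ δ κ J₂ D₂ t₂ f₂ E F K C₀) {x y : ℝ} (hx : γ * x + δ ∈ J₁) :
    A.eval x * (c * y ^ 2 + m.eval x * y + s.eval x) =
      K x * D₂ (E x * y - F x) + (l.eval x * y + r.eval x) ^ 2 := by
  rw [← h.disc_eq x hx y]
  simp only [disc₂, disc₁, disc₀, eval_sub, eval_mul, eval_pow, eval_C, eval_ofNat]
  ring

/-- The new coordinates are γ x + δ and ε (y - Q(x)). Since A Q' = r, the shift by Q removes the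
off-diagonal coefficient, and ε² K = κ₂ A turns det g into the product form. -/
lemma caseU2_of_split (hΩ : IsOpen Ω) (h1 : ∫ X in Ω, ρ X = 1)
    (hg : ∀ x ∈ Ω, g x = !![A.eval (x 0), l.eval (x 0) * x 1 + r.eval (x 0);
      l.eval (x 0) * x 1 + r.eval (x 0), c * x 1 ^ 2 + m.eval (x 0) * x 1 + s.eval (x 0)])
    (h : SplitForm (planeDomain Ω) (planeDensity Ω ρ) A l r m s β B c e
      J₁ D₁ t₁ f₁ γ δ κ J₂ D₂ t₂ f₂ E F K C₀) (hl : l = 0) :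
    ∃ Φ : (Fin 2 → ℝ) ≃ (Fin 2 → ℝ), IsInftyAdmissible Φ ∧
      IsCaseU2 (Φ '' Ω) (pushCometric Φ g) (pushDensity Φ ρ) := by
  obtain ⟨Q, ε, κ₂, hε, hκ₂, hQ, hx⟩ := h.exists_product hl
  subst hl
  have hmem : ∀ x, x ∈ Ω ↔ triangular γ δ ε Q h.γ_ne hε x ∈ {X | X 0 ∈ J₁ ∧ X 1 ∈ J₂} := by
    intro x
    rw [← mem_planeDomain, h.mem_iff, triangular_apply, mem_ofPred_eq]
    simp only [Matrix.cons_val_zero, Matrix.cons_val_one]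
    refine and_congr_right fun hx0 => ?_
    obtain ⟨h2, h3, -⟩ := hx _ hx0
    rw [h2, h3, mul_sub]
  have himg := image_triangular h.γ_ne hε hmem
  have hJ₁ := h.std₁.isOpen.measurableSet
  have hJ₂ := h.std₂.isOpen.measurableSet
  have hm : MeasurableSet {X : Fin 2 → ℝ | X 0 ∈ J₁ ∧ X 1 ∈ J₂} :=
    (hJ₁.preimage (measurable_pi_apply 0)).inter (hJ₂.preimage (measurable_pi_apply 1))
  have hpt : ∀ x ∈ Ω, γ * x 0 + δ ∈ J₁ ∧ E (x 0) * x 1 - F (x 0) = ε * (x 1 - Q.eval (x 0)) := by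
    intro x hxΩ
    have h2 := ((h.mem_iff (x 0, x 1)).1 ((mem_planeDomain x).2 hxΩ)).1
    obtain ⟨h3, h4, -⟩ := hx _ h2
    exact ⟨h2, by rw [h3, h4, mul_sub]⟩
  have hρ : ∀ X ∈ {X : Fin 2 → ℝ | X 0 ∈ J₁ ∧ X 1 ∈ J₂},
      pushDensity (triangular γ δ ε Q h.γ_ne hε) ρ X =
        C₀ * |ε| / |γ * ε| * (f₁ (X 0) * f₂ (X 1)) := by
    intro X hX
    obtain ⟨x, rfl⟩ := (triangular γ δ ε Q h.γ_ne hε).surjective X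
    have hxΩ := (hmem x).2 hX
    obtain ⟨h2, h3⟩ := hpt x hxΩ
    rw [pushDensity_triangular, ← planeDensity_of_mem (ρ := ρ) hxΩ,
      h.density_eq _ ((mem_planeDomain x).2 hxΩ), triangular_apply]
    simp only [Matrix.cons_val_zero, Matrix.cons_val_one]
    rw [h3, (hx _ h2).1]
    ring
  have hint := setIntegral_pushDensity (b := δ) (Q := Q) h.γ_ne hε hΩ ρ
  rw [h1, himg, setIntegral_congr_fun hm hρ, integral_const_mul,
    setIntegral_prod_plane hJ₁ hJ₂] at hint
  refine ⟨triangular γ δ ε Q h.γ_ne hε, triangular_admissible _ _, J₁, J₂, D₁, D₂, _, _, κ, κ₂,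
    h.std₁.isClassicalSolution, h.std₂.isClassicalSolution, h.κ_pos, hκ₂, himg, ?_, ?_⟩
  · rw [himg]
    intro X hX
    obtain ⟨x, rfl⟩ := (triangular γ δ ε Q h.γ_ne hε).surjective X
    have hxΩ := (hmem x).2 hX
    obtain ⟨h2, h3⟩ := hpt x hxΩ
    have hA0 := (h.A_pos h2).ne'
    have h4 := det_split h (y := x 1) h2
    have h5 := (hx _ h2).2.2
    have h6 : r.eval (x 0) = A.eval (x 0) * (derivative Q).eval (x 0) := by rw [← hQ, eval_mul]
    rw [pushCometric_triangular h.γ_ne hε (hg x hxΩ), triangular_apply]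
    simp only [Matrix.cons_val_zero, Matrix.cons_val_one]
    rw [h.A_eq, ← h3, eval_zero, zero_mul, zero_add, h6]
    rw [eval_zero, zero_mul, zero_add, h6] at h4
    have h7 : ε ^ 2 * (c * x 1 ^ 2 + m.eval (x 0) * x 1 + s.eval (x 0) -
        2 * (derivative Q).eval (x 0) * (A.eval (x 0) * (derivative Q).eval (x 0)) +
        (derivative Q).eval (x 0) ^ 2 * A.eval (x 0)) =
        κ₂ * D₂ (E (x 0) * x 1 - F (x 0)) := by
      refine mul_left_cancel₀ hA0 ?_
      linear_combination ε ^ 2 * h4 + D₂ (E (x 0) * x 1 - F (x 0)) * h5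
    rw [h7, show γ * ε * (A.eval (x 0) * (derivative Q).eval (x 0) -
      (derivative Q).eval (x 0) * A.eval (x 0)) = 0 by ring]
  · rw [himg]
    intro X hX
    rw [hρ X hX]
    have h2 := left_ne_zero_of_mul (right_ne_zero_of_mul (hint.trans_ne one_ne_zero))
    have h3 := right_ne_zero_of_mul (right_ne_zero_of_mul (hint.trans_ne one_ne_zero))
    field_simp
    linear_combination f₁ (X 0) * f₂ (X 1) * hint

/-- Here w = X ^ (-n / 2) plays the role of |E|, up to a constant. The relation between a and t
makes the power of X exactly what is needed to pass from 1 ± w Y to X ^ (n / 2) ± Y, with t the sum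
of the exponents. -/
lemma rpow_cusp {X w a t : ℝ} {n : ℕ} (hX : 0 < X) (hw : 0 < w) (h : w ^ 2 * X ^ n = 1)
    (ha : a = 1 + n / 2 * (t - 1)) : X ^ (a - 1) * w = X ^ ((n : ℝ) / 2 * (t - 2)) := by
  have h1 : w = X ^ (-((n : ℝ) / 2)) := by
    refine (pow_left_inj₀ hw.le (Real.rpow_nonneg hX.le _) two_ne_zero).1 ?_
    rw [← Real.rpow_natCast (X ^ (-((n : ℝ) / 2))) 2, ← Real.rpow_mul hX.le, eq_comm,
      show -((n : ℝ) / 2) * ((2 : ℕ) : ℝ) = -(n : ℝ) by push_cast; ring, Real.rpow_neg hX.le,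
      Real.rpow_natCast]
    exact (eq_inv_of_mul_eq_one_left h).symm
  rw [h1, ← Real.rpow_add hX, ha]
  congr 1
  ring

lemma cusp_density_odd {X Y w a p : ℝ} {n : ℕ} (hX : 0 < X) (hw : 0 < w) (h : w ^ 2 * X ^ n = 1)
    (hY : Y ^ 2 < X ^ n) (ha : a = 1 + n / 2 * (p + p - 1)) :
    X ^ (a - 1) * w * ((1 - w * Y) ^ (p - 1) * (1 + w * Y) ^ (p - 1)) =
      (X ^ n - Y ^ 2) ^ (p - 1) := by
  have h1 : X ^ n - Y ^ 2 = X ^ n * ((1 - w * Y) * (1 + w * Y)) := by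
    linear_combination Y ^ 2 * h
  have h2 : 0 < X ^ n := pow_pos hX n
  have h3 : (w * Y) ^ 2 < 1 := by
    rw [mul_pow, ← h]
    exact mul_lt_mul_of_pos_left hY (pow_pos hw 2)
  have h4 := abs_lt.1 ((sq_lt_one_iff_abs_lt_one _).1 h3)
  rw [rpow_cusp hX hw h ha, h1, Real.mul_rpow h2.le (mul_nonneg (by linarith) (by linarith)),
    Real.mul_rpow (by linarith) (by linarith), ← Real.rpow_natCast, ← Real.rpow_mul hX.le]
  congr 2
  ring

lemma cusp_density_even {X Y w a p q : ℝ} {n : ℕ} (hX : 0 < X) (hw : 0 < w)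
    (h : w ^ 2 * X ^ n = 1) (hn : Even n) (hY : Y ^ 2 < X ^ n)
    (ha : a = 1 + n / 2 * (p + q - 1)) :
    X ^ (a - 1) * w * ((1 - w * Y) ^ (p - 1) * (1 + w * Y) ^ (q - 1)) =
      (X ^ (n / 2) + Y) ^ (q - 1) * (X ^ (n / 2) - Y) ^ (p - 1) := by
  obtain ⟨k, rfl⟩ := hn
  have hk : (k + k) / 2 = k := by omega
  rw [hk]
  have h2 : 0 < X ^ k := pow_pos hX k
  have hwk : w * X ^ k = 1 := by
    refine (pow_left_inj₀ (mul_pos hw h2).le zero_le_one two_ne_zero).1 ?_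
    rw [pow_add] at h
    linear_combination h
  have h3 : (w * Y) ^ 2 < 1 := by
    rw [mul_pow, ← h]
    exact mul_lt_mul_of_pos_left hY (pow_pos hw 2)
  have h4 := abs_lt.1 ((sq_lt_one_iff_abs_lt_one _).1 h3)
  have e1 : X ^ k + Y = X ^ k * (1 + w * Y) := by linear_combination -Y * hwk
  have e2 : X ^ k - Y = X ^ k * (1 - w * Y) := by linear_combination Y * hwk
  rw [rpow_cusp hX hw h ha, e1, e2, Real.mul_rpow h2.le (by linarith),
    Real.mul_rpow h2.le (by linarith), ← Real.rpow_natCast X k, ← Real.rpow_mul hX.le,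
    ← Real.rpow_mul hX.le]
  have e3 : X ^ (((k + k : ℕ) : ℝ) / 2 * (p + q - 2)) =
      X ^ ((k : ℝ) * (q - 1)) * X ^ ((k : ℝ) * (p - 1)) := by
    rw [← Real.rpow_add hX]
    congr 1
    push_cast
    ring
  rw [e3]
  ring

/-- Pure algebra behind (U1), with t = κ / γ, z = Q, q = Q', P = Xⁿ and P' = X ^ (n - 1). The last
entry is recovered from the determinant, dividing by A ≠ 0. -/
lemma cusp_cometric {t X y z q A L g₁₂ g₂₂ b c w d n P P' : ℝ} (ht : t ≠ 0) (hX : X ≠ 0)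
    (hd : d ^ 2 * b = 1) (hA : A = t ^ 2 * X) (hL : L = t * n / 2)
    (hg : g₁₂ = L * y + (A * q - L * z)) (hw : w ^ 2 * P = 1) (hP : P' * X = P)
    (hdet : A * g₂₂ = -(A * c - L ^ 2) * (b * P) * (1 - (w * (d * (y - z))) ^ 2) + g₁₂ ^ 2) :
    !![t⁻¹ ^ 2 * A, t⁻¹ * d * (g₁₂ - q * A); t⁻¹ * d * (g₁₂ - q * A),
      d ^ 2 * (g₂₂ - 2 * q * g₁₂ + q ^ 2 * A)] =
    !![X, n / 2 * (d * (y - z)); n / 2 * (d * (y - z)),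
      n ^ 2 / 4 * P' - c * (P - (d * (y - z)) ^ 2)] := by
  have e1 : t⁻¹ ^ 2 * A = X := by rw [hA]; field_simp
  have e2 : t⁻¹ * d * (g₁₂ - q * A) = n / 2 * (d * (y - z)) := by
    rw [hg, hL]
    field_simp
    ring
  have hA0 : A ≠ 0 := by rw [hA]; positivity
  have e3 : d ^ 2 * (g₂₂ - 2 * q * g₁₂ + q ^ 2 * A) =
      n ^ 2 / 4 * P' - c * (P - (d * (y - z)) ^ 2) := by
    refine mul_left_cancel₀ hA0 ?_
    have h1 : A * (d ^ 2 * (g₂₂ - 2 * q * g₁₂ + q ^ 2 * A)) = (d * (L * (y - z))) ^ 2 +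
        (L ^ 2 - A * c) * (P - (d * (y - z)) ^ 2) := by
      have hg' : L * (y - z) = g₁₂ - A * q := by rw [hg]; ring
      rw [hg']
      linear_combination d ^ 2 * hdet + (L ^ 2 - A * c) * (P - w ^ 2 * P * (d * (y - z)) ^ 2) * hd -
        (L ^ 2 - A * c) * (d * (y - z)) ^ 2 * hw
    rw [h1, ← hP, hL, hA]
    ring
  rw [e1, e2, e3]

/-- The new coordinates are X = (γ x + δ) / κ, scaled so that the first coefficient becomes X, and Y
= (σ / √b) (y - Q), where R = b Xⁿ and σ is the sign of E. The Laguerre factor becomes exp(-κ X), so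
λ = κ, and a > 0 is the lower bound on the exponents. -/
lemma caseU1_of_split (hΩ : IsOpen Ω) (h1 : ∫ X in Ω, ρ X = 1)
    (hg : ∀ x ∈ Ω, g x = !![A.eval (x 0), l.eval (x 0) * x 1 + r.eval (x 0);
      l.eval (x 0) * x 1 + r.eval (x 0), c * x 1 ^ 2 + m.eval (x 0) * x 1 + s.eval (x 0)])
    {a p q : ℝ} (ha : 0 < a) (hp : 0 < p) (hq : 0 < q)
    (h : SplitForm (planeDomain Ω) (planeDensity Ω ρ) A l r m s β B c e
      (Ioi 0) (fun v => v) (fun v => a - v) (fun v => v ^ (a - 1) * Real.exp (-v)) γ δ κ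
      (Ioo (-1) 1) (fun v => 1 - v ^ 2) (fun v => q - p - (p + q) * v)
      (fun v => (1 - v) ^ (p - 1) * (1 + v) ^ (q - 1)) E F K C₀) (hl : l ≠ 0) :
    ∃ Φ : (Fin 2 → ℝ) ≃ (Fin 2 → ℝ), IsInftyAdmissible Φ ∧
      IsCaseU1 (Φ '' Ω) (pushCometric Φ g) (pushDensity Φ ρ) := by
  obtain ⟨Q, n, b, hn, hb, hln, hQ, hx, han, hodd, hc⟩ := h.exists_cusp hl
  obtain ⟨σ, hσ, hσE⟩ := h.E_sign
  have hγ := h.γ_ne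
  have hκ := h.κ_pos
  have hκ' := hκ.ne'
  have hn0 : (0 : ℝ) < n := Nat.cast_pos.2 hn
  have hσ0 : σ ≠ 0 := by
    rintro rfl
    norm_num at hσ
  have hsb : 0 < √b := Real.sqrt_pos.2 hb
  have hsb2 : √b ^ 2 = b := Real.sq_sqrt hb.le
  have ha' : γ / κ ≠ 0 := div_ne_zero hγ hκ'
  have hd' : σ / √b ≠ 0 := div_ne_zero hσ0 hsb.ne'
  have hd2 : (σ / √b) ^ 2 = 1 / b := by rw [div_pow, hσ, hsb2]
  -- the data at a point, in the new coordinates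
  have hpt : ∀ x : Fin 2 → ℝ, 0 < γ * x 0 + δ → ∃ w, 0 < w ∧
      w ^ 2 * (γ / κ * x 0 + δ / κ) ^ n = 1 ∧ |E (x 0)| = w / √b ∧
      E (x 0) * x 1 - F (x 0) = w * (σ / √b * (x 1 - Q.eval (x 0))) := by
    intro x hx0
    obtain ⟨h2, h3⟩ := hx _ hx0
    refine ⟨|E (x 0)| * √b, mul_pos (abs_pos.2 (h.E_ne _)) hsb, ?_, ?_, ?_⟩
    · rw [← h3, mul_pow, sq_abs, hsb2, show γ / κ * x 0 + δ / κ = (γ * x 0 + δ) / κ by ring]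
      ring
    · field_simp
    · rw [h2, hσE]
      field_simp
      linear_combination -(E (x 0) * (x 1 - Q.eval (x 0))) * hσ
  set Φ := triangular (γ / κ) (δ / κ) (σ / √b) Q ha' hd' with hΦ
  set S : Set (Fin 2 → ℝ) := {X | 0 < X 0 ∧ X 1 ^ 2 < X 0 ^ n} with hS
  have hpos : ∀ x : Fin 2 → ℝ, 0 < γ / κ * x 0 + δ / κ ↔ 0 < γ * x 0 + δ := fun x => by
    rw [show γ / κ * x 0 + δ / κ = (γ * x 0 + δ) / κ by ring]
    exact div_pos_iff_of_pos_right hκ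
  have hmem : ∀ x, x ∈ Ω ↔ Φ x ∈ S := by
    intro x
    rw [← mem_planeDomain, h.mem_iff, hΦ, triangular_apply, hS, mem_ofPred_eq]
    simp only [Matrix.cons_val_zero, Matrix.cons_val_one, mem_Ioi]
    rw [hpos]
    refine and_congr_right fun hx0 => ?_
    obtain ⟨w, hw, hw1, -, hv⟩ := hpt x hx0
    rw [hv]
    have h2 : ∀ Y : ℝ, w * Y ∈ Ioo (-1 : ℝ) 1 ↔ (w * Y) ^ 2 < 1 := fun Y => by
      rw [sq_lt_one_iff_abs_lt_one, abs_lt]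
      rfl
    rw [h2, mul_pow, ← hw1]
    exact mul_lt_mul_iff_right₀ (pow_pos hw 2)
  have himg : Φ '' Ω = S := image_triangular ha' hd' hmem
  have hSm : MeasurableSet S := ((isOpen_lt continuous_const (continuous_apply 0)).inter
    (isOpen_lt ((continuous_apply 1).pow 2) ((continuous_apply 0).pow n))).measurableSet
  have hint : ∫ X in S, pushDensity Φ ρ X = 1 := by
    rw [← himg, ← h1]
    exact setIntegral_pushDensity ha' hd' hΩ ρ
  have hρ : ∀ X ∈ S, ∃ w, 0 < w ∧ w ^ 2 * X 0 ^ n = 1 ∧ pushDensity Φ ρ X =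
      C₀ / √b * κ ^ (a - 1) / |γ / κ * (σ / √b)| * (X 0 ^ (a - 1) * w *
        ((1 - w * X 1) ^ (p - 1) * (1 + w * X 1) ^ (q - 1)) * Real.exp (-κ * X 0)) := by
    intro X hX
    obtain ⟨x, rfl⟩ := Φ.surjective X
    have hxΩ := (hmem x).2 hX
    have hx0 := (hpos x).1 hX.1
    obtain ⟨w, hw, hw1, hwE, hv⟩ := hpt x hx0
    refine ⟨w, hw, hw1, ?_⟩
    rw [hΦ, pushDensity_triangular, ← planeDensity_of_mem (ρ := ρ) hxΩ,
      h.density_eq _ ((mem_planeDomain x).2 hxΩ), triangular_apply]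
    simp only [Matrix.cons_val_zero, Matrix.cons_val_one]
    have h3 : γ * x 0 + δ = κ * (γ / κ * x 0 + δ / κ) := by field_simp
    rw [hv, hwE, h3, Real.mul_rpow hκ.le ((hpos x).2 hx0).le, neg_mul]
    ring
  refine ⟨Φ, triangular_admissible _ _, n, c, hn, hc, himg, ?_, ?_⟩
  · rw [himg]
    intro X hX
    obtain ⟨x, rfl⟩ := Φ.surjective X
    have hxΩ := (hmem x).2 hX
    have hx0 := (hpos x).1 hX.1
    have hX0 := hX.1
    obtain ⟨w, hw, hw1, hwE, hv⟩ := hpt x hx0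
    rw [hΦ, pushCometric_triangular ha' hd' (hg x hxΩ)]
    rw [hΦ, triangular_apply] at hX0
    simp only [triangular_apply, Matrix.cons_val_zero, Matrix.cons_val_one] at hX0 ⊢
    have hAX : A.eval (x 0) = κ ^ 2 / γ ^ 2 * (γ / κ * x 0 + δ / κ) := by
      have := h.A_eq (x 0)
      field_simp
      linarith
    have hlx : l.eval (x 0) = κ / γ * n / 2 := by rw [hln, eval_C]
    have hrx : r.eval (x 0) = A.eval (x 0) * (derivative Q).eval (x 0) -
        κ / γ * n / 2 * Q.eval (x 0) := by
      rw [← hlx, ← eval_mul, ← eval_mul, hQ, eval_add]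
      ring
    have hdet := det_split h (y := x 1) hx0
    have hK : K (x 0) = -(disc₂ A l c).eval (x 0) * (b * (γ / κ * x 0 + δ / κ) ^ n) := by
      have h3 := (hx _ hx0).2
      rw [(h.jacobi_disc hx0).1, show γ / κ * x 0 + δ / κ = (γ * x 0 + δ) / κ by ring]
      linear_combination -K (x 0) * h3
    rw [hK, hv] at hdet
    simp only [disc₂, eval_sub, eval_mul, eval_pow, eval_C] at hdet
    rw [← inv_div κ γ]
    rw [← inv_div κ γ] at hX0 hdet hw1
    refine cusp_cometric (div_ne_zero hκ' hγ) hX0.ne' (b := b) (by rw [hd2]; field_simp)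
      (by rw [hAX, div_pow, inv_div]) hlx (by rw [hrx, hlx]) hw1
      (by rw [← pow_succ, Nat.sub_add_cancel hn]) hdet
  · rw [himg]
    rcases Nat.even_or_odd n with hev | hod
    -- The exponents are exchanged: in the Jacobi weight q belongs to 1 + v, which becomes X ^ (n /
    -- 2) + Y.
    · refine Or.inr ⟨hev, q, p, κ, hκ, hq, hp, ?_, ?_⟩
      · rw [han] at ha
        field_simp at ha ⊢
        linarith
      · refine isNormalizationOn_of_eq hSm
          (k := C₀ / √b * κ ^ (a - 1) / |γ / κ * (σ / √b)|) (fun X hX => ?_) hint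
        obtain ⟨w, hw, hw1, hXρ⟩ := hρ X hX
        rw [hXρ, cusp_density_even hX.1 hw hw1 hev hX.2 han]
    · obtain rfl := hodd hod
      refine Or.inl ⟨hod, p, κ, hκ, max_lt hp ?_, ?_⟩
      · rw [han] at ha
        field_simp at ha ⊢
        linarith
      · refine isNormalizationOn_of_eq hSm
          (k := C₀ / √b * κ ^ (a - 1) / |γ / κ * (σ / √b)|) (fun X hX => ?_) hint
        obtain ⟨w, hw, hw1, hXρ⟩ := hρ X hX
        rw [hXρ, cusp_density_odd hX.1 hw hw1 hX.2 han]

end Final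

end SDOP

theorem theorem6p4 (Ω : Set (Fin 2 → ℝ)) (g : (Fin 2 → ℝ) → Matrix (Fin 2) (Fin 2) ℝ)
    (ρ : (Fin 2 → ℝ) → ℝ) (hsol : IsInftySDOPTriple Ω g ρ)
    (hunb : ¬ Bornology.IsBounded Ω) :
    ∃ Φ : (Fin 2 → ℝ) ≃ (Fin 2 → ℝ), IsInftyAdmissible Φ ∧
      (IsCaseU1 (Φ '' Ω) (pushCometric Φ g) (pushDensity Φ ρ) ∨
        IsCaseU2 (Φ '' Ω) (pushCometric Φ g) (pushDensity Φ ρ)) := by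
  obtain ⟨w, hw, b, h⟩ := hsol
  obtain ⟨A, l, r, m, s, β, B, c, e, ws, hg⟩ := SDOP.exists_weakSolution hw h
  have hΩ : IsOpen Ω := h.naturalDomain.1
  have h1 := SDOP.setIntegral_eq_one hΩ ws.integral_one
  obtain ⟨J₁, D₁, t₁, f₁, γ, δ, κ, J₂, D₂, t₂, f₂, E, F, K, C₀, hs⟩ := ws.exists_splitForm
  by_cases hl : l = 0
  · obtain ⟨Φ, hΦ, hU⟩ := SDOP.caseU2_of_split hΩ h1 hg hs hl
    exact ⟨Φ, hΦ, Or.inr hU⟩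
  cases hs.std₂ with
  | hermite => exact (SDOP.SplitForm.hermite_false hl hs).elim
  | laguerre a ha => exact (SDOP.SplitForm.laguerre_false hl hs).elim
  | jacobi p q hp hq =>
    cases hs.std₁ with
    | hermite => exact (SDOP.SplitForm.hermite_jacobi_false hl hs).elim
    | laguerre a ha =>
      obtain ⟨Φ, hΦ, hU⟩ := SDOP.caseU1_of_split hΩ h1 hg ha hp hq hs hl
      exact ⟨Φ, hΦ, Or.inl hU⟩
    | jacobi p' q' hp' hq' =>
      -- The only place where unboundedness is used: for l ≠ 0, Jacobi over Jacobi is a bounded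
      -- domain.
      refine (hunb ?_).elim
      have hb := hs.jacobi_jacobi_bounded
      obtain ⟨M, hM⟩ := hb.exists_norm_le
      rw [isBounded_iff_forall_norm_le]
      refine ⟨M, fun X hX => ?_⟩
      have h3 := hM _ ((SDOP.mem_planeDomain X).2 hX)
      have h4 := (norm_nonneg _).trans h3
      rw [pi_norm_le_iff_of_nonneg h4]
      intro i
      fin_cases i
      · exact (norm_fst_le (X 0, X 1)).trans h3
      · exact (norm_snd_le (X 0, X 1)).trans h3
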